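/- **Setting.** Let $\mu$ be a probability measure and $L$ a (not necessarily symmetric) diffusion generator, defined on an algebra $\mathcal A$ of bounded measurable functions which contains the constants and is dense in $L^2(\mu)$, with values in $L^2(\mu)$ and such that $\int Lf\,d\mu=0$ for $f\in\mathcal A$. Put $\Gamma(f,g)=L(fg)-fLg-gLf$ and $\Gamma(f)=\Gamma(f,f)$, and assume that $\Gamma(f)\ge 0$, that $\Gamma(fg,h)=f\,\Gamma(g,h)+g\,\Gamma(f,h)$ $\mu$-a.e. for $f,g,h\in\mathcal A$, and that the form $f\mapsto\int\Gamma(f)\,d\mu$ on $\mathcal A$ is closable in $L^2(\mu)$ (automatic if $L$ is symmetric). Its closure, the Dirichlet form, is still written $\int\Gamma(f)\,d\mu$. Let $D_2(L)$ be the domain of the Friedrichs extension, i.e. the set of those $f$ in the domain of the Dirichlet form for which there is $g\in L^2(\mu)$ with $\int\Gamma(f,h)\,d\mu=-2\int g\,h\,d\mu$ for all $h\in\mathcal A$. $\mathrm{Osc}(u)$ denotes the essential oscillation $\operatorname{ess\,sup}u-\operatorname{ess\,inf}u\in[0,\infty]$. One says that $\mu$ satisfies * the *Hellinger inequality* with function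 $\beta$ if, for all $s>0$ and all $f\in D_2(L)$, $$\Big(\int f^4\,d\mu\Big)^{1/2}-\int f^2\,d\mu\ \le\ \beta(s)\int\Gamma(f)\,d\mu+s\,\mathrm{Osc}(f^2);$$ * the *weak Poincaré inequality* with function $\beta_{WP}$ if, for all $s>0$ and all bounded $f\in D_2(L)$, $$\mathrm{Var}_\mu(f)\ \le\ \beta_{WP}(s)\int\Gamma(f)\,d\mu+s\,\mathrm{Osc}(f)^2;$$ * the *super-Poincaré inequality* with function $\beta_{SP}$ if, for all $s\ge 1$ and all $f\in D_2(L)$, $$\int f^2\,d\mu\ \le\ \beta_{SP}(s)\int\Gamma(f)\,d\mu+s\Big(\int|f|\,d\mu\Big)^2 .$$ **Statement.** Let $\beta_H:(0,\infty)\to[0,\infty)$ be non-increasing and put $$\gamma_H(s)=s^{1/2}\,\beta_H\Big(\frac{\sqrt2-1}{2\sqrt2}\,s^{1/2}\Big),\qquad s>0 .$$ 1. Suppose that $\gamma_H$ is non-increasing on $(0,1/2)$. If $\mu$ satisfies the Hellinger inequality with $\beta_H$, then $\mu$ satisfies the weak Poincaré inequality with $\beta_{WP}(s)=12\,\gamma_H(s)$.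 Conversely, there are universal constants $c,c'>0$ (depending neither on $\mu$, $L$ nor on $\beta_H$) such that this weak Poincaré inequality implies the Hellinger inequality with the function $s\mapsto c\,\beta_H(c's)$. 2. Put $\theta_H(s)=\gamma_H(1/s)$ and suppose that $\theta_H$ is non-increasing on $[2,\infty)$ and that $s\mapsto s\,\theta_H(s)$ is non-decreasing on $(2,\infty)$. If $\mu$ satisfies the Hellinger inequality with $\beta_H$, then $\mu$ satisfies the super-Poincaré inequality with $\beta_{SP}(s)=8\,\gamma_H(1/s)$ for $s\ge2$ and $\beta_{SP}(s)=8\,\gamma_H(1/2)$ for $1\le s\le2$. -/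

import Mathlib

open MeasureTheory Filter Topology

universe u

/-- The carré du champ `Γ(f, g) = L(fg) - f Lg - g Lf` of an operator `L` defined on an algebra `A`
of functions (normalised without a factor `1/2`). -/
def carreDuChamp {X : Type u} {A : Subalgebra ℝ (X → ℝ)} (L : A →ₗ[ℝ] (X → ℝ)) (f g : A) :
    X → ℝ :=
  fun x => L (f * g) x - (f : X → ℝ) x * L g x - (g : X → ℝ) x * L f x

/-- The pre-Dirichlet form `∫ Γ(f, g) dμ` on the algebra `A`. -/
noncomputable def preForm {X : Type u} [MeasurableSpace X] (μ : Measure X)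
    {A : Subalgebra ℝ (X → ℝ)} (L : A →ₗ[ℝ] (X → ℝ)) (f g : A) : ℝ :=
  ∫ x, carreDuChamp L f g x ∂μ

/-- A sequence of elements of `A` that is Cauchy for `f ↦ (∫ Γ(f) dμ)^{1/2}`. -/
def IsFormCauchy {X : Type u} [MeasurableSpace X] (μ : Measure X)
    {A : Subalgebra ℝ (X → ℝ)} (L : A →ₗ[ℝ] (X → ℝ)) (a : ℕ → A) : Prop :=
  ∀ ε : ℝ, 0 < ε → ∃ N : ℕ, ∀ m ≥ N, ∀ n ≥ N, preForm μ L (a m - a n) (a m - a n) < ε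

/-- The framework: a diffusion generator `L` with invariant measure `μ`, given on an algebra `A` of
bounded functions containing the constants. The carré du champ is nonnegative and is a derivation,
and the form `f ↦ ∫ Γ(f) dμ` on `A` is closable in `L²(μ)`, so that it has a closure (the Dirichlet
form) and `L` has a Friedrichs extension. Closability is automatic when `L` is symmetric in
`L²(μ)`; symmetry itself is not assumed. For `f : A`, the function `L f` is a representative of the
corresponding element of `L²(μ)`. -/
structure DiffusionGenerator (X : Type u) [MeasurableSpace X] (μ : Measure X) where
  /-- the algebra of nice functions; as a subalgebra of `X → ℝ` it contains the constants -/
  A : Subalgebra ℝ (X → ℝ)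
  measurable_of_mem : ∀ f ∈ A, Measurable f
  bounded_of_mem : ∀ f ∈ A, ∃ C : ℝ, ∀ x, |f x| ≤ C
  /-- `A` is dense in `L²(μ)` -/
  dense : ∀ f : X → ℝ, MemLp f 2 μ → ∀ ε : ENNReal, 0 < ε → ∃ a ∈ A, eLpNorm (f - a) 2 μ < ε
  /-- the generator -/
  L : A →ₗ[ℝ] (X → ℝ)
  memLp_L : ∀ f : A, MemLp (L f) 2 μ
  /-- `μ` is invariant -/
  integral_L : ∀ f : A, ∫ x, L f x ∂μ = 0
  carre_nonneg : ∀ f : A, ∀ᵐ x ∂μ, 0 ≤ carreDuChamp L f f x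
  /-- `Γ(fg, h) = f Γ(g, h) + g Γ(f, h)` -/
  derivation : ∀ f g h : A, ∀ᵐ x ∂μ, carreDuChamp L (f * g) h x =
    (f : X → ℝ) x * carreDuChamp L g h x + (g : X → ℝ) x * carreDuChamp L f h x
  closable : ∀ a : ℕ → A,
    Tendsto (fun n => eLpNorm (a n : X → ℝ) 2 μ) atTop (𝓝 0) → IsFormCauchy μ L a →
    Tendsto (fun n => preForm μ L (a n) (a n)) atTop (𝓝 0)

namespace DiffusionGenerator

variable {X : Type u} [MeasurableSpace X] {μ : Measure X}

/-- `a n → f` in the graph norm of the form: `a n → f` in `L²(μ)` and `a` is Cauchy for the form.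
A function `f ∈ L²(μ)` is in the domain of the Dirichlet form iff such a sequence exists. -/
def IsApprox (S : DiffusionGenerator X μ) (f : X → ℝ) (a : ℕ → S.A) : Prop :=
  Tendsto (fun n => eLpNorm (f - (a n : X → ℝ)) 2 μ) atTop (𝓝 0) ∧ IsFormCauchy μ S.L a

open Classical in
/-- `∫ Γ(f) dμ` for `f` in the domain of the Dirichlet form: the limit of `∫ Γ(a n) dμ` along an
approximating sequence. It does not depend on the sequence, see `tendsto_energy`. -/
noncomputable def energy (S : DiffusionGenerator X μ) (f : X → ℝ) : ℝ :=
  if h : ∃ a, S.IsApprox f a then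
    limUnder atTop (fun n => preForm μ S.L (h.choose n) (h.choose n)) else 0

/-- `D₂(L)`, the domain of the Friedrichs extension of `L`: those `f` in the domain of the Dirichlet
form for which there is `g ∈ L²(μ)` (the value of the extension at `f`) with
`∫ Γ(f, h) dμ = -2 ∫ g h dμ` for all `h ∈ A` (equivalently, for all `h` in the form domain). -/
def friedrichsDomain (S : DiffusionGenerator X μ) : Set (X → ℝ) :=
  {f | MemLp f 2 μ ∧ ∃ a : ℕ → S.A, S.IsApprox f a ∧ ∃ g : X → ℝ, MemLp g 2 μ ∧
    ∀ h : S.A, Tendsto (fun n => preForm μ S.L (a n) h) atTop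
      (𝓝 (-2 * ∫ x, g x * (h : X → ℝ) x ∂μ))}

theorem integrable_carre (S : DiffusionGenerator X μ) [IsFiniteMeasure μ] (f g : S.A) :
    Integrable (carreDuChamp S.L f g) μ := by
  have key : ∀ (f g : S.A), Integrable (fun x => (f : X → ℝ) x * S.L g x) μ := by
    intro f g
    obtain ⟨C, hC⟩ := S.bounded_of_mem f f.2
    exact ((S.memLp_L g).integrable one_le_two).bdd_mul
      (S.measurable_of_mem f f.2).aestronglyMeasurable
      (Eventually.of_forall (fun x => by simpa using hC x))
  exact ((((S.memLp_L (f * g)).integrable one_le_two).sub (key f g)).sub (key g f))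

theorem preForm_add_smul (S : DiffusionGenerator X μ) [IsFiniteMeasure μ] (f g : S.A) (t : ℝ) :
    preForm μ S.L (f + t • g) (f + t • g) =
      preForm μ S.L f f + 2 * t * preForm μ S.L f g + t ^ 2 * preForm μ S.L g g := by
  have h : ∀ x, carreDuChamp S.L (f + t • g) (f + t • g) x =
      carreDuChamp S.L f f x + 2 * t * carreDuChamp S.L f g x
        + t ^ 2 * carreDuChamp S.L g g x := by
    intro x
    have e : (f + t • g) * (f + t • g) = f * f + (2 * t) • (f * g) + (t ^ 2) • (g * g) := by
      ext y
      simp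
      ring
    simp only [carreDuChamp, e, map_add, map_smul, Pi.add_apply, Pi.smul_apply, smul_eq_mul,
      Subalgebra.coe_add, Subalgebra.coe_smul]
    ring
  have i1 := S.integrable_carre f f
  have i2 := (S.integrable_carre f g).const_mul (2 * t)
  have i3 := (S.integrable_carre g g).const_mul (t ^ 2)
  have i12 : Integrable (fun x => carreDuChamp S.L f f x + 2 * t * carreDuChamp S.L f g x) μ :=
    i1.add i2
  simp only [preForm, h]
  rw [integral_add i12 i3, integral_add i1 i2, integral_const_mul, integral_const_mul]

theorem preForm_nonneg (S : DiffusionGenerator X μ) (f : S.A) : 0 ≤ preForm μ S.L f f :=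
  integral_nonneg_of_ae (S.carre_nonneg f)

theorem sqrt_preForm_add_le (S : DiffusionGenerator X μ) [IsFiniteMeasure μ] (f g : S.A) :
    √(preForm μ S.L (f + g) (f + g)) ≤ √(preForm μ S.L f f) + √(preForm μ S.L g g) := by
  have hf := S.preForm_nonneg f
  have hg := S.preForm_nonneg g
  have hd : discrim (preForm μ S.L g g) (2 * preForm μ S.L f g) (preForm μ S.L f f) ≤ 0 := by
    apply discrim_le_zero
    intro t
    have := S.preForm_nonneg (f + t • g)
    rw [preForm_add_smul] at this
    nlinarith
  have h1 := S.preForm_add_smul f g 1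
  simp only [one_smul] at h1
  have hcs : preForm μ S.L f g ≤ √(preForm μ S.L f f) * √(preForm μ S.L g g) := by
    rw [← Real.sqrt_mul hf]
    apply Real.le_sqrt_of_sq_le
    unfold discrim at hd
    nlinarith
  rw [h1]
  apply Real.sqrt_le_iff.2
  refine ⟨by positivity, ?_⟩
  nlinarith [Real.sq_sqrt hf, Real.sq_sqrt hg]

theorem abs_sqrt_preForm_sub_le (S : DiffusionGenerator X μ) [IsFiniteMeasure μ] (f g : S.A) :
    |√(preForm μ S.L f f) - √(preForm μ S.L g g)| ≤ √(preForm μ S.L (f - g) (f - g)) := by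
  have h1 := S.sqrt_preForm_add_le (f - g) g
  have h2 := S.sqrt_preForm_add_le f ((-2 : ℝ) • (f - g) + (f - g))
  have h3 := S.preForm_add_smul 0 (f - g) (-1)
  have e1 : preForm μ S.L (0 + (-1 : ℝ) • (f - g)) (0 + (-1 : ℝ) • (f - g)) =
      preForm μ S.L (f - g) (f - g) := by
    rw [h3]
    simp [preForm, carreDuChamp]
  have e2 : (-2 : ℝ) • (f - g) + (f - g) = 0 + (-1 : ℝ) • (f - g) := by module
  have e3 : f + (0 + (-1 : ℝ) • (f - g)) = g := by module
  rw [e2, e1, e3] at h2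
  rw [sub_add_cancel] at h1
  rw [abs_le]
  constructor <;> linarith

/-- The energy is the limit along every approximating sequence. -/
theorem tendsto_energy (S : DiffusionGenerator X μ) [IsFiniteMeasure μ] {f : X → ℝ}
    (hf : MemLp f 2 μ) {a : ℕ → S.A} (ha : S.IsApprox f a) :
    Tendsto (fun n => preForm μ S.L (a n) (a n)) atTop (𝓝 (S.energy f)) := by
  have cau : ∀ b : ℕ → S.A, IsFormCauchy μ S.L b →
      ∃ l, Tendsto (fun n => √(preForm μ S.L (b n) (b n))) atTop (𝓝 l) := by
    intro b hb
    apply cauchySeq_tendsto_of_complete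
    rw [Metric.cauchySeq_iff]
    intro ε hε
    obtain ⟨N, hN⟩ := hb (ε ^ 2) (by positivity)
    refine ⟨N, fun m hm n hn => ?_⟩
    rw [Real.dist_eq]
    refine (S.abs_sqrt_preForm_sub_le _ _).trans_lt ?_
    rw [Real.sqrt_lt' hε]
    exact hN m hm n hn
  have sq : ∀ (b : ℕ → S.A) (l : ℝ),
      Tendsto (fun n => √(preForm μ S.L (b n) (b n))) atTop (𝓝 l) →
      Tendsto (fun n => preForm μ S.L (b n) (b n)) atTop (𝓝 (l ^ 2)) := by
    intro b l h
    refine (h.pow 2).congr (fun n => ?_)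
    exact Real.sq_sqrt (S.preForm_nonneg _)
  have hex : ∃ b, S.IsApprox f b := ⟨a, ha⟩
  set b := hex.choose with hb
  have hbA : S.IsApprox f b := hex.choose_spec
  obtain ⟨l, hl⟩ := cau b hbA.2
  have hen : S.energy f = l ^ 2 := by
    rw [energy, dif_pos hex]
    exact (sq b l hl).limUnder_eq
  have hdiff : Tendsto (fun n => preForm μ S.L (a n - b n) (a n - b n)) atTop (𝓝 0) := by
    apply S.closable
    · have hsum := ha.1.add hbA.1
      rw [add_zero] at hsum
      refine tendsto_of_tendsto_of_tendsto_of_le_of_le tendsto_const_nhds hsum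
        (fun _ => zero_le) (fun n => ?_)
      have e : ((a n - b n : S.A) : X → ℝ) = (f - (b n : X → ℝ)) - (f - (a n : X → ℝ)) := by
        rw [Subalgebra.coe_sub]
        abel
      have ma := hf.1.sub (S.measurable_of_mem _ (a n).2).aestronglyMeasurable
      have mb := hf.1.sub (S.measurable_of_mem _ (b n).2).aestronglyMeasurable
      rw [e]
      refine (eLpNorm_sub_le mb ma one_le_two).trans ?_
      rw [add_comm]
    · intro ε hε
      obtain ⟨N, hN⟩ := ha.2 (ε / 4) (by positivity)
      obtain ⟨M, hM⟩ := hbA.2 (ε / 4) (by positivity)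
      refine ⟨max N M, fun m hm n hn => ?_⟩
      have x1 := hN m (le_of_max_le_left hm) n (le_of_max_le_left hn)
      have x2 := hM n (le_of_max_le_right hn) m (le_of_max_le_right hm)
      have x3 := S.sqrt_preForm_add_le (a m - a n) (b n - b m)
      have e : a m - a n + (b n - b m) = a m - b m - (a n - b n) := by abel
      rw [e] at x3
      have y1 := Real.sqrt_lt_sqrt (S.preForm_nonneg _) x1
      have y2 := Real.sqrt_lt_sqrt (S.preForm_nonneg _) x2
      have y3 := x3.trans_lt (add_lt_add y1 y2)
      have y4 : √(ε / 4) + √(ε / 4) = √ε := by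
        rw [show ε / 4 = ε / 2 ^ 2 by norm_num, Real.sqrt_div' _ (by positivity),
          Real.sqrt_sq (by norm_num)]
        ring
      rw [y4] at y3
      exact lt_of_not_ge fun hc => absurd (Real.sqrt_le_sqrt hc) (not_le.2 y3)
  have hs : Tendsto (fun n => √(preForm μ S.L (a n) (a n))) atTop (𝓝 l) := by
    have h0 : Tendsto (fun n => √(preForm μ S.L (a n - b n) (a n - b n))) atTop (𝓝 0) := by
      have := (Real.continuous_sqrt.tendsto 0).comp hdiff
      rwa [Real.sqrt_zero] at this
    have h1 : Tendsto (fun n => √(preForm μ S.L (a n) (a n)) - √(preForm μ S.L (b n) (b n)))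
        atTop (𝓝 0) :=
      squeeze_zero_norm (fun n => S.abs_sqrt_preForm_sub_le _ _) h0
    simpa using h1.add hl
  rw [hen]
  exact sq a l hs

end DiffusionGenerator

/-- The (essential) oscillation `sup u - inf u` of an essentially bounded function. -/
noncomputable def osc {X : Type u} [MeasurableSpace X] (μ : Measure X) (u : X → ℝ) : ℝ :=
  essSup u μ - essInf u μ

/-- Essentially bounded functions. -/
def EssBounded {X : Type u} [MeasurableSpace X] (μ : Measure X) (f : X → ℝ) : Prop :=
  ∃ C : ℝ, ∀ᵐ x ∂μ, |f x| ≤ C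

namespace DiffusionGenerator

variable {X : Type u} [MeasurableSpace X] {μ : Measure X}

/-- The Hellinger inequality
`(∫ f⁴ dμ)^{1/2} - ∫ f² dμ ≤ β(s) ∫ Γ(f) dμ + s Osc(f²)` for all `s > 0` and `f ∈ D₂(L)`. If `f` is
not essentially bounded, then `Osc(f²) = +∞` and there is nothing to require. -/
def Hellinger (S : DiffusionGenerator X μ) (β : ℝ → ℝ) : Prop :=
  ∀ s : ℝ, 0 < s → ∀ f ∈ S.friedrichsDomain, EssBounded μ f →
    Real.sqrt (∫ x, f x ^ 4 ∂μ) - ∫ x, f x ^ 2 ∂μ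
      ≤ β s * S.energy f + s * osc μ (fun x => f x ^ 2)

/-- The weak Poincaré inequality `Var_μ(f) ≤ β(s) ∫ Γ(f) dμ + s Osc(f)²` for all `s > 0` and all
bounded `f ∈ D₂(L)`. -/
def WeakPoincare (S : DiffusionGenerator X μ) (β : ℝ → ℝ) : Prop :=
  ∀ s : ℝ, 0 < s → ∀ f ∈ S.friedrichsDomain, EssBounded μ f →
    ProbabilityTheory.variance f μ ≤ β s * S.energy f + s * osc μ f ^ 2

/-- The super-Poincaré inequality `∫ f² dμ ≤ β(s) ∫ Γ(f) dμ + s (∫ |f| dμ)²` for all `s ≥ 1` and all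
`f ∈ D₂(L)`. -/
def SuperPoincare (S : DiffusionGenerator X μ) (β : ℝ → ℝ) : Prop :=
  ∀ s : ℝ, 1 ≤ s → ∀ f ∈ S.friedrichsDomain,
    ∫ x, f x ^ 2 ∂μ ≤ β s * S.energy f + s * (∫ x, |f x| ∂μ) ^ 2

end DiffusionGenerator

/-- `γ_H(s) = s^{1/2} β_H(((√2 - 1) / (2 √2)) s^{1/2})`. -/
noncomputable def gammaH (β : ℝ → ℝ) (s : ℝ) : ℝ :=
  Real.sqrt s * β ((Real.sqrt 2 - 1) / (2 * Real.sqrt 2) * Real.sqrt s)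

/-! ### Chain rule for polynomials of an element of the algebra -/

namespace DiffusionGenerator

variable {X : Type u} [MeasurableSpace X] {μ : Measure X}

/-! Every implication passes through the capacities of the level sets of some a ∈ A. Test functions
that depend on a alone rise from a value α on {a ≤ 0} to 1 on {a ≥ c}. Inserted in the given
inequality, they bound the measure T(c) of {a ≥ c} by a decreasing function of the resistance R(c)
between the two sets. For the Hellinger inequality the lower bound comes from duality: √∫φ⁴ ≥ ∫ φ²η
whenever ∫ η² ≤ 1, with η adapted to the two sets (`le_sqrt_integral_pow_four_sub`). The
monotonicity of γ_H turns β_H(t) into at most θ/t on a range of t (`HellingerRate`), and t is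
optimised inside that range. For the weak Poincaré inequality the variance of the test function
gives a bound on √T(c) instead.

Capacity bounds become integral bounds through a Hardy inequality (`discrete_hardy`, `hardy`). Let
e(c) be the energy density at level c, so that R' = 1/e, and suppose T ≤ C(p(R) - q(R)) with q' ≤
-p². Integrating by parts and completing the square, ∫ 2c(p - q) dc ≤ ∫ (2cp - c²p²/e) dc ≤ ∫ e dc,
while ∫ 2c T(c) dc is the second moment of the positive part by the layer cake formula. For the
Hellinger inequality the constant C is 54.6, and 54.6 (√2 - 1)/(2√2) < 8.

For weak Poincaré, a function is split at a median and both halves are treated this way. Conversely,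
the same Hardy inequality applied to √T bounds the L⁴ norm squared of each half, and the Hellinger
functional is at most 5 times the square root of the fourth moment about a median
(`sqrt_sub_le_of_median`). For super-Poincaré the positive part is cut at two quantiles, of levels u
= 1/s and 0.35 u: the Hardy inequality controls the top, one linear test function controls the
middle slice, and the (∫|f|)² term pays for the rest.

The inequalities are assumed only on the Friedrichs domain, which need not contain Lipschitz
functions of a. They are therefore extended first to L² limits of elements of bounded energy
(`RelaxedLE`). The test functions lie in this class by a one-sided chain rule, proved by polynomial
approximation (`relaxedLE_chain`); a resolvent regularisation that keeps bounds and does not raise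
the energy brings them back into the domain (`exists_regularization`). -/

theorem coe_aeval_apply (S : DiffusionGenerator X μ) (a : S.A) (P : Polynomial ℝ) (x : X) :
    ((Polynomial.aeval a P : S.A) : X → ℝ) x = P.eval ((a : X → ℝ) x) := by
  have h := Polynomial.aeval_algHom_apply ((Pi.evalAlgHom ℝ (fun _ : X => ℝ) x).comp S.A.val) a P
  rw [Polynomial.coe_aeval_eq_eval] at h
  exact h.symm

theorem carre_comm (S : DiffusionGenerator X μ) (f g : S.A) :
    carreDuChamp S.L f g = carreDuChamp S.L g f := by
  ext x
  simp only [carreDuChamp, mul_comm f g]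
  ring

theorem carre_add_left (S : DiffusionGenerator X μ) (f g h : S.A) (x : X) :
    carreDuChamp S.L (f + g) h x = carreDuChamp S.L f h x + carreDuChamp S.L g h x := by
  simp only [carreDuChamp, add_mul, map_add, Pi.add_apply, Subalgebra.coe_add]
  ring

theorem carre_smul_left (S : DiffusionGenerator X μ) (c : ℝ) (f h : S.A) (x : X) :
    carreDuChamp S.L (c • f) h x = c * carreDuChamp S.L f h x := by
  simp only [carreDuChamp, smul_mul_assoc, map_smul, Pi.smul_apply, smul_eq_mul,
    Subalgebra.coe_smul]
  ring

theorem carre_one_left (S : DiffusionGenerator X μ) (h : S.A) :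
    ∀ᵐ x ∂μ, carreDuChamp S.L 1 h x = 0 := by
  filter_upwards [S.derivation 1 1 h] with x hx
  simp at hx
  exact hx

theorem carre_pow_left (S : DiffusionGenerator X μ) (a h : S.A) (n : ℕ) :
    ∀ᵐ x ∂μ, carreDuChamp S.L (a ^ n) h x =
      n * (a : X → ℝ) x ^ (n - 1) * carreDuChamp S.L a h x := by
  induction n with
  | zero => simpa using S.carre_one_left h
  | succ n ih =>
    filter_upwards [ih, S.derivation (a ^ n) a h] with x h1 h2
    rw [pow_succ, h2, h1]
    rcases n with _ | n
    · simp
    · simp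
      ring

/-- The chain rule for polynomials. -/
theorem carre_aeval_left (S : DiffusionGenerator X μ) (a h : S.A) (P : Polynomial ℝ) :
    ∀ᵐ x ∂μ, carreDuChamp S.L (Polynomial.aeval a P) h x =
      P.derivative.eval ((a : X → ℝ) x) * carreDuChamp S.L a h x := by
  induction P using Polynomial.induction_on' with
  | add P Q hP hQ =>
    filter_upwards [hP, hQ] with x h1 h2
    rw [map_add, carre_add_left, h1, h2]
    simp
    ring
  | monomial n c =>
    filter_upwards [S.carre_pow_left a h n] with x h1
    rw [Polynomial.aeval_monomial, ← Algebra.smul_def, carre_smul_left, h1,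
      Polynomial.derivative_monomial, Polynomial.eval_monomial]
    ring

theorem carre_aeval_self (S : DiffusionGenerator X μ) (a : S.A) (P : Polynomial ℝ) :
    ∀ᵐ x ∂μ, carreDuChamp S.L (Polynomial.aeval a P) (Polynomial.aeval a P) x =
      P.derivative.eval ((a : X → ℝ) x) ^ 2 * carreDuChamp S.L a a x := by
  filter_upwards [S.carre_aeval_left a (Polynomial.aeval a P) P, S.carre_aeval_left a a P]
    with x h1 h2
  rw [h1, carre_comm, h2]
  ring

theorem preForm_aeval (S : DiffusionGenerator X μ) (a : S.A) (P : Polynomial ℝ) :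
    preForm μ S.L (Polynomial.aeval a P) (Polynomial.aeval a P) =
      ∫ x, P.derivative.eval ((a : X → ℝ) x) ^ 2 * carreDuChamp S.L a a x ∂μ :=
  integral_congr_ae (S.carre_aeval_self a P)

/-- A translation is a polynomial with derivative 1, so locality of Γ follows from the polynomial
chain rule. It allows level sets to be moved to 0 throughout. -/
theorem carre_sub_const (S : DiffusionGenerator X μ) (a : S.A) (m : ℝ) :
    carreDuChamp S.L (a - algebraMap ℝ S.A m) (a - algebraMap ℝ S.A m) =ᵐ[μ]
      carreDuChamp S.L a a := by
  have h := S.carre_aeval_self a (Polynomial.X - Polynomial.C m)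
  simp only [map_sub, Polynomial.aeval_X, Polynomial.aeval_C] at h
  filter_upwards [h] with x hx
  simpa using hx

theorem carre_neg (S : DiffusionGenerator X μ) (a : S.A) :
    carreDuChamp S.L (-a) (-a) =ᵐ[μ] carreDuChamp S.L a a := by
  have h := S.carre_aeval_self a (-Polynomial.X)
  simp only [map_neg, Polynomial.aeval_X] at h
  filter_upwards [h] with x hx
  simpa using hx

theorem memLp_coe (S : DiffusionGenerator X μ) [IsFiniteMeasure μ] (a : S.A) :
    MemLp (a : X → ℝ) 2 μ := by
  obtain ⟨C, hC⟩ := S.bounded_of_mem a a.2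
  exact MemLp.of_bound (S.measurable_of_mem a a.2).aestronglyMeasurable C
    (Eventually.of_forall fun x => by simpa using hC x)

end DiffusionGenerator

/-! ### Polynomial approximation in L² on a compact interval -/

theorem toReal_eLpNorm_two_sq {X : Type*} [MeasurableSpace X] {μ : Measure X} {f : X → ℝ}
    (hf : MemLp f 2 μ) : (eLpNorm f 2 μ).toReal ^ 2 = ∫ x, f x ^ 2 ∂μ := by
  have h := hf.eLpNorm_eq_integral_rpow_norm (by norm_num) (by norm_num)
  have h0 : 0 ≤ ∫ x, f x ^ 2 ∂μ := integral_nonneg fun x => sq_nonneg _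
  have e : ∫ x, ‖f x‖ ^ (2 : ENNReal).toReal ∂μ = ∫ x, f x ^ 2 ∂μ := by
    refine integral_congr_ae (Eventually.of_forall fun x => ?_)
    simp
  rw [e] at h
  rw [h, ENNReal.toReal_ofReal (by positivity), ← Real.rpow_natCast, ← Real.rpow_mul h0]
  norm_num

theorem eLpNorm_two_le_ofReal {X : Type*} [MeasurableSpace X] {μ : Measure X} {f : X → ℝ}
    (hf : MemLp f 2 μ) {ε : ℝ} (hε : 0 ≤ ε) :
    eLpNorm f 2 μ ≤ ENNReal.ofReal ε ↔ ∫ x, f x ^ 2 ∂μ ≤ ε ^ 2 := by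
  rw [← toReal_eLpNorm_two_sq hf, ENNReal.le_ofReal_iff_toReal_le hf.2.ne hε,
    sq_le_sq₀ ENNReal.toReal_nonneg hε]

/-- Polynomials are dense in `L²` of a finite measure carried by a compact interval. -/
theorem exists_polynomial_integral_sq_sub_le (ρ : Measure ℝ) [IsFiniteMeasure ρ] {C : ℝ}
    (hρ : ∀ᵐ x ∂ρ, x ∈ Set.Icc (-C) C) {G : ℝ → ℝ} (hG : MemLp G 2 ρ) {ε : ℝ} (hε : 0 < ε) :
    ∃ P : Polynomial ℝ, ∫ x, (G x - P.eval x) ^ 2 ∂ρ ≤ ε ^ 2 := by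
  obtain ⟨g, -, hg, gc, gm⟩ := hG.exists_hasCompactSupport_eLpNorm_sub_le (by norm_num)
    (ε := ENNReal.ofReal (ε / 2)) (by simpa using hε)
  -- Chosen so that a uniform error δ costs at most δ√(ρ(ℝ)) ≤ ε/2 in L²(ρ); the added 1 guards
  -- against ρ = 0.
  set δ : ℝ := ε / 2 / (1 + √(ρ.real Set.univ)) with hδ
  have hδ0 : 0 < δ := by positivity
  obtain ⟨P, hP⟩ := exists_polynomial_near_of_continuousOn (-C) C g gc.continuousOn δ hδ0
  have hPm : AEStronglyMeasurable (fun x => P.eval x) ρ := P.continuous.aestronglyMeasurable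
  have hb : ∀ᵐ x ∂ρ, ‖(g - fun x => P.eval x) x‖ ≤ δ := by
    filter_upwards [hρ] with x hx
    rw [Pi.sub_apply, norm_sub_rev]
    exact (hP x hx).le
  have m2 : MemLp (g - fun x => P.eval x) 2 ρ :=
    MemLp.of_bound (gm.1.sub hPm) δ hb
  refine ⟨P, ?_⟩
  have m : MemLp (fun x => G x - P.eval x) 2 ρ := by
    have := (hG.sub gm).add m2
    refine this.congr_norm ?_ ?_
    · exact hG.1.sub hPm
    · refine Eventually.of_forall fun x => ?_
      simp
  rw [← eLpNorm_two_le_ofReal m hε.le]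
  have e : (fun x => G x - P.eval x) = (G - g) + (g - fun x => P.eval x) := by
    ext x; simp
  rw [e]
  refine (eLpNorm_add_le (hG.sub gm).1 m2.1 one_le_two).trans ?_
  rw [show ε = ε / 2 + ε / 2 by ring, ENNReal.ofReal_add (by positivity) (by positivity)]
  refine add_le_add (by simpa using hg) ?_
  rw [eLpNorm_two_le_ofReal m2 (by positivity)]
  calc ∫ x, (g - fun x => P.eval x) x ^ 2 ∂ρ ≤ ∫ _, δ ^ 2 ∂ρ := by
        refine integral_mono_of_nonneg (Eventually.of_forall fun x => sq_nonneg _)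
          (integrable_const _) ?_
        filter_upwards [hb] with x hx
        exact sq_le_sq' (by have := neg_le_of_abs_le hx; linarith) (le_of_abs_le hx)
    _ = ρ.real Set.univ * δ ^ 2 := by simp
    _ = (√(ρ.real Set.univ) * δ) ^ 2 := by
        rw [mul_pow, Real.sq_sqrt measureReal_nonneg]
    _ ≤ (ε / 2) ^ 2 := by
        refine pow_le_pow_left₀ (by positivity) ?_ 2
        rw [hδ, mul_div_assoc', div_le_iff₀ (by positivity)]
        nlinarith [Real.sqrt_nonneg (ρ.real Set.univ)]

theorem Polynomial.exists_derivative_eq (P : Polynomial ℝ) :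
    ∃ Q : Polynomial ℝ, Q.derivative = P := by
  induction P using Polynomial.induction_on' with
  | add p q hp hq =>
    obtain ⟨P, rfl⟩ := hp
    obtain ⟨Q, rfl⟩ := hq
    exact ⟨P + Q, by simp⟩
  | monomial n c =>
    refine ⟨Polynomial.monomial (n + 1) (c / (n + 1)), ?_⟩
    have : (n : ℝ) + 1 ≠ 0 := by positivity
    rw [Polynomial.derivative_monomial]
    simp [this]

/-! ### The relaxed energy and its chain rule -/

namespace DiffusionGenerator

variable {X : Type u} [MeasurableSpace X] {μ : Measure X}

/-- `f` is an `L²`-limit of elements of the algebra whose energies are asymptotically at most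
`C`. -/
def RelaxedLE (S : DiffusionGenerator X μ) (f : X → ℝ) (C : ℝ) : Prop :=
  ∀ ε : ℝ, 0 < ε → ∃ a : S.A,
    eLpNorm (f - (a : X → ℝ)) 2 μ ≤ ENNReal.ofReal ε ∧ preForm μ S.L a a ≤ C + ε

theorem integrable_mul_carre (S : DiffusionGenerator X μ) [IsFiniteMeasure μ] (a : S.A)
    {h : ℝ → ℝ} (hm : Measurable h) {K : ℝ} (hK : ∀ x, |h ((a : X → ℝ) x)| ≤ K) :
    Integrable (fun x => h ((a : X → ℝ) x) * carreDuChamp S.L a a x) μ :=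
  (S.integrable_carre a a).bdd_mul
    (hm.comp (S.measurable_of_mem a a.2)).aestronglyMeasurable
    (Eventually.of_forall fun x => by simpa using hK x)

/-- Simultaneous polynomial approximation in `L²` of the energy distribution of `a` and in `L²` of
the Lebesgue measure. -/
theorem exists_polynomial_near (S : DiffusionGenerator X μ) [IsFiniteMeasure μ] (a : S.A)
    {C : ℝ} (hC : ∀ x, |(a : X → ℝ) x| ≤ C) {G : ℝ → ℝ} (hG : Measurable G) {K : ℝ}
    (hK : ∀ x, |G x| ≤ K) {ε : ℝ} (hε : 0 < ε) :
    ∃ P : Polynomial ℝ,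
      ∫ x, (G ((a : X → ℝ) x) - P.eval ((a : X → ℝ) x)) ^ 2 * carreDuChamp S.L a a x ∂μ ≤ ε ^ 2 ∧
      ∫ x in Set.Icc (-C) C, (G x - P.eval x) ^ 2 ≤ ε ^ 2 := by
  have ham : Measurable (a : X → ℝ) := S.measurable_of_mem a a.2
  have hint := S.integrable_carre a a
  set w : X → ENNReal := fun x => ENNReal.ofReal (carreDuChamp S.L a a x) with hw
  have hwm : AEMeasurable w μ := hint.aemeasurable.ennreal_ofReal
  set ν : Measure ℝ := (μ.withDensity w).map (a : X → ℝ) with hν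
  have : IsFiniteMeasure (μ.withDensity w) := by
    refine isFiniteMeasure_withDensity ?_
    have := hint.lintegral_lt_top
    exact this.ne
  have : IsFiniteMeasure ν := by rw [hν]; infer_instance
  -- The image ν of Γ(a)μ under a controls the energy error and Lebesgue measure controls the
  -- primitives; their sum makes a single polynomial serve both purposes.
  set ρ : Measure ℝ := ν + volume.restrict (Set.Icc (-C) C) with hρ
  have hsupp : ∀ᵐ x ∂ρ, x ∈ Set.Icc (-C) C := by
    rw [hρ, ae_add_measure_iff]
    refine ⟨?_, ae_restrict_mem measurableSet_Icc⟩
    exact (ae_map_iff ham.aemeasurable measurableSet_Icc).2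
      (Eventually.of_forall fun x => abs_le.1 (hC x))
  have hGm : MemLp G 2 ρ := MemLp.of_bound hG.aestronglyMeasurable K
    (Eventually.of_forall fun x => by simpa using hK x)
  obtain ⟨P, hP⟩ := exists_polynomial_integral_sq_sub_le ρ hsupp hGm hε
  have hcont : Measurable fun x => (G x - P.eval x) ^ 2 :=
    (hG.sub P.continuous.measurable).pow_const 2
  obtain ⟨B, hB⟩ : ∃ B, ∀ x ∈ Set.Icc (-C) C, |P.eval x| ≤ B := by
    obtain ⟨B, hB⟩ := isCompact_Icc.exists_bound_of_continuousOn
      (P.continuous.continuousOn (s := Set.Icc (-C) C))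
    exact ⟨B, fun x hx => by simpa using hB x hx⟩
  have hI : Integrable (fun x => (G x - P.eval x) ^ 2) ρ := by
    refine Integrable.of_bound hcont.aestronglyMeasurable ((K + B) ^ 2) ?_
    filter_upwards [hsupp] with x hx
    rw [Real.norm_eq_abs, abs_pow]
    refine pow_le_pow_left₀ (abs_nonneg _) ?_ 2
    exact (abs_sub _ _).trans (add_le_add (hK x) (hB x hx))
  rw [hρ] at hI hP
  have hI1 := hI.left_of_add_measure
  have hI2 := hI.right_of_add_measure
  rw [integral_add_measure hI1 hI2] at hP
  have n1 : 0 ≤ ∫ x, (G x - P.eval x) ^ 2 ∂ν := integral_nonneg fun x => sq_nonneg _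
  have n2 : 0 ≤ ∫ x in Set.Icc (-C) C, (G x - P.eval x) ^ 2 :=
    integral_nonneg fun x => sq_nonneg _
  refine ⟨P, ?_, by linarith⟩
  have e : ∫ x, (G ((a : X → ℝ) x) - P.eval ((a : X → ℝ) x)) ^ 2 * carreDuChamp S.L a a x ∂μ =
      ∫ x, (G x - P.eval x) ^ 2 ∂ν := by
    rw [hν, integral_map ham.aemeasurable hcont.aestronglyMeasurable,
      integral_withDensity_eq_integral_toReal_smul₀ hwm
        (Eventually.of_forall fun x => ENNReal.ofReal_lt_top)]
    refine integral_congr_ae ?_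
    filter_upwards [S.carre_nonneg a] with x hx
    simp only [hw, ENNReal.toReal_ofReal hx, smul_eq_mul]
    ring
  rw [e]
  linarith

/-- The chain rule for the relaxed form: if `φ(x) = φ₀ + ∫₀ˣ G`, then
`E(φ(a)) ≤ ∫ G(a)² Γ(a) dμ`. -/
theorem relaxedLE_chain (S : DiffusionGenerator X μ) [IsProbabilityMeasure μ] (a : S.A)
    {G : ℝ → ℝ} (hG : Measurable G) {K : ℝ} (hK : ∀ x, |G x| ≤ K) (φ₀ : ℝ) :
    S.RelaxedLE (fun x => φ₀ + ∫ t in (0 : ℝ)..(a : X → ℝ) x, G t)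
      (∫ x, G ((a : X → ℝ) x) ^ 2 * carreDuChamp S.L a a x ∂μ) := by
  intro ε hε
  have ham : Measurable (a : X → ℝ) := S.measurable_of_mem a a.2
  obtain ⟨C₀, hC₀⟩ := S.bounded_of_mem a a.2
  set C := |C₀| with hCdef
  have hC : ∀ x, |(a : X → ℝ) x| ≤ C := fun x => (hC₀ x).trans (le_abs_self _)
  have hC0 : 0 ≤ C := abs_nonneg _
  set I := ∫ x, G ((a : X → ℝ) x) ^ 2 * carreDuChamp S.L a a x ∂μ with hI
  have hGI : Integrable (fun x => G ((a : X → ℝ) x) ^ 2 * carreDuChamp S.L a a x) μ := by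
    refine S.integrable_mul_carre a (h := fun y => G y ^ 2) (hG.pow_const 2) (K := K ^ 2)
      fun x => ?_
    rw [abs_pow]
    exact pow_le_pow_left₀ (abs_nonneg _) (hK _) 2
  have hI0 : 0 ≤ I := by
    refine integral_nonneg_of_ae ?_
    filter_upwards [S.carre_nonneg a] with x hx
    exact mul_nonneg (sq_nonneg _) hx
  obtain ⟨δ, hδ0, hδ1, hδ2⟩ : ∃ δ : ℝ, 0 < δ ∧ δ * I + (δ ^ 2 + δ) ≤ ε ∧
      (2 * C * δ + δ) / 2 ≤ ε := by
    refine ⟨min 1 (ε / (I + 2 * C + 3)), by positivity, ?_, ?_⟩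
    · set δ := min 1 (ε / (I + 2 * C + 3)) with hδ
      have h0 : 0 < δ := by positivity
      have h1 : δ ≤ 1 := min_le_left _ _
      have h2 : δ * (I + 2 * C + 3) ≤ ε :=
        (le_div_iff₀ (by positivity)).1 (min_le_right _ _)
      nlinarith [mul_nonneg h0.le hC0]
    · set δ := min 1 (ε / (I + 2 * C + 3)) with hδ
      have h0 : 0 < δ := by positivity
      have h2 : δ * (I + 2 * C + 3) ≤ ε :=
        (le_div_iff₀ (by positivity)).1 (min_le_right _ _)
      nlinarith [mul_nonneg h0.le hC0, mul_nonneg h0.le hI0]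
  obtain ⟨P, hP1, hP2⟩ := S.exists_polynomial_near a hC hG hK hδ0
  obtain ⟨Q, hQd, hQ0⟩ : ∃ Q : Polynomial ℝ, Q.derivative = P ∧ Q.eval 0 = φ₀ := by
    obtain ⟨Q, hQ⟩ := P.exists_derivative_eq
    refine ⟨Q + Polynomial.C (φ₀ - Q.eval 0), by simp [hQ], by simp⟩
  have hQint : ∀ y, Q.eval y = φ₀ + ∫ t in (0 : ℝ)..y, P.eval t := by
    intro y
    have := intervalIntegral.integral_eq_sub_of_hasDerivAt (a := 0) (b := y)
      (f := fun t => Q.eval t) (f' := fun t => P.eval t)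
      (fun t _ => by simpa [hQd] using Q.hasDerivAt t) (P.continuous.intervalIntegrable _ _)
    rw [this, hQ0]
    ring
  have hGii : ∀ y z, IntervalIntegrable G volume y z := fun y z => by
    rw [intervalIntegrable_iff]
    exact Measure.integrableOn_of_bounded (M := K) (by simp)
      hG.aestronglyMeasurable (Eventually.of_forall fun x => by simpa using hK x)
  have hsqI : IntegrableOn (fun t => (G t - P.eval t) ^ 2) (Set.Icc (-C) C) := by
    obtain ⟨B, hB⟩ := isCompact_Icc.exists_bound_of_continuousOn
      (P.continuous.continuousOn (s := Set.Icc (-C) C))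
    refine Measure.integrableOn_of_bounded (M := (K + B) ^ 2) (by simp)
      ((hG.sub P.continuous.measurable).pow_const 2).aestronglyMeasurable ?_
    filter_upwards [ae_restrict_mem measurableSet_Icc] with x hx
    rw [Real.norm_eq_abs, abs_pow]
    refine pow_le_pow_left₀ (abs_nonneg _) ?_ 2
    exact (abs_sub _ _).trans (add_le_add (hK x) (hB x hx))
  have hclose : ∀ y, |y| ≤ C → |(φ₀ + ∫ t in (0 : ℝ)..y, G t) - Q.eval y| ≤ ε := by
    intro y hy
    have hy' := abs_le.1 hy
    rw [hQint, add_sub_add_left_eq_sub,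
      ← intervalIntegral.integral_sub (hGii _ _) (P.continuous.intervalIntegrable _ _)]
    have hsub : Set.uIoc 0 y ⊆ Set.Icc (-C) C := by
      intro t ht
      rcases Set.mem_uIoc.1 ht with h | h
      · exact ⟨by linarith, by linarith⟩
      · exact ⟨by linarith, by linarith⟩
    refine (intervalIntegral.norm_integral_le_integral_norm_uIoc (f := fun t => G t - P.eval t)
      (a := 0) (b := y)).trans ?_
    -- Since |z| ≤ (δ + z²/δ)/2, closeness of G and P in L² makes their primitives uniformly close.
    have hmaj : IntegrableOn (fun t => (δ + (G t - P.eval t) ^ 2 / δ) / 2) (Set.Icc (-C) C) :=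
      ((integrable_const _).add (hsqI.div_const _)).div_const _
    have hpt : ∀ t, ‖G t - P.eval t‖ ≤ (δ + (G t - P.eval t) ^ 2 / δ) / 2 := by
      intro t
      rw [Real.norm_eq_abs, ← sq_abs (G t - P.eval t)]
      set z := |G t - P.eval t|
      rw [le_div_iff₀ two_pos, ← sub_nonneg]
      have : δ + z ^ 2 / δ - z * 2 = (z - δ) ^ 2 / δ := by field_simp; ring
      rw [this]
      positivity
    calc ∫ t in Set.uIoc 0 y, ‖G t - P.eval t‖
        ≤ ∫ t in Set.uIoc 0 y, (δ + (G t - P.eval t) ^ 2 / δ) / 2 :=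
          integral_mono_of_nonneg (Eventually.of_forall fun t => norm_nonneg _)
            (hmaj.mono_set hsub) (Eventually.of_forall hpt)
      _ ≤ ∫ t in Set.Icc (-C) C, (δ + (G t - P.eval t) ^ 2 / δ) / 2 :=
          setIntegral_mono_set hmaj (Eventually.of_forall fun t => by positivity)
            hsub.eventuallyLE
      _ = (2 * C * δ + (∫ t in Set.Icc (-C) C, (G t - P.eval t) ^ 2) / δ) / 2 := by
          rw [integral_div, integral_add (integrable_const _) (hsqI.div_const _), integral_div]
          rw [setIntegral_const, Real.volume_real_Icc_of_le (by linarith), smul_eq_mul]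
          ring
      _ ≤ (2 * C * δ + δ) / 2 := by
          have : (∫ t in Set.Icc (-C) C, (G t - P.eval t) ^ 2) / δ ≤ δ := by
            rw [div_le_iff₀ hδ0]
            nlinarith
          linarith
      _ ≤ ε := hδ2
  refine ⟨Polynomial.aeval a Q, ?_, ?_⟩
  · refine (eLpNorm_le_of_ae_bound (C := ε) (Eventually.of_forall fun x => ?_)).trans ?_
    · rw [Pi.sub_apply, coe_aeval_apply]
      exact hclose _ (hC x)
    · simp
  · rw [preForm_aeval, hQd]
    obtain ⟨B, hB⟩ := isCompact_Icc.exists_bound_of_continuousOn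
      (P.continuous.continuousOn (s := Set.Icc (-C) C))
    have hdI : Integrable (fun x => (G ((a : X → ℝ) x) - P.eval ((a : X → ℝ) x)) ^ 2 *
        carreDuChamp S.L a a x) μ := by
      refine S.integrable_mul_carre a (h := fun y => (G y - P.eval y) ^ 2)
        ((hG.sub P.continuous.measurable).pow_const 2) (K := (K + B) ^ 2) fun x => ?_
      rw [abs_pow]
      refine pow_le_pow_left₀ (abs_nonneg _) ?_ 2
      exact (abs_sub _ _).trans (add_le_add (hK _) (hB _ (abs_le.1 (hC x))))
    have hmono : ∫ x, P.eval ((a : X → ℝ) x) ^ 2 * carreDuChamp S.L a a x ∂μ ≤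
        ∫ x, ((1 + δ) * (G ((a : X → ℝ) x) ^ 2 * carreDuChamp S.L a a x) + (1 + 1 / δ) *
          ((G ((a : X → ℝ) x) - P.eval ((a : X → ℝ) x)) ^ 2 * carreDuChamp S.L a a x)) ∂μ := by
      refine integral_mono_of_nonneg ?_ ((hGI.const_mul _).add (hdI.const_mul _)) ?_
      · filter_upwards [S.carre_nonneg a] with x hx
        exact mul_nonneg (sq_nonneg _) hx
      · filter_upwards [S.carre_nonneg a] with x hx
        -- Young's inequality with weight δ: the approximation error is at most δ² in the energy, so
        -- even multiplied by 1 + 1/δ it tends to 0.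
        have key : ∀ p g : ℝ, p ^ 2 ≤ (1 + δ) * g ^ 2 + (1 + 1 / δ) * (g - p) ^ 2 := by
          intro p g
          have : (1 + δ) * g ^ 2 + (1 + 1 / δ) * (g - p) ^ 2 - p ^ 2 =
              (δ * g + (g - p)) ^ 2 / δ := by
            field_simp
            ring
          have h2 : 0 ≤ (δ * g + (g - p)) ^ 2 / δ := by positivity
          linarith
        have := mul_le_mul_of_nonneg_right
          (key (P.eval ((a : X → ℝ) x)) (G ((a : X → ℝ) x))) hx
        calc _ ≤ _ := this
          _ = _ := by ring
    rw [integral_add (hGI.const_mul _) (hdI.const_mul _), integral_const_mul,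
      integral_const_mul] at hmono
    have h3 : (1 + 1 / δ) * ∫ x, (G ((a : X → ℝ) x) - P.eval ((a : X → ℝ) x)) ^ 2 *
        carreDuChamp S.L a a x ∂μ ≤ (1 + 1 / δ) * δ ^ 2 :=
      mul_le_mul_of_nonneg_left hP1 (by positivity)
    have h4 : (1 + 1 / δ) * δ ^ 2 = δ ^ 2 + δ := by field_simp
    linarith

end DiffusionGenerator

/-! ### Truncation and absolute value as primitives of bounded functions -/

/-- The truncation of `x` to `[lo, hi]`. -/
noncomputable def clamp (lo hi x : ℝ) : ℝ := max lo (min hi x)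

theorem clamp_mem {lo hi : ℝ} (h : lo ≤ hi) (x : ℝ) : lo ≤ clamp lo hi x ∧ clamp lo hi x ≤ hi :=
  ⟨le_max_left _ _, max_le h (min_le_left _ _)⟩

theorem clamp_of_mem {lo hi x : ℝ} (h₁ : lo ≤ x) (h₂ : x ≤ hi) : clamp lo hi x = x := by
  rw [clamp, min_eq_right h₂, max_eq_right h₁]

theorem continuous_clamp (lo hi : ℝ) : Continuous (clamp lo hi) := by
  unfold clamp; fun_prop

theorem abs_clamp_sub_clamp_le (lo hi x y : ℝ) : |clamp lo hi x - clamp lo hi y| ≤ |x - y| :=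
  (abs_max_sub_max_le_max _ _ _ _).trans <| by
    rw [sub_self, abs_zero]
    refine max_le (abs_nonneg _) ((abs_min_sub_min_le_max _ _ _ _).trans ?_)
    rw [sub_self, abs_zero]
    exact max_le (abs_nonneg _) le_rfl

/-- The derivative is missing only at the two corners, a countable set. The shape φ₀ + ∫ G is the
one to which the relaxed chain rule applies. -/
theorem clamp_eq_integral {lo hi : ℝ} (h : lo ≤ hi) (x : ℝ) :
    clamp lo hi x = clamp lo hi 0 + ∫ t in (0 : ℝ)..x, (Set.Ioo lo hi).indicator 1 t := by
  have hi' : IntervalIntegrable ((Set.Ioo lo hi).indicator (1 : ℝ → ℝ)) volume 0 x := by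
    rw [intervalIntegrable_iff]
    refine Measure.integrableOn_of_bounded (M := 1) (by simp)
      ((measurable_const (a := (1 : ℝ))).indicator measurableSet_Ioo).aestronglyMeasurable
      (Eventually.of_forall fun t => ?_)
    by_cases ht : t ∈ Set.Ioo lo hi <;> simp [Set.indicator, ht]
  have := integral_eq_of_hasDerivAt_off_countable (clamp lo hi)
    ((Set.Ioo lo hi).indicator 1) (a := 0) (b := x) (s := {lo, hi}) (by simp)
    (continuous_clamp lo hi).continuousOn (fun t ht => ?_) hi'
  · rw [this]; ring
  · have hlo : t ≠ lo := fun e => ht.2 (by simp [e])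
    have hhi : t ≠ hi := fun e => ht.2 (by simp [e])
    rcases lt_or_gt_of_ne hlo with h1 | h1
    · have e : clamp lo hi =ᶠ[𝓝 t] fun _ => lo := by
        filter_upwards [Iio_mem_nhds h1] with y hy
        exact max_eq_left ((min_le_right _ _).trans (le_of_lt hy))
      have hn : t ∉ Set.Ioo lo hi := fun hc => absurd hc.1 (not_lt.2 h1.le)
      rw [Set.indicator_of_notMem hn]
      exact (hasDerivAt_const t lo).congr_of_eventuallyEq e
    · rcases lt_or_gt_of_ne hhi with h2 | h2
      · have e : clamp lo hi =ᶠ[𝓝 t] fun y => y := by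
          filter_upwards [Ioo_mem_nhds h1 h2] with y hy
          exact clamp_of_mem hy.1.le hy.2.le
        rw [Set.indicator_of_mem (show t ∈ Set.Ioo lo hi from ⟨h1, h2⟩)]
        exact (hasDerivAt_id t).congr_of_eventuallyEq e
      · have e : clamp lo hi =ᶠ[𝓝 t] fun _ => hi := by
          filter_upwards [Ioi_mem_nhds h2] with y hy
          rw [clamp, min_eq_left (le_of_lt hy), max_eq_right h]
        have hn : t ∉ Set.Ioo lo hi := fun hc => absurd hc.2 (not_lt.2 h2.le)
        rw [Set.indicator_of_notMem hn]
        exact (hasDerivAt_const t hi).congr_of_eventuallyEq e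

theorem abs_eq_integral (x : ℝ) :
    |x| = 0 + ∫ t in (0 : ℝ)..x, (if 0 ≤ t then (1 : ℝ) else -1) := by
  have hm : Measurable fun t : ℝ => if 0 ≤ t then (1 : ℝ) else -1 :=
    Measurable.ite measurableSet_Ici measurable_const measurable_const
  have hi' : IntervalIntegrable (fun t : ℝ => if 0 ≤ t then (1 : ℝ) else -1) volume 0 x := by
    rw [intervalIntegrable_iff]
    refine Measure.integrableOn_of_bounded (M := 1) (by simp) hm.aestronglyMeasurable
      (Eventually.of_forall fun t => ?_)
    split_ifs <;> simp
  have := integral_eq_of_hasDerivAt_off_countable (fun t : ℝ => |t|)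
    (fun t : ℝ => if 0 ≤ t then (1 : ℝ) else -1) (a := 0) (b := x) (s := {0}) (by simp)
    continuous_abs.continuousOn (fun t ht => ?_) hi'
  · rw [this]; simp
  · have h0 : t ≠ 0 := fun e => ht.2 (by simp [e])
    rcases lt_or_gt_of_ne h0 with h | h
    · rw [if_neg (not_le.2 h)]
      exact hasDerivAt_abs_neg h
    · rw [if_pos h.le]
      exact hasDerivAt_abs_pos h

/-! ### Stability of the relaxed energy under L² limits and contractions -/

namespace DiffusionGenerator

variable {X : Type u} [MeasurableSpace X] {μ : Measure X}

theorem aestronglyMeasurable_coe (S : DiffusionGenerator X μ) (a : S.A) :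
    AEStronglyMeasurable (a : X → ℝ) μ := (S.measurable_of_mem a a.2).aestronglyMeasurable

/-- Lower semicontinuity of the relaxed energy, by a diagonal choice with half of the error spent on
each approximation. -/
theorem RelaxedLE.of_approx {S : DiffusionGenerator X μ} {f : X → ℝ} {C : ℝ}
    (hf : AEStronglyMeasurable f μ)
    (h : ∀ ε : ℝ, 0 < ε → ∃ g : X → ℝ, AEStronglyMeasurable g μ ∧ S.RelaxedLE g (C + ε) ∧
      eLpNorm (f - g) 2 μ ≤ ENNReal.ofReal ε) : S.RelaxedLE f C := by
  intro ε hε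
  obtain ⟨g, hgm, hg, hfg⟩ := h (ε / 2) (by positivity)
  obtain ⟨a, ha, hE⟩ := hg (ε / 2) (by positivity)
  refine ⟨a, ?_, by linarith⟩
  have e : f - (a : X → ℝ) = (f - g) + (g - (a : X → ℝ)) := by abel
  rw [e, show ε = ε / 2 + ε / 2 by ring, ENNReal.ofReal_add (by positivity) (by positivity)]
  exact (eLpNorm_add_le (hf.sub hgm) (hgm.sub (S.aestronglyMeasurable_coe a)) one_le_two).trans
    (add_le_add hfg ha)

theorem RelaxedLE.mono {S : DiffusionGenerator X μ} {f : X → ℝ} {C C' : ℝ}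
    (h : S.RelaxedLE f C) (hC : C ≤ C') : S.RelaxedLE f C' := fun ε hε =>
  (h ε hε).imp fun _ ha => ⟨ha.1, by linarith [ha.2]⟩

theorem relaxedLE_coe (S : DiffusionGenerator X μ) (a : S.A) :
    S.RelaxedLE (a : X → ℝ) (preForm μ S.L a a) := fun ε hε =>
  ⟨a, by simp, by linarith⟩

/-- Normal contractions decrease the relaxed form. -/
theorem RelaxedLE.contraction {S : DiffusionGenerator X μ} [IsProbabilityMeasure μ] {f : X → ℝ}
    {C : ℝ} (h : S.RelaxedLE f C) (hf : AEStronglyMeasurable f μ) {φ G : ℝ → ℝ} {φ₀ : ℝ}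
    (hφ : ∀ x, φ x = φ₀ + ∫ t in (0 : ℝ)..x, G t) (hφc : Continuous φ) (hG : Measurable G)
    (hG1 : ∀ x, |G x| ≤ 1) (hφ1 : ∀ x y, |φ x - φ y| ≤ |x - y|) :
    S.RelaxedLE (fun x => φ (f x)) C := by
  refine RelaxedLE.of_approx (hφc.comp_aestronglyMeasurable hf) fun ε hε => ?_
  obtain ⟨a, ha, hE⟩ := h ε hε
  refine ⟨fun x => φ ((a : X → ℝ) x),
    hφc.comp_aestronglyMeasurable (S.aestronglyMeasurable_coe a), ?_, ?_⟩
  · have := S.relaxedLE_chain a hG hG1 φ₀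
    simp only [← hφ] at this
    refine this.mono (le_trans ?_ hE)
    refine integral_mono_of_nonneg ?_ (S.integrable_carre a a) ?_
    · filter_upwards [S.carre_nonneg a] with x hx
      exact mul_nonneg (sq_nonneg _) hx
    · filter_upwards [S.carre_nonneg a] with x hx
      have : G ((a : X → ℝ) x) ^ 2 ≤ 1 := by
        rw [← sq_abs]
        exact pow_le_one₀ (abs_nonneg _) (hG1 _)
      nlinarith
  · exact (eLpNorm_mono fun x => hφ1 _ _).trans ha

theorem RelaxedLE.clamp {S : DiffusionGenerator X μ} [IsProbabilityMeasure μ] {f : X → ℝ}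
    {C : ℝ} (h : S.RelaxedLE f C) (hf : AEStronglyMeasurable f μ) {lo hi : ℝ} (hlh : lo ≤ hi) :
    S.RelaxedLE (fun x => clamp lo hi (f x)) C := by
  refine h.contraction hf (clamp_eq_integral hlh) (continuous_clamp lo hi)
    ((measurable_const (a := (1 : ℝ))).indicator measurableSet_Ioo) (fun t => ?_)
    (abs_clamp_sub_clamp_le lo hi)
  by_cases ht : t ∈ Set.Ioo lo hi <;> simp [Set.indicator, ht]

theorem RelaxedLE.abs {S : DiffusionGenerator X μ} [IsProbabilityMeasure μ] {f : X → ℝ}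
    {C : ℝ} (h : S.RelaxedLE f C) (hf : AEStronglyMeasurable f μ) :
    S.RelaxedLE (fun x => |f x|) C := by
  refine h.contraction hf abs_eq_integral continuous_abs
    (Measurable.ite measurableSet_Ici measurable_const measurable_const) (fun t => ?_)
    (fun x y => abs_abs_sub_abs_le_abs_sub x y)
  split_ifs <;> simp

theorem relaxedLE_of_isApprox (S : DiffusionGenerator X μ) [IsFiniteMeasure μ] {f : X → ℝ}
    (hf : MemLp f 2 μ) {a : ℕ → S.A} (ha : S.IsApprox f a) : S.RelaxedLE f (S.energy f) := by
  intro ε hε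
  have h1 := (ENNReal.tendsto_nhds_zero.1 ha.1) (ENNReal.ofReal ε) (by simpa using hε)
  have h2 := (S.tendsto_energy hf ha).eventually_le_const
    (show S.energy f < S.energy f + ε by linarith)
  obtain ⟨n, hn⟩ := (h1.and h2).exists
  exact ⟨a n, hn⟩

/-! ### Regularisation by minimising a penalised energy -/

/-- The inclusion of the algebra into `L²(μ)`. -/
noncomputable def toL2 (S : DiffusionGenerator X μ) [IsFiniteMeasure μ] :
    S.A →ₗ[ℝ] Lp ℝ 2 μ where
  toFun a := (S.memLp_coe a).toLp _
  map_add' _ _ := rfl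
  map_smul' _ _ := rfl

theorem norm_toL2_sub (S : DiffusionGenerator X μ) [IsFiniteMeasure μ] {f : X → ℝ}
    (hf : MemLp f 2 μ) (a : S.A) :
    ‖S.toL2 a - hf.toLp f‖ = (eLpNorm (f - (a : X → ℝ)) 2 μ).toReal := by
  have : S.toL2 a - hf.toLp f = ((S.memLp_coe a).sub hf).toLp _ := rfl
  rw [this, Lp.norm_toLp, eLpNorm_sub_comm]

/-- `E(a) + lam ‖a - F‖²`. -/
noncomputable def penalized (S : DiffusionGenerator X μ) [IsFiniteMeasure μ] (lam : ℝ)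
    (F : Lp ℝ 2 μ) (a : S.A) : ℝ := preForm μ S.L a a + lam * ‖S.toL2 a - F‖ ^ 2

theorem penalized_add_smul (S : DiffusionGenerator X μ) [IsFiniteMeasure μ] (lam : ℝ)
    (F : Lp ℝ 2 μ) (a h : S.A) (t : ℝ) :
    S.penalized lam F (a + t • h) = S.penalized lam F a +
      2 * t * (preForm μ S.L a h + lam * inner ℝ (S.toL2 a - F) (S.toL2 h)) +
      t ^ 2 * (preForm μ S.L h h + lam * ‖S.toL2 h‖ ^ 2) := by
  have e : S.toL2 (a + t • h) - F = (S.toL2 a - F) + t • S.toL2 h := by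
    rw [map_add, map_smul]; abel
  rw [penalized, penalized, preForm_add_smul, e, norm_add_sq_real, inner_smul_right, norm_smul,
    mul_pow, Real.norm_eq_abs, sq_abs]
  ring

/-- Exact uniform convexity: two near-minimisers are close both for the form and in L², because
their midpoint cannot fall below the infimum. -/
theorem penalized_parallelogram (S : DiffusionGenerator X μ) [IsFiniteMeasure μ] (lam : ℝ)
    (F : Lp ℝ 2 μ) (a b : S.A) :
    S.penalized lam F (b + (1 / 2 : ℝ) • (a - b)) + (preForm μ S.L (a - b) (a - b) +
      lam * ‖S.toL2 a - S.toL2 b‖ ^ 2) / 4 =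
      (S.penalized lam F a + S.penalized lam F b) / 2 := by
  have h1 := S.penalized_add_smul lam F b (a - b) (1 / 2)
  have h2 := S.penalized_add_smul lam F b (a - b) 1
  rw [one_smul, add_sub_cancel] at h2
  rw [h1, h2, map_sub]
  ring

/-- A bounded `L²`-limit of elements of bounded energy is an `L²`-limit of elements of the
Friedrichs domain with the same bounds and no larger energy. -/
theorem exists_regularization (S : DiffusionGenerator X μ) [IsProbabilityMeasure μ] {f : X → ℝ}
    (hf : MemLp f 2 μ) {C : ℝ} (hC : S.RelaxedLE f C) {lo hi : ℝ} (hlh : lo ≤ hi)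
    (hb : ∀ᵐ x ∂μ, lo ≤ f x ∧ f x ≤ hi) {ε : ℝ} (hε : 0 < ε) :
    ∃ u ∈ S.friedrichsDomain, (∀ᵐ x ∂μ, lo ≤ u x ∧ u x ≤ hi) ∧ S.energy u ≤ C ∧
      ∫ x, (u x - f x) ^ 2 ∂μ ≤ ε := by
  have hC0 : 0 ≤ C := by
    refine le_of_forall_pos_le_add fun δ hδ => ?_
    obtain ⟨a, -, ha⟩ := hC δ hδ
    exact (S.preForm_nonneg a).trans ha
  set F : Lp ℝ 2 μ := hf.toLp f with hF
  -- The minimum will be at most C, hence lam‖U - F‖² ≤ C and ‖U - F‖² ≤ Cε/(C + 1) ≤ ε. The added 1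
  -- keeps lam positive when C = 0.
  set lam : ℝ := (C + 1) / ε with hlam
  have hlam0 : 0 < lam := by positivity
  set J := S.penalized lam F with hJ
  have hJ0 : ∀ a, 0 ≤ J a := fun a => by
    have := S.preForm_nonneg a
    rw [hJ, penalized]; positivity
  have hbdd : BddBelow (Set.range J) := ⟨0, by rintro _ ⟨a, rfl⟩; exact hJ0 a⟩
  set I := sInf (Set.range J) with hI
  have hIle : ∀ a, I ≤ J a := fun a => csInf_le hbdd ⟨a, rfl⟩
  have hIC : I ≤ C := by
    refine le_of_forall_pos_le_add fun δ hδ => ?_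
    obtain ⟨η, hη0, hη⟩ : ∃ η : ℝ, 0 < η ∧ η + lam * η ^ 2 ≤ δ := by
      refine ⟨min 1 (δ / (1 + lam)), by positivity, ?_⟩
      set η := min 1 (δ / (1 + lam))
      have h0 : 0 < η := by positivity
      have h1 : η ≤ 1 := min_le_left _ _
      have h2 : η * (1 + lam) ≤ δ := (le_div_iff₀ (by positivity)).1 (min_le_right _ _)
      nlinarith [mul_nonneg hlam0.le (mul_nonneg h0.le (sub_nonneg.2 h1))]
    obtain ⟨a, ha1, ha2⟩ := hC η hη0
    have h3 : ‖S.toL2 a - F‖ ≤ η := by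
      rw [hF, norm_toL2_sub]
      exact ENNReal.toReal_le_of_le_ofReal hη0.le ha1
    have h4 : J a ≤ C + η + lam * η ^ 2 := by
      rw [hJ, penalized]
      gcongr
    linarith [hIle a]
  have hclose : ∀ (a b : S.A) (η η' : ℝ), J a ≤ I + η → J b ≤ I + η' →
      preForm μ S.L (a - b) (a - b) + lam * ‖S.toL2 a - S.toL2 b‖ ^ 2 ≤ 2 * (η + η') := by
    intro a b η η' ha hb
    have := S.penalized_parallelogram lam F a b
    have h2 := hIle (b + (1 / 2 : ℝ) • (a - b))
    rw [hJ] at h2 ha hb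
    linarith
  have hex : ∀ n : ℕ, ∃ a : S.A, J a < I + 1 / ((n : ℝ) + 1) := fun n => by
    obtain ⟨_, ⟨a, rfl⟩, ha⟩ := exists_lt_of_csInf_lt (Set.range_nonempty J)
      (show I < I + 1 / ((n : ℝ) + 1) by linarith [show (0 : ℝ) < 1 / ((n : ℝ) + 1) by positivity])
    exact ⟨a, ha⟩
  choose a ha using hex
  have hone : ∀ {m n : ℕ}, m ≤ n → (1 : ℝ) / ((n : ℝ) + 1) ≤ 1 / ((m : ℝ) + 1) :=
    fun h => one_div_le_one_div_of_le (by positivity) (by exact_mod_cast Nat.succ_le_succ h)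
  have htend : Tendsto (fun n : ℕ => (1 : ℝ) / ((n : ℝ) + 1)) atTop (𝓝 0) :=
    tendsto_one_div_add_atTop_nhds_zero_nat
  have hpair : ∀ {N m n : ℕ}, N ≤ m → N ≤ n →
      preForm μ S.L (a m - a n) (a m - a n) + lam * ‖S.toL2 (a m) - S.toL2 (a n)‖ ^ 2 ≤
        4 * (1 / ((N : ℝ) + 1)) := by
    intro N m n hm hn
    have := hclose (a m) (a n) _ _ (ha m).le (ha n).le
    linarith [hone hm, hone hn]
  have hsmall : ∀ δ : ℝ, 0 < δ → ∃ N : ℕ, 4 * (1 / ((N : ℝ) + 1)) < δ := fun δ hδ => by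
    obtain ⟨N, hN⟩ := exists_nat_one_div_lt (show 0 < δ / 4 by positivity)
    exact ⟨N, by linarith⟩
  have hformC : IsFormCauchy μ S.L a := by
    intro δ hδ
    obtain ⟨N, hN⟩ := hsmall δ hδ
    refine ⟨N, fun m hm n hn => ?_⟩
    have := hpair hm hn
    have : 0 ≤ lam * ‖S.toL2 (a m) - S.toL2 (a n)‖ ^ 2 := by positivity
    linarith
  have hcau : CauchySeq fun n => S.toL2 (a n) := by
    rw [Metric.cauchySeq_iff]
    intro δ hδ
    obtain ⟨N, hN⟩ := hsmall (lam * δ ^ 2) (by positivity)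
    refine ⟨N, fun m hm n hn => ?_⟩
    have h1 := hpair hm hn
    have h2 := S.preForm_nonneg (a m - a n)
    have h3 : ‖S.toL2 (a m) - S.toL2 (a n)‖ ^ 2 < δ ^ 2 := by
      refine lt_of_mul_lt_mul_left ?_ hlam0.le
      linarith
    rw [dist_eq_norm]
    exact lt_of_pow_lt_pow_left₀ 2 hδ.le h3
  obtain ⟨U, hU⟩ := cauchySeq_tendsto_of_complete hcau
  have hUm : MemLp (U : X → ℝ) 2 μ := Lp.memLp U
  have hUe : hUm.toLp (U : X → ℝ) = U := Lp.toLp_coeFn U hUm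
  have happ : S.IsApprox (U : X → ℝ) a := by
    refine ⟨?_, hformC⟩
    have h1 := tendsto_iff_norm_sub_tendsto_zero.1 hU
    have h2 : ∀ n, ‖S.toL2 (a n) - U‖ = (eLpNorm ((U : X → ℝ) - (a n : X → ℝ)) 2 μ).toReal :=
      fun n => by
        have := S.norm_toL2_sub hUm (a n)
        rwa [hUe] at this
    simp only [h2] at h1
    rw [← ENNReal.toReal_zero, ENNReal.tendsto_toReal_iff
      (fun n => (hUm.sub (S.memLp_coe (a n))).2.ne) ENNReal.zero_ne_top] at h1
    exact h1
  have hJlim : Tendsto (fun n => J (a n)) atTop (𝓝 I) := by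
    refine tendsto_of_tendsto_of_tendsto_of_le_of_le tendsto_const_nhds
      (?_ : Tendsto (fun n : ℕ => I + 1 / ((n : ℝ) + 1)) atTop (𝓝 I)) (fun n => hIle _)
      (fun n => (ha n).le)
    simpa using htend.const_add I
  have hElim := S.tendsto_energy hUm happ
  have hsum : S.energy U + lam * ‖U - F‖ ^ 2 = I := by
    refine tendsto_nhds_unique ?_ hJlim
    exact hElim.add (((hU.sub_const F).norm.pow 2).const_mul lam)
  have hE0 : 0 ≤ S.energy U := ge_of_tendsto' hElim fun n => S.preForm_nonneg _
  have hUF : ‖U - F‖ ^ 2 = ∫ x, ((U : X → ℝ) x - f x) ^ 2 ∂μ := by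
    have e : U - F = (hUm.sub hf).toLp _ := by
      rw [MemLp.toLp_sub hUm hf, hUe]
    rw [e, Lp.norm_toLp, toReal_eLpNorm_two_sq (hUm.sub hf)]
    rfl
  -- The minimiser solves E(U, h) = -lam⟨U - F, h⟩. The factor -2 in the Friedrichs domain turns
  -- this into g = (lam/2)(U - f).
  refine ⟨U, ⟨hUm, a, happ, fun x => lam / 2 * ((U : X → ℝ) x - f x),
    (hUm.sub hf).const_mul _, fun h => ?_⟩, ?_, ?_, ?_⟩
  · -- Euler-Lagrange equation
    set D := preForm μ S.L h h + lam * ‖S.toL2 h‖ ^ 2 with hD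
    have hD0 : 0 ≤ D := by have := S.preForm_nonneg h; positivity
    set ell := fun n => preForm μ S.L (a n) h + lam * inner ℝ (S.toL2 (a n) - F) (S.toL2 h)
      with hell
    -- The quadratic t ↦ J(a n + t h) - I is nonnegative, so its discriminant bounds the first
    -- variation at a n by the gap J(a n) - I, which tends to 0.
    have hsq : ∀ n, ell n ^ 2 ≤ D * (J (a n) - I) := by
      intro n
      have hd : discrim D (2 * ell n) (J (a n) - I) ≤ 0 := by
        refine discrim_le_zero fun t => ?_
        have h1 := hIle (a n + t • h)
        rw [hJ, penalized_add_smul] at h1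
        nlinarith
      unfold discrim at hd
      nlinarith
    have hell0 : Tendsto ell atTop (𝓝 0) := by
      have h1 : Tendsto (fun n => ell n ^ 2) atTop (𝓝 0) := by
        refine squeeze_zero (fun n => sq_nonneg _) hsq ?_
        simpa using (hJlim.sub_const I).const_mul D
      have h2 := (Real.continuous_sqrt.tendsto 0).comp h1
      rw [Real.sqrt_zero] at h2
      refine (tendsto_zero_iff_abs_tendsto_zero _).2 (h2.congr fun n => ?_)
      exact Real.sqrt_sq_eq_abs _
    have hin : Tendsto (fun n => lam * inner ℝ (S.toL2 (a n) - F) (S.toL2 h)) atTop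
        (𝓝 (lam * inner ℝ (U - F) (S.toL2 h))) :=
      ((hU.sub_const F).inner tendsto_const_nhds).const_mul lam
    have hfin := hell0.sub hin
    have e1 : ∀ n, ell n - lam * inner ℝ (S.toL2 (a n) - F) (S.toL2 h) =
        preForm μ S.L (a n) h := fun n => by rw [hell]; ring
    have e2 : inner ℝ (U - F) (S.toL2 h) =
        ∫ x, ((U : X → ℝ) x - f x) * (h : X → ℝ) x ∂μ := by
      rw [L2.inner_def]
      refine integral_congr_ae ?_
      filter_upwards [Lp.coeFn_sub U F, hf.coeFn_toLp, (S.memLp_coe h).coeFn_toLp]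
        with x h1 h2 h3
      have h3' : (S.toL2 h : X → ℝ) x = (h : X → ℝ) x := h3
      rw [h1, Pi.sub_apply, hF, h2, h3']
      simp [mul_comm]
    simp only [e1, e2] at hfin
    convert hfin using 2
    rw [zero_sub, ← integral_const_mul, ← integral_const_mul, ← integral_neg]
    refine integral_congr_ae (Eventually.of_forall fun x => ?_)
    simp only
    ring
  · -- the minimizer inherits the bounds
    have hv : ∀ n : ℕ, ∃ v : S.A, eLpNorm ((fun x => clamp lo hi ((a n : X → ℝ) x)) -
        (v : X → ℝ)) 2 μ ≤ ENNReal.ofReal (1 / ((n : ℝ) + 1)) ∧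
        preForm μ S.L v v ≤ preForm μ S.L (a n) (a n) + 1 / ((n : ℝ) + 1) := fun n =>
      (S.relaxedLE_coe (a n)).clamp (S.aestronglyMeasurable_coe _) hlh _ (by positivity)
    choose v hv1 hv2 using hv
    have hcm : ∀ {g : X → ℝ}, MemLp g 2 μ → MemLp (fun x => clamp lo hi (g x)) 2 μ := by
      intro g hg
      refine MemLp.of_bound ((continuous_clamp lo hi).comp_aestronglyMeasurable hg.1)
        (max |lo| |hi|) (Eventually.of_forall fun x => ?_)
      exact abs_le_max_abs_abs (clamp_mem hlh _).1 (clamp_mem hlh _).2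
    set Cl : ℕ → Lp ℝ 2 μ := fun n => (hcm (S.memLp_coe (a n))).toLp _ with hCl
    have hlip : ∀ (g k : X → ℝ) (hg : MemLp g 2 μ) (hk : MemLp k 2 μ),
        ‖(hcm hg).toLp _ - (hcm hk).toLp _‖ ≤ ‖hg.toLp g - hk.toLp k‖ := by
      intro g k hg hk
      rw [← MemLp.toLp_sub, ← MemLp.toLp_sub, Lp.norm_toLp, Lp.norm_toLp]
      exact ENNReal.toReal_mono (hg.sub hk).2.ne
        (eLpNorm_mono fun x => abs_clamp_sub_clamp_le lo hi _ _)
    have hFc : (hcm hf).toLp _ = F := by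
      rw [hF, MemLp.toLp_eq_toLp_iff]
      filter_upwards [hb] with x hx
      exact clamp_of_mem hx.1 hx.2
    have hvC : ∀ n, ‖S.toL2 (v n) - Cl n‖ ≤ 1 / ((n : ℝ) + 1) := fun n => by
      rw [hCl, norm_toL2_sub]
      exact ENNReal.toReal_le_of_le_ofReal (by positivity) (hv1 n)
    have hCF : ∀ n, ‖Cl n - F‖ ≤ ‖S.toL2 (a n) - F‖ := fun n => by
      have := hlip _ _ (S.memLp_coe (a n)) hf
      rwa [hFc] at this
    have hvC0 : Tendsto (fun n => S.toL2 (v n) - Cl n) atTop (𝓝 0) :=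
      squeeze_zero_norm hvC htend
    -- Truncation does not raise the energy, and it does not raise the distance to F either, since F
    -- is its own truncation. The v n, which stand in the algebra for truncations of the a n, are
    -- thus minimising too, and uniform convexity forces the same limit.
    have hJv : ∀ n, J (v n) ≤ J (a n) + (1 / ((n : ℝ) + 1) + lam * ((1 / ((n : ℝ) + 1)) *
        (2 * ‖S.toL2 (a n) - F‖ + 1 / ((n : ℝ) + 1)))) := fun n => by
      have h1 : ‖S.toL2 (v n) - F‖ ≤ 1 / ((n : ℝ) + 1) + ‖S.toL2 (a n) - F‖ := by
        have e : S.toL2 (v n) - F = (S.toL2 (v n) - Cl n) + (Cl n - F) := by abel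
        rw [e]
        exact (norm_add_le _ _).trans (add_le_add (hvC n) (hCF n))
      have h2 := pow_le_pow_left₀ (norm_nonneg _) h1 2
      have h3 := mul_le_mul_of_nonneg_left h2 hlam0.le
      rw [hJ, penalized, penalized]
      nlinarith [hv2 n]
    set err := fun n : ℕ => 1 / ((n : ℝ) + 1) + lam * ((1 / ((n : ℝ) + 1)) *
        (2 * ‖S.toL2 (a n) - F‖ + 1 / ((n : ℝ) + 1))) with herr
    have herr0 : Tendsto err atTop (𝓝 0) := by
      have h1 := (((hU.sub_const F).norm.const_mul 2).add htend)
      have h2 := htend.add ((htend.mul h1).const_mul lam)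
      simp only [zero_mul, mul_zero, add_zero] at h2
      exact h2
    have hva : Tendsto (fun n => S.toL2 (v n) - S.toL2 (a n)) atTop (𝓝 0) := by
      have h1 : ∀ n, ‖S.toL2 (v n) - S.toL2 (a n)‖ ^ 2 ≤
          (2 * ((1 / ((n : ℝ) + 1) + err n) + 1 / ((n : ℝ) + 1))) / lam := fun n => by
        have h2 := hclose (v n) (a n) (1 / ((n : ℝ) + 1) + err n) (1 / ((n : ℝ) + 1))
          (by linarith [hJv n, (ha n).le]) (ha n).le
        have h3 := S.preForm_nonneg (v n - a n)
        rw [le_div_iff₀ hlam0]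
        linarith
      have h2 : Tendsto (fun n => ‖S.toL2 (v n) - S.toL2 (a n)‖ ^ 2) atTop (𝓝 0) := by
        refine squeeze_zero (fun n => sq_nonneg _) h1 ?_
        simpa using (((htend.add herr0).add htend).const_mul 2).div_const lam
      have h3 := (Real.continuous_sqrt.tendsto 0).comp h2
      rw [Real.sqrt_zero] at h3
      refine tendsto_zero_iff_norm_tendsto_zero.2 (h3.congr fun n => ?_)
      exact Real.sqrt_sq (norm_nonneg _)
    have hClU : Tendsto Cl atTop (𝓝 U) := by
      have := (hva.add hU).sub hvC0
      simpa using this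
    have hClU' : Tendsto Cl atTop (𝓝 ((hcm hUm).toLp _)) := by
      rw [tendsto_iff_norm_sub_tendsto_zero]
      refine squeeze_zero (fun n => norm_nonneg _)
        (fun n => hlip _ _ (S.memLp_coe (a n)) hUm) ?_
      rw [hUe]
      exact tendsto_iff_norm_sub_tendsto_zero.1 hU
    -- The truncations of a n converge to U as near-minimisers and to the truncation of U by
    -- continuity, so U is its own truncation.
    have heq := hUe.trans (tendsto_nhds_unique hClU hClU')
    rw [MemLp.toLp_eq_toLp_iff] at heq
    filter_upwards [heq] with x hx
    rw [hx]
    exact clamp_mem hlh _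
  · have : 0 ≤ lam * ‖U - F‖ ^ 2 := by positivity
    linarith
  · rw [← hUF]
    have h1 : lam * ‖U - F‖ ^ 2 ≤ C := by linarith
    rw [hlam, div_mul_eq_mul_div, div_le_iff₀ hε] at h1
    nlinarith [sq_nonneg ‖U - F‖]

end DiffusionGenerator

/-! ### Integrals of essentially bounded functions -/

section Integrals

variable {X : Type*} [MeasurableSpace X] {μ : Measure X}

theorem integrable_of_ae_bounds [IsFiniteMeasure μ] {f : X → ℝ} (hf : AEStronglyMeasurable f μ)
    {lo hi : ℝ} (hb : ∀ᵐ x ∂μ, lo ≤ f x ∧ f x ≤ hi) : Integrable f μ :=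
  Integrable.of_bound hf (max |lo| |hi|) <| hb.mono fun _ hx => abs_le_max_abs_abs hx.1 hx.2

theorem memLp_of_ae_bounds [IsFiniteMeasure μ] {f : X → ℝ} (hf : AEStronglyMeasurable f μ)
    {lo hi : ℝ} (hb : ∀ᵐ x ∂μ, lo ≤ f x ∧ f x ≤ hi) : MemLp f 2 μ :=
  MemLp.of_bound hf (max |lo| |hi|) <| hb.mono fun _ hx => abs_le_max_abs_abs hx.1 hx.2

theorem integrable_pow_of_ae_bounds [IsFiniteMeasure μ] {f : X → ℝ}
    (hf : AEStronglyMeasurable f μ) {lo hi : ℝ} (hb : ∀ᵐ x ∂μ, lo ≤ f x ∧ f x ≤ hi) (k : ℕ) :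
    Integrable (fun x => f x ^ k) μ := by
  refine Integrable.of_bound (hf.pow k) (max |lo| |hi| ^ k) (hb.mono fun x hx => ?_)
  rw [norm_pow]
  exact pow_le_pow_left₀ (norm_nonneg _) (abs_le_max_abs_abs hx.1 hx.2) k

theorem osc_le_of_ae_bounds [NeZero μ] {f : X → ℝ} {lo hi : ℝ}
    (hb : ∀ᵐ x ∂μ, lo ≤ f x ∧ f x ≤ hi) : osc μ f ≤ hi - lo := by
  have h1 : IsBoundedUnder (· ≤ ·) (ae μ) f := ⟨hi, by simpa using hb.mono fun x hx => hx.2⟩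
  have h2 : IsBoundedUnder (· ≥ ·) (ae μ) f := ⟨lo, by simpa using hb.mono fun x hx => hx.1⟩
  have h3 : essSup f μ ≤ hi :=
    essSup_le_of_ae_le hi (hb.mono fun x hx => hx.2) h2.isCoboundedUnder_le
  have h4 : lo ≤ essInf f μ :=
    le_essInf_of_ae_le lo (hb.mono fun x hx => hx.1) h1.isCoboundedUnder_ge
  unfold osc
  linarith

theorem EssBounded.ae_mem {f : X → ℝ} (hf : EssBounded μ f) :
    ∀ᵐ x ∂μ, essInf f μ ≤ f x ∧ f x ≤ essSup f μ := by
  obtain ⟨C, hC⟩ := hf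
  have h1 : IsBoundedUnder (· ≤ ·) (ae μ) f :=
    ⟨C, by simpa using hC.mono fun x hx => (abs_le.1 hx).2⟩
  have h2 : IsBoundedUnder (· ≥ ·) (ae μ) f :=
    ⟨-C, by simpa using hC.mono fun x hx => (abs_le.1 hx).1⟩
  filter_upwards [ae_le_essSup h1, ae_essInf_le h2] with x h3 h4
  exact ⟨h4, h3⟩

/-- Cauchy–Schwarz against 1, in the form |h| ≤ (η + h²/η)/2. -/
theorem integral_abs_le_of_integral_sq_le [IsProbabilityMeasure μ] {h : X → ℝ} (hm : MemLp h 2 μ)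
    {η : ℝ} (hη : 0 < η) (hsq : ∫ x, h x ^ 2 ∂μ ≤ η ^ 2) : ∫ x, |h x| ∂μ ≤ η := by
  have hI : Integrable (fun x => h x ^ 2) μ := hm.integrable_sq
  calc ∫ x, |h x| ∂μ ≤ ∫ x, (η + h x ^ 2 / η) / 2 ∂μ := by
        refine integral_mono_of_nonneg (Eventually.of_forall fun x => abs_nonneg _)
          (((integrable_const _).add (hI.div_const _)).div_const _)
          (Eventually.of_forall fun x => ?_)
        simp only
        rw [← sq_abs (h x)]
        set z := |h x|
        rw [le_div_iff₀ two_pos, ← sub_nonneg]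
        have : η + z ^ 2 / η - z * 2 = (z - η) ^ 2 / η := by field_simp; ring
        rw [this]
        positivity
    _ = (η + (∫ x, h x ^ 2 ∂μ) / η) / 2 := by
        rw [integral_div, integral_add (integrable_const _) (hI.div_const _), integral_div]
        simp
    _ ≤ η := by
        have : (∫ x, h x ^ 2 ∂μ) / η ≤ η := by
          rw [div_le_iff₀ hη]; nlinarith
        linarith

/-- For uniformly bounded functions, convergence in `L¹` implies convergence of all moments. -/
theorem tendsto_integral_pow [IsFiniteMeasure μ] {f : X → ℝ} {u : ℕ → X → ℝ}
    (hf : AEStronglyMeasurable f μ) (hu : ∀ n, AEStronglyMeasurable (u n) μ) {lo hi : ℝ}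
    (hfb : ∀ᵐ x ∂μ, lo ≤ f x ∧ f x ≤ hi) (hub : ∀ n, ∀ᵐ x ∂μ, lo ≤ u n x ∧ u n x ≤ hi)
    (hlim : Tendsto (fun n => ∫ x, |u n x - f x| ∂μ) atTop (𝓝 0)) (k : ℕ) :
    Tendsto (fun n => ∫ x, u n x ^ k ∂μ) atTop (𝓝 (∫ x, f x ^ k ∂μ)) := by
  set B := max |lo| |hi| with hB
  rw [tendsto_iff_norm_sub_tendsto_zero]
  refine squeeze_zero (fun n => norm_nonneg _) (fun n => ?_)
    (by simpa using hlim.mul_const (k * B ^ (k - 1)))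
  rw [← integral_sub (integrable_pow_of_ae_bounds (hu n) (hub n) k)
    (integrable_pow_of_ae_bounds hf hfb k), ← integral_mul_const]
  refine (norm_integral_le_integral_norm _).trans ?_
  have hi1 : Integrable (fun x => |u n x - f x|) μ :=
    ((integrable_of_ae_bounds (hu n) (hub n)).sub (integrable_of_ae_bounds hf hfb)).abs
  refine integral_mono_of_nonneg (Eventually.of_forall fun x => norm_nonneg _)
    (hi1.mul_const _) ?_
  filter_upwards [hfb, hub n] with x h1 h2
  refine (abs_pow_sub_pow_le _ _ _).trans ?_
  rw [mul_assoc]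
  gcongr
  exact max_le (abs_le_max_abs_abs h2.1 h2.2) (abs_le_max_abs_abs h1.1 h1.2)

theorem sq_integral_mul_le {f g : X → ℝ} (hf : MemLp f 2 μ) (hg : MemLp g 2 μ) :
    (∫ x, f x * g x ∂μ) ^ 2 ≤ (∫ x, f x ^ 2 ∂μ) * ∫ x, g x ^ 2 ∂μ := by
  have hd : discrim (∫ x, g x ^ 2 ∂μ) (2 * ∫ x, f x * g x ∂μ) (∫ x, f x ^ 2 ∂μ) ≤ 0 := by
    refine discrim_le_zero fun t => ?_
    have h0 : 0 ≤ ∫ x, (f x + t * g x) ^ 2 ∂μ := integral_nonneg fun x => sq_nonneg _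
    have i1 := hf.integrable_sq
    have i2 := hg.integrable_sq
    have i3 : Integrable (fun x => f x * g x) μ := hf.integrable_mul hg
    have e : ∀ x, (f x + t * g x) ^ 2 = f x ^ 2 + ((2 * t) * (f x * g x) + t ^ 2 * g x ^ 2) :=
      fun x => by ring
    simp only [e] at h0
    have i4 : Integrable (fun x => (2 * t) * (f x * g x) + t ^ 2 * g x ^ 2) μ :=
      (i3.const_mul _).add (i2.const_mul _)
    rw [integral_add i1 i4,
      integral_add (i3.const_mul _) (i2.const_mul _), integral_const_mul, integral_const_mul] at h0
    nlinarith
  unfold discrim at hd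
  nlinarith

end Integrals

/-! ### Extension of the functional inequalities to the relaxed energy -/

namespace DiffusionGenerator

variable {X : Type u} [MeasurableSpace X] {μ : Measure X}

/-- The common bounds turn L² convergence of the regularisations into convergence of every moment,
which is all that both sides of the functional inequalities need besides the energy and the bounds.
-/
theorem exists_regularization_seq (S : DiffusionGenerator X μ) [IsProbabilityMeasure μ]
    {f : X → ℝ} (hf : AEStronglyMeasurable f μ) {C : ℝ} (hC : S.RelaxedLE f C) {lo hi : ℝ}
    (hlh : lo ≤ hi) (hb : ∀ᵐ x ∂μ, lo ≤ f x ∧ f x ≤ hi) :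
    ∃ u : ℕ → X → ℝ, (∀ n, u n ∈ S.friedrichsDomain) ∧
      (∀ n, ∀ᵐ x ∂μ, lo ≤ u n x ∧ u n x ≤ hi) ∧ (∀ n, S.energy (u n) ≤ C) ∧
      ∀ k : ℕ, Tendsto (fun n => ∫ x, u n x ^ k ∂μ) atTop (𝓝 (∫ x, f x ^ k ∂μ)) := by
  have hf2 : MemLp f 2 μ := memLp_of_ae_bounds hf hb
  have hex : ∀ n : ℕ, ∃ u ∈ S.friedrichsDomain, (∀ᵐ x ∂μ, lo ≤ u x ∧ u x ≤ hi) ∧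
      S.energy u ≤ C ∧ ∫ x, (u x - f x) ^ 2 ∂μ ≤ (1 / ((n : ℝ) + 1)) ^ 2 := fun n =>
    S.exists_regularization hf2 hC hlh hb (by positivity)
  choose u hu1 hu2 hu3 hu4 using hex
  refine ⟨u, hu1, hu2, hu3, tendsto_integral_pow hf (fun n => (hu1 n).1.1) hb hu2 ?_⟩
  refine squeeze_zero (fun n => integral_nonneg fun x => abs_nonneg _)
    (fun n => integral_abs_le_of_integral_sq_le ((hu1 n).1.sub hf2) (by positivity) (hu4 n))
    tendsto_one_div_add_atTop_nhds_zero_nat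

/-- The Hellinger inequality extends to the relaxed form. -/
theorem Hellinger.relaxed {S : DiffusionGenerator X μ} [IsProbabilityMeasure μ] {β : ℝ → ℝ}
    (h : S.Hellinger β) {s : ℝ} (hs : 0 < s) (hβ : 0 ≤ β s) {f : X → ℝ}
    (hf : AEStronglyMeasurable f μ) {C : ℝ} (hC : S.RelaxedLE f C) {lo hi : ℝ} (hlo : 0 ≤ lo)
    (hlh : lo ≤ hi) (hb : ∀ᵐ x ∂μ, lo ≤ f x ∧ f x ≤ hi) :
    √(∫ x, f x ^ 4 ∂μ) - ∫ x, f x ^ 2 ∂μ ≤ β s * C + s * (hi ^ 2 - lo ^ 2) := by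
  obtain ⟨u, hu1, hu2, hu3, hlim⟩ := S.exists_regularization_seq hf hC hlh hb
  refine le_of_tendsto' ((hlim 4).sqrt.sub (hlim 2)) fun n => ?_
  have hbd : EssBounded μ (u n) := ⟨max |lo| |hi|, (hu2 n).mono fun x hx =>
    abs_le_max_abs_abs hx.1 hx.2⟩
  refine (h s hs (u n) (hu1 n) hbd).trans ?_
  have ho : osc μ (fun x => u n x ^ 2) ≤ hi ^ 2 - lo ^ 2 :=
    osc_le_of_ae_bounds ((hu2 n).mono fun x hx =>
      ⟨pow_le_pow_left₀ hlo hx.1 2, pow_le_pow_left₀ (hlo.trans hx.1) hx.2 2⟩)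
  exact add_le_add (mul_le_mul_of_nonneg_left (hu3 n) hβ) (mul_le_mul_of_nonneg_left ho hs.le)

theorem variance_eq_of_ae_bounds [IsProbabilityMeasure μ] {f : X → ℝ}
    (hf : MemLp f 2 μ) :
    ProbabilityTheory.variance f μ = ∫ x, f x ^ 2 ∂μ - (∫ x, f x ^ 1 ∂μ) ^ 2 := by
  rw [ProbabilityTheory.variance_eq_sub hf]
  simp

/-- The weak Poincaré inequality extends to the relaxed form. -/
theorem WeakPoincare.relaxed {S : DiffusionGenerator X μ} [IsProbabilityMeasure μ] {β : ℝ → ℝ}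
    (h : S.WeakPoincare β) {s : ℝ} (hs : 0 < s) (hβ : 0 ≤ β s) {f : X → ℝ}
    (hf : AEStronglyMeasurable f μ) {C : ℝ} (hC : S.RelaxedLE f C) {lo hi : ℝ}
    (hlh : lo ≤ hi) (hb : ∀ᵐ x ∂μ, lo ≤ f x ∧ f x ≤ hi) :
    ∫ x, f x ^ 2 ∂μ - (∫ x, f x ∂μ) ^ 2 ≤ β s * C + s * (hi - lo) ^ 2 := by
  obtain ⟨u, hu1, hu2, hu3, hlim⟩ := S.exists_regularization_seq hf hC hlh hb
  have hl := (hlim 2).sub ((hlim 1).pow 2)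
  simp only [pow_one] at hl
  refine le_of_tendsto' hl fun n => ?_
  have hbd : EssBounded μ (u n) := ⟨max |lo| |hi|, (hu2 n).mono fun x hx =>
    abs_le_max_abs_abs hx.1 hx.2⟩
  have hv := h s hs (u n) (hu1 n) hbd
  rw [variance_eq_of_ae_bounds (hu1 n).1] at hv
  simp only [pow_one] at hv
  refine hv.trans ?_
  have ho0 : 0 ≤ osc μ (u n) := by
    obtain ⟨x, hx⟩ := hbd.ae_mem.exists
    unfold osc
    linarith [hx.1, hx.2]
  have ho : osc μ (u n) ^ 2 ≤ (hi - lo) ^ 2 :=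
    pow_le_pow_left₀ ho0 (osc_le_of_ae_bounds (hu2 n)) 2
  exact add_le_add (mul_le_mul_of_nonneg_left (hu3 n) hβ) (mul_le_mul_of_nonneg_left ho hs.le)

end DiffusionGenerator

/-! ### Hardy inequalities from capacity bounds -/

/-- A discrete Hardy inequality: `p` and `q` play the role of a solution of a Riccati
inequality in the resistance coordinate `R`. -/
theorem discrete_hardy {p q : ℝ → ℝ}
    (hpq : ∀ r r', 0 ≤ r → r ≤ r' → p r' ^ 2 * (r' - r) ≤ q r - q r')
    {B : ℝ} (hpB : ∀ r, 0 ≤ r → p r ≤ B) (hq : ∀ r, 0 ≤ r → 0 ≤ q r)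
    {d : ℝ} {e : ℕ → ℝ} (he : ∀ i, 0 < e i) (N : ℕ) :
    ∑ j ∈ Finset.range N, d ^ 2 * (2 * j + 3) *
      (p (∑ i ∈ Finset.range (j + 1), d ^ 2 / e i) - q (∑ i ∈ Finset.range (j + 1), d ^ 2 / e i)) ≤
      ∑ i ∈ Finset.range N, e i + d ^ 2 * (N * B + q 0) := by
  set R : ℕ → ℝ := fun k => ∑ i ∈ Finset.range k, d ^ 2 / e i with hR
  have hr : ∀ i, 0 ≤ d ^ 2 / e i := fun i => div_nonneg (sq_nonneg _) (he i).le
  have hR0 : ∀ k, 0 ≤ R k := fun k => Finset.sum_nonneg fun i _ => hr i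
  have hRs : ∀ k, R (k + 1) = R k + d ^ 2 / e k := fun k => Finset.sum_range_succ _ _
  -- Discrete form of 2cp - c²p²/e ≤ e at c = (i + 1)d: complete the square and replace p² times the
  -- resistance of the slice by the decrease of q.
  have hstep : ∀ i : ℕ, 2 * d ^ 2 * (i + 1) * p (R (i + 1)) -
      d ^ 2 * ((i : ℝ) + 1) ^ 2 * (q (R i) - q (R (i + 1))) ≤ e i := by
    intro i
    have h1 := hpq (R i) (R (i + 1)) (hR0 i) (by rw [hRs]; linarith [hr i])
    rw [show R (i + 1) - R i = d ^ 2 / e i by rw [hRs]; ring] at h1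
    set P := p (R (i + 1))
    have h2 : d ^ 2 * ((i : ℝ) + 1) ^ 2 * (P ^ 2 * (d ^ 2 / e i)) ≤
        d ^ 2 * ((i : ℝ) + 1) ^ 2 * (q (R i) - q (R (i + 1))) :=
      mul_le_mul_of_nonneg_left h1 (by positivity)
    have h3 : e i - 2 * d ^ 2 * (i + 1) * P + d ^ 2 * ((i : ℝ) + 1) ^ 2 * (P ^ 2 * (d ^ 2 / e i)) =
        (e i - d ^ 2 * (i + 1) * P) ^ 2 / e i := by
      have := (he i).ne'
      field_simp
      ring
    have h4 : 0 ≤ (e i - d ^ 2 * (i + 1) * P) ^ 2 / e i := div_nonneg (sq_nonneg _) (he i).le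
    linarith
  -- Summation by parts of `hstep`. The weight 2j + 3 exceeds 2(j + 1) by one; the surplus is the
  -- term d² ∑ p, a discretisation error.
  have hmain : ∀ N : ℕ, ∑ j ∈ Finset.range N, d ^ 2 * (2 * j + 3) * p (R (j + 1)) +
      d ^ 2 * N ^ 2 * q (R N) ≤ ∑ i ∈ Finset.range N, e i +
      d ^ 2 * ∑ j ∈ Finset.range N, p (R (j + 1)) +
      ∑ j ∈ Finset.range N, d ^ 2 * (2 * j + 1) * q (R j) := by
    intro N
    induction N with
    | zero => simp
    | succ N ih =>
      rw [Finset.sum_range_succ, Finset.sum_range_succ, Finset.sum_range_succ,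
        Finset.sum_range_succ]
      have := hstep N
      push_cast
      nlinarith
  -- Re-indexing aligns the weights of q with those of p, at the cost of the boundary term d² q(0).
  have hshift : ∀ N : ℕ, ∑ j ∈ Finset.range N, d ^ 2 * (2 * j + 1) * q (R j) ≤
      d ^ 2 * q 0 + ∑ j ∈ Finset.range N, d ^ 2 * (2 * j + 3) * q (R (j + 1)) := by
    intro N
    have h1 := Finset.sum_range_succ (fun j : ℕ => d ^ 2 * (2 * j + 1) * q (R j)) N
    have h2 := Finset.sum_range_succ' (fun j : ℕ => d ^ 2 * (2 * j + 1) * q (R j)) N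
    have h3 : 0 ≤ d ^ 2 * (2 * (N : ℝ) + 1) * q (R N) :=
      mul_nonneg (by positivity) (hq _ (hR0 N))
    have h4 : ∑ j ∈ Finset.range N, d ^ 2 * (2 * ((j + 1 : ℕ) : ℝ) + 1) * q (R (j + 1)) =
        ∑ j ∈ Finset.range N, d ^ 2 * (2 * j + 3) * q (R (j + 1)) :=
      Finset.sum_congr rfl fun j _ => by push_cast; ring
    have h5 : R 0 = 0 := by simp [hR]
    rw [h4] at h2
    simp only [h5] at h2
    push_cast at h2
    linarith
  have hB : ∑ j ∈ Finset.range N, p (R (j + 1)) ≤ N * B := by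
    have := Finset.sum_le_card_nsmul (Finset.range N) (fun j => p (R (j + 1))) B
      fun j _ => hpB _ (hR0 _)
    simpa using this
  have hB' := mul_le_mul_of_nonneg_left hB (sq_nonneg d)
  have h1 := hmain N
  have h2 := hshift N
  have h3 : 0 ≤ d ^ 2 * N ^ 2 * q (R N) := mul_nonneg (by positivity) (hq _ (hR0 N))
  simp only [mul_sub, Finset.sum_sub_distrib]
  linarith

section Hardy

variable {X : Type*} [MeasurableSpace X] {μ : Measure X}

theorem setIntegral_slices {a : X → ℝ} (ha : Measurable a) {h : X → ℝ} (hh : Integrable h μ)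
    {d : ℝ} (hd : 0 ≤ d) (k : ℕ) :
    ∫ x in a ⁻¹' Set.Ioc 0 (k * d), h x ∂μ =
      ∑ i ∈ Finset.range k, ∫ x in a ⁻¹' Set.Ioc (i * d) ((i + 1) * d), h x ∂μ := by
  induction k with
  | zero => simp
  | succ k ih =>
    rw [Finset.sum_range_succ, ← ih]
    have e : Set.Ioc 0 (((k + 1 : ℕ) : ℝ) * d) =
        Set.Ioc 0 (k * d) ∪ Set.Ioc (k * d) (((k : ℝ) + 1) * d) := by
      rw [Set.Ioc_union_Ioc_eq_Ioc (by positivity) (by nlinarith)]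
      push_cast
      rfl
    rw [e, Set.preimage_union, setIntegral_union ?_ (ha measurableSet_Ioc) hh.integrableOn
      hh.integrableOn]
    refine Disjoint.preimage _ ?_
    rw [Set.disjoint_left]
    exact fun x hx hx' => absurd hx'.1 (not_lt.2 hx.2)

/-- Antitone functions: upper Riemann sum for `∫ 2 c T(c) dc`. -/
theorem integral_two_mul_antitone_le {T : ℝ → ℝ} (hT : Antitone T) {d : ℝ} (hd : 0 ≤ d) (k : ℕ) :
    ∫ c in (0 : ℝ)..(k * d), 2 * c * T c ≤
      ∑ j ∈ Finset.range k, d ^ 2 * (2 * j + 1) * T (j * d) := by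
  have hii : ∀ y z : ℝ, IntervalIntegrable (fun c => 2 * c * T c) volume y z := fun y z =>
    (hT.intervalIntegrable).continuousOn_mul (by fun_prop)
  have hs := intervalIntegral.sum_integral_adjacent_intervals (f := fun c => 2 * c * T c)
    (μ := volume) (a := fun i : ℕ => (i : ℝ) * d) (n := k) fun i _ => hii _ _
  simp only [Nat.cast_zero, zero_mul] at hs
  rw [← hs]
  refine Finset.sum_le_sum fun j _ => ?_
  have hle : (j : ℝ) * d ≤ ((j + 1 : ℕ) : ℝ) * d := by push_cast; nlinarith
  calc ∫ c in ((j : ℝ) * d)..(((j + 1 : ℕ) : ℝ) * d), 2 * c * T c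
      ≤ ∫ c in ((j : ℝ) * d)..(((j + 1 : ℕ) : ℝ) * d), T (j * d) * (2 * c) := by
        refine intervalIntegral.integral_mono_on hle (hii _ _)
          (Continuous.intervalIntegrable (by fun_prop) _ _) fun c hc => ?_
        have h0 : 0 ≤ c := le_trans (by positivity) hc.1
        nlinarith [hT hc.1]
    _ = d ^ 2 * (2 * j + 1) * T (j * d) := by
        rw [intervalIntegral.integral_const_mul, intervalIntegral.integral_const_mul, integral_id]
        push_cast
        ring

/-- A Hardy-type inequality: from bounds on the capacities of the level sets of `a` to bounds on
`∫ 2 c T(c) dc`. -/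
theorem hardy {a : X → ℝ} (ha : Measurable a) {w : X → ℝ} (hw : Integrable w μ)
    (hw0 : ∀ᵐ x ∂μ, 0 ≤ w x) {T : ℝ → ℝ} (hT : Antitone T) (hT1 : ∀ c, T c ≤ 1)
    {p q : ℝ → ℝ} (hpq : ∀ r r', 0 ≤ r → r ≤ r' → p r' ^ 2 * (r' - r) ≤ q r - q r')
    {B : ℝ} (hp0 : ∀ r, 0 ≤ r → 0 ≤ p r) (hpB : ∀ r, 0 ≤ r → p r ≤ B) (hq : ∀ r, 0 ≤ r → 0 ≤ q r)
    {C δ M : ℝ} (hC : 0 ≤ C) (hδ : 0 ≤ δ) (hM : 0 ≤ M)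
    (hcap : ∀ c, 0 < c → c ≤ M → ∀ R, 0 < R → ∀ g : ℝ → ℝ, Measurable g →
      (∃ K, ∀ t, g t ≤ K) → (∀ t, 0 ≤ g t) → ∫ t in (0 : ℝ)..c, g t = 1 →
      ∫ x in a ⁻¹' Set.Ioc 0 c, g (a x) ^ 2 * w x ∂μ ≤ 1 / R → T c ≤ C * (p R - q R) + δ) :
    ∫ c in (0 : ℝ)..M, 2 * c * T c ≤ C * ∫ x in a ⁻¹' Set.Ioi 0, w x ∂μ + δ * M ^ 2 := by
  rcases hM.eq_or_lt with rfl | hM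
  · have : 0 ≤ ∫ x in a ⁻¹' Set.Ioi 0, w x ∂μ :=
      setIntegral_nonneg_of_ae hw0
    simp only [intervalIntegral.integral_same]
    positivity
  set W := ∫ x in a ⁻¹' Set.Ioi 0, w x ∂μ with hW
  have hq0 := hq 0 le_rfl
  have hB0 : 0 ≤ B := (hp0 0 le_rfl).trans (hpB 0 le_rfl)
  have key : ∀ N : ℕ, ∫ c in (0 : ℝ)..M, 2 * c * T c ≤ C * W + δ * M ^ 2 +
      (M ^ 2 + C * (1 + M ^ 2 * (B + q 0))) * (1 / ((N : ℝ) + 1)) := by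
    intro N
    set d : ℝ := M / (N + 1) with hd
    have hd0 : 0 < d := by positivity
    have hNd : ((N + 1 : ℕ) : ℝ) * d = M := by rw [hd]; push_cast; field_simp
    -- A slice may carry no energy; adding ε keeps its resistance finite, and N slices add at most
    -- 1/(N + 1) in total.
    set ε : ℝ := (1 / ((N : ℝ) + 1)) ^ 2 with hε
    have hε0 : 0 < ε := by positivity
    set e : ℕ → ℝ := fun i => ∫ x in a ⁻¹' Set.Ioc (i * d) ((i + 1) * d), w x ∂μ + ε with he
    have hsl0 : ∀ i : ℕ, 0 ≤ ∫ x in a ⁻¹' Set.Ioc (i * d) ((i + 1) * d), w x ∂μ := fun i =>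
      setIntegral_nonneg_of_ae hw0
    have heε : ∀ i, ε ≤ e i := fun i => by rw [he]; linarith [hsl0 i]
    have he0 : ∀ i, 0 < e i := fun i => hε0.trans_le (heε i)
    set R : ℕ → ℝ := fun k => ∑ i ∈ Finset.range k, d ^ 2 / e i with hR
    have hRpos : ∀ k, 0 < R (k + 1) := fun k =>
      Finset.sum_pos (fun i _ => div_pos (by positivity) (he0 i)) (by simp)
    have hTj : ∀ j ∈ Finset.range N, T (((j + 1 : ℕ) : ℝ) * d) ≤
        C * (p (R (j + 1)) - q (R (j + 1))) + δ := by
      intro j hj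
      have hjN : j < N := Finset.mem_range.1 hj
      set ρ := R (j + 1) with hρ
      have hρ0 : 0 < ρ := hRpos j
      -- The profile of the equilibrium potential of slices in series: its slope on slice i is
      -- proportional to d²/e i, normalised to total increase 1, and its energy is then at most 1/ρ.
      -- The index ⌈t/d⌉ - 1 is that of the half-open slice containing t.
      set g : ℝ → ℝ := fun t => d ^ 2 / e (⌈t / d⌉₊ - 1) / (ρ * d) with hg
      have hgs : ∀ i : ℕ, ∀ t ∈ Set.Ioc ((i : ℝ) * d) (((i : ℝ) + 1) * d),
          g t = d ^ 2 / e i / (ρ * d) := by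
        intro i t ht
        have : ⌈t / d⌉₊ = i + 1 := by
          rw [Nat.ceil_eq_iff (by simp)]
          constructor
          · simpa [lt_div_iff₀ hd0] using ht.1
          · rw [div_le_iff₀ hd0]; push_cast; exact ht.2
        simp only [hg, this, Nat.add_sub_cancel]
      have hg0 : ∀ t, 0 ≤ g t := fun t => by
        have := he0 (⌈t / d⌉₊ - 1)
        simp only [hg]; positivity
      have hgK : ∀ t, g t ≤ d ^ 2 / ε / (ρ * d) := fun t => by
        have := heε (⌈t / d⌉₊ - 1)
        simp only [hg]
        gcongr
      have hgm : Measurable g := by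
        have h1 : Measurable fun t : ℝ => ⌈t / d⌉₊ := Nat.measurable_ceil.comp (by fun_prop)
        exact (measurable_from_nat (f := fun n : ℕ => d ^ 2 / e (n - 1) / (ρ * d))).comp h1
      refine hcap _ (by positivity) ?_ ρ hρ0 g hgm ⟨_, hgK⟩ hg0 ?_ ?_
      · rw [← hNd]
        have : ((j + 1 : ℕ) : ℝ) ≤ ((N + 1 : ℕ) : ℝ) := by exact_mod_cast Nat.succ_le_succ hjN.le
        exact mul_le_mul_of_nonneg_right this hd0.le
      · have hint : ∀ y z : ℝ, IntervalIntegrable g volume y z := fun y z => by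
          rw [intervalIntegrable_iff]
          refine Measure.integrableOn_of_bounded (M := d ^ 2 / ε / (ρ * d)) (by simp)
            hgm.aestronglyMeasurable (Eventually.of_forall fun t => ?_)
          rw [Real.norm_eq_abs, abs_of_nonneg (hg0 t)]
          exact hgK t
        have hs := intervalIntegral.sum_integral_adjacent_intervals (f := g)
          (μ := volume) (a := fun i : ℕ => (i : ℝ) * d) (n := j + 1) fun i _ => hint _ _
        simp only [Nat.cast_zero, zero_mul] at hs
        rw [← hs]
        have hpiece : ∀ i ∈ Finset.range (j + 1),
            ∫ t in ((i : ℝ) * d)..(((i + 1 : ℕ) : ℝ) * d), g t = d ^ 2 / e i / ρ := by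
          intro i _
          have hle : (i : ℝ) * d ≤ ((i + 1 : ℕ) : ℝ) * d := by push_cast; nlinarith
          rw [intervalIntegral.integral_of_le hle]
          have : ∫ t in Set.Ioc ((i : ℝ) * d) (((i + 1 : ℕ) : ℝ) * d), g t =
              ∫ t in Set.Ioc ((i : ℝ) * d) (((i + 1 : ℕ) : ℝ) * d), d ^ 2 / e i / (ρ * d) := by
            refine setIntegral_congr_fun measurableSet_Ioc fun t ht => ?_
            push_cast at ht
            exact hgs i t ht
          rw [this, setIntegral_const, Real.volume_real_Ioc_of_le hle, smul_eq_mul]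
          push_cast
          field_simp
          ring
        rw [Finset.sum_congr rfl hpiece, ← Finset.sum_div]
        exact div_self hρ0.ne'
      · have hgi : Integrable (fun x => g (a x) ^ 2 * w x) μ := by
          refine hw.bdd_mul (c := (d ^ 2 / ε / (ρ * d)) ^ 2)
            ((hgm.comp ha).pow_const 2).aestronglyMeasurable (Eventually.of_forall fun x => ?_)
          rw [Real.norm_eq_abs, abs_pow, abs_of_nonneg (hg0 _)]
          exact pow_le_pow_left₀ (hg0 _) (hgK _) 2
        rw [setIntegral_slices ha hgi hd0.le]
        have hpiece : ∀ i ∈ Finset.range (j + 1),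
            ∫ x in a ⁻¹' Set.Ioc (i * d) ((i + 1) * d), g (a x) ^ 2 * w x ∂μ ≤
              d ^ 2 / e i / ρ ^ 2 := by
          intro i _
          have : ∫ x in a ⁻¹' Set.Ioc (i * d) ((i + 1) * d), g (a x) ^ 2 * w x ∂μ =
              ∫ x in a ⁻¹' Set.Ioc (i * d) ((i + 1) * d), (d ^ 2 / e i / (ρ * d)) ^ 2 * w x ∂μ := by
            refine setIntegral_congr_fun (ha measurableSet_Ioc) fun x hx => ?_
            rw [hgs i (a x) hx]
          rw [this, integral_const_mul]
          have h1 : ∫ x in a ⁻¹' Set.Ioc (i * d) ((i + 1) * d), w x ∂μ ≤ e i := by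
            simp only [he]; linarith
          have h2 := mul_le_mul_of_nonneg_left h1 (sq_nonneg (d ^ 2 / e i / (ρ * d)))
          refine h2.trans (le_of_eq ?_)
          have := (he0 i).ne'
          field_simp
        refine (Finset.sum_le_sum hpiece).trans (le_of_eq ?_)
        rw [← Finset.sum_div]
        change ρ / ρ ^ 2 = 1 / ρ
        field_simp
    have hup := integral_two_mul_antitone_le hT hd0.le (N + 1)
    rw [hNd, Finset.sum_range_succ'] at hup
    have hdh := discrete_hardy hpq hpB hq (d := d) he0 N
    -- No capacity bound is available at level 0; the trivial bound T ≤ 1 there costs d², which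
    -- vanishes in the limit.
    have h0 : d ^ 2 * (2 * ((0 : ℕ) : ℝ) + 1) * T (((0 : ℕ) : ℝ) * d) ≤ d ^ 2 := by
      have := hT1 (((0 : ℕ) : ℝ) * d)
      push_cast at this ⊢
      nlinarith [sq_nonneg d]
    have h1 : ∑ j ∈ Finset.range N, d ^ 2 * (2 * ((j + 1 : ℕ) : ℝ) + 1) *
        T (((j + 1 : ℕ) : ℝ) * d) ≤ ∑ j ∈ Finset.range N, (C * (d ^ 2 * (2 * j + 3) *
          (p (R (j + 1)) - q (R (j + 1)))) + d ^ 2 * (2 * j + 3) * δ) := by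
      refine Finset.sum_le_sum fun j hj => ?_
      have h2 : 0 ≤ d ^ 2 * (2 * (j : ℝ) + 3) := by positivity
      have h3 := mul_le_mul_of_nonneg_left (hTj j hj) h2
      push_cast at h3 ⊢
      linarith
    rw [Finset.sum_add_distrib, ← Finset.mul_sum, ← Finset.sum_mul] at h1
    have h2 : ∑ j ∈ Finset.range N, d ^ 2 * (2 * (j : ℝ) + 3) ≤ M ^ 2 := by
      have : ∀ n : ℕ, ∑ j ∈ Finset.range n, d ^ 2 * (2 * (j : ℝ) + 3) = d ^ 2 * (n ^ 2 + 2 * n) := by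
        intro n
        induction n with
        | zero => simp
        | succ n ih => rw [Finset.sum_range_succ, ih]; push_cast; ring
      rw [this, ← hNd]
      push_cast
      nlinarith [sq_nonneg d]
    have h3 : ∑ i ∈ Finset.range N, e i ≤ W + 1 / ((N : ℝ) + 1) := by
      simp only [he]
      rw [Finset.sum_add_distrib, ← setIntegral_slices ha hw hd0.le]
      refine add_le_add ?_ ?_
      · exact setIntegral_mono_set hw.integrableOn (ae_restrict_of_ae hw0)
          (Eventually.of_forall fun x hx => hx.1)
      · rw [Finset.sum_const, Finset.card_range, nsmul_eq_mul, hε, pow_two, ← mul_assoc]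
        have : (N : ℝ) * (1 / ((N : ℝ) + 1)) ≤ 1 := by
          rw [mul_one_div, div_le_one (by positivity)]; linarith
        exact mul_le_of_le_one_left (by positivity) this
    have h4 : d ^ 2 ≤ M ^ 2 * (1 / ((N : ℝ) + 1)) := by
      have hN1 : (1 : ℝ) / ((N : ℝ) + 1) ≤ 1 := by
        rw [div_le_one (by positivity)]; linarith [(Nat.cast_nonneg N : (0 : ℝ) ≤ N)]
      have e1 : d ^ 2 = M ^ 2 * (1 / ((N : ℝ) + 1)) * (1 / ((N : ℝ) + 1)) := by
        rw [hd]; field_simp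
      rw [e1]
      exact mul_le_of_le_one_right (by positivity) hN1
    have h5 : d ^ 2 * (N * B + q 0) ≤ M ^ 2 * (B + q 0) * (1 / ((N : ℝ) + 1)) := by
      have e1 : d ^ 2 * (N * B + q 0) =
          M ^ 2 * (1 / ((N : ℝ) + 1)) * ((N * B + q 0) / ((N : ℝ) + 1)) := by
        rw [hd]; field_simp
      have e2 : (N * B + q 0) / ((N : ℝ) + 1) ≤ B + q 0 := by
        rw [div_le_iff₀ (by positivity)]
        nlinarith [(Nat.cast_nonneg N : (0 : ℝ) ≤ N), mul_nonneg (Nat.cast_nonneg N : (0 : ℝ) ≤ N) hq0]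
      rw [e1]
      have := mul_le_mul_of_nonneg_left e2 (show 0 ≤ M ^ 2 * (1 / ((N : ℝ) + 1)) by positivity)
      linarith
    have h6 := mul_le_mul_of_nonneg_left (hdh.trans (add_le_add h3 h5)) hC
    have h7 := mul_le_mul_of_nonneg_right h2 hδ
    simp only [hR] at h1
    linarith
  have hl : Tendsto (fun N : ℕ => C * W + δ * M ^ 2 +
      (M ^ 2 + C * (1 + M ^ 2 * (B + q 0))) * (1 / ((N : ℝ) + 1))) atTop
      (𝓝 (C * W + δ * M ^ 2)) := by
    have h := (tendsto_one_div_add_atTop_nhds_zero_nat (𝕜 := ℝ).const_mul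
      (M ^ 2 + C * (1 + M ^ 2 * (B + q 0)))).const_add (C * W + δ * M ^ 2)
    rw [mul_zero, add_zero] at h
    exact h
  exact ge_of_tendsto' hl key

end Hardy

/-! ### Layer cake formulas and a dual bound for the Hellinger functional -/

section Layers

variable {X : Type*} [MeasurableSpace X] {μ : Measure X}

theorem integral_two_mul_indicator_Iic {M : ℝ} (hM : 0 ≤ M) (y : ℝ) :
    ∫ c in (0 : ℝ)..M, (Set.Iic y).indicator (fun c => 2 * c) c = clamp 0 M y ^ 2 := by
  rw [intervalIntegral.integral_of_le hM, setIntegral_indicator measurableSet_Iic]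
  have e : Set.Ioc 0 M ∩ Set.Iic y = Set.Ioc 0 (clamp 0 M y) := by
    ext c
    simp only [clamp, Set.mem_inter_iff, Set.mem_Ioc, Set.mem_Iic, le_max_iff, le_min_iff]
    constructor
    · rintro ⟨⟨h1, h2⟩, h3⟩
      exact ⟨h1, Or.inr ⟨h2, h3⟩⟩
    · rintro ⟨h1, h2 | h2⟩
      · exact absurd h1 (not_lt.2 h2)
      · exact ⟨⟨h1, h2.1⟩, h2.2⟩
  rw [e, ← intervalIntegral.integral_of_le (clamp_mem hM y).1,
    intervalIntegral.integral_const_mul, integral_id]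
  ring

/-- The layer cake formula for the square of a truncation. -/
theorem integral_clamp_sq_mul [IsFiniteMeasure μ] {a : X → ℝ} (ha : Measurable a) {H : X → ℝ}
    (hH : Measurable H) {K : ℝ} (hK : ∀ x, |H x| ≤ K) {M : ℝ} (hM : 0 ≤ M) :
    ∫ x, clamp 0 M (a x) ^ 2 * H x ∂μ =
      ∫ c in (0 : ℝ)..M, 2 * c * ∫ x in a ⁻¹' Set.Ici c, H x ∂μ := by
  have hS : MeasurableSet {z : X × ℝ | z.2 ≤ a z.1} :=
    measurableSet_le measurable_snd (ha.comp measurable_fst)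
  have hint : Integrable (Function.uncurry fun (x : X) (c : ℝ) =>
      (Set.Iic (a x)).indicator (fun c => 2 * c) c * H x)
      (μ.prod (volume.restrict (Set.Ioc 0 M))) := by
    refine Integrable.of_bound (C := 2 * M * K) ?_ ?_
    · have e : (Function.uncurry fun (x : X) (c : ℝ) =>
          (Set.Iic (a x)).indicator (fun c => 2 * c) c * H x) =
          fun z : X × ℝ => {z : X × ℝ | z.2 ≤ a z.1}.indicator (fun z => 2 * z.2) z * H z.1 := by
        ext ⟨x, c⟩
        simp [Function.uncurry, Set.indicator]
      rw [e]
      exact (((measurable_snd.const_mul 2).indicator hS).mul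
        (hH.comp measurable_fst)).aestronglyMeasurable
    · have h1 : ∀ᵐ c ∂(volume.restrict (Set.Ioc 0 M)), c ∈ Set.Ioc 0 M :=
        ae_restrict_mem measurableSet_Ioc
      have h2 : ∀ᵐ z ∂(μ.prod (volume.restrict (Set.Ioc 0 M))), z.2 ∈ Set.Ioc 0 M :=
        Measure.quasiMeasurePreserving_snd.ae h1
      filter_upwards [h2] with z hz
      obtain ⟨x, c⟩ := z
      simp only [Function.uncurry, norm_mul]
      refine mul_le_mul ?_ (hK x) (norm_nonneg _) (by positivity)
      refine (norm_indicator_le_norm_self _ _).trans ?_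
      rw [Real.norm_eq_abs, abs_of_nonneg (by linarith [hz.1])]
      linarith [hz.2]
  have hsw := integral_integral_swap hint
  have e1 : ∀ x, ∫ c in Set.Ioc 0 M, (Set.Iic (a x)).indicator (fun c => 2 * c) c * H x =
      clamp 0 M (a x) ^ 2 * H x := fun x => by
    rw [integral_mul_const, ← intervalIntegral.integral_of_le hM, integral_two_mul_indicator_Iic hM]
  simp only [e1] at hsw
  rw [hsw, intervalIntegral.integral_of_le hM]
  refine integral_congr_ae (Eventually.of_forall fun c => ?_)
  simp only
  rw [← integral_indicator (ha measurableSet_Ici), ← integral_const_mul]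
  refine integral_congr_ae (Eventually.of_forall fun x => ?_)
  by_cases h : c ≤ a x <;> simp [Set.indicator, h]

theorem integral_clamp_sq [IsFiniteMeasure μ] {a : X → ℝ} (ha : Measurable a) {M : ℝ}
    (hM : 0 ≤ M) :
    ∫ x, clamp 0 M (a x) ^ 2 ∂μ = ∫ c in (0 : ℝ)..M, 2 * c * μ.real (a ⁻¹' Set.Ici c) := by
  have := integral_clamp_sq_mul (μ := μ) ha (H := fun _ => 1) measurable_const (K := 1) (by simp) hM
  simpa using this

/-- A lower bound for the Hellinger functional of a function which is constant on two sets. -/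
theorem le_sqrt_integral_pow_four_sub [IsProbabilityMeasure μ] {φ : X → ℝ} (hφ : Measurable φ)
    (hb : ∀ x, 0 ≤ φ x ∧ φ x ≤ 1) {A Z : Set X} (hA : MeasurableSet A) (hZ : MeasurableSet Z)
    (hAZ : Disjoint A Z) {α : ℝ} (hφA : ∀ x ∈ A, φ x = 1) (hφZ : ∀ x ∈ Z, φ x = α) {x y : ℝ}
    (hxy : μ.real A * (x ^ 2 - 1) ≤ μ.real Z * (1 - y ^ 2)) :
    μ.real A * (x - 1) - α ^ 2 * (μ.real Z * (1 - y)) ≤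
      √(∫ t, φ t ^ 4 ∂μ) - ∫ t, φ t ^ 2 ∂μ := by
  -- The dual weight: x on A, y on Z and 1 elsewhere. The hypothesis on x and y says exactly that ∫
  -- η² ≤ 1, and ∫ φ²(η - 1) is the lower bound sought.
  set η : X → ℝ := fun t => 1 + (A.indicator (fun _ => x - 1) t + Z.indicator (fun _ => y - 1) t)
    with hη
  have hηm : Measurable η :=
    measurable_const.add ((measurable_const.indicator hA).add (measurable_const.indicator hZ))
  have cases : ∀ t, (t ∈ A ∧ t ∉ Z) ∨ (t ∉ A ∧ t ∈ Z) ∨ (t ∉ A ∧ t ∉ Z) := fun t => by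
    by_cases h1 : t ∈ A
    · exact Or.inl ⟨h1, fun h2 => Set.disjoint_left.1 hAZ h1 h2⟩
    · by_cases h2 : t ∈ Z
      · exact Or.inr (Or.inl ⟨h1, h2⟩)
      · exact Or.inr (Or.inr ⟨h1, h2⟩)
  have iA : ∀ k : ℝ, Integrable (A.indicator fun _ => k) μ := fun k =>
    (integrable_const k).indicator hA
  have iZ : ∀ k : ℝ, Integrable (Z.indicator fun _ => k) μ := fun k =>
    (integrable_const k).indicator hZ
  have vA : ∀ k : ℝ, ∫ t, A.indicator (fun _ => k) t ∂μ = μ.real A * k := fun k => by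
    rw [integral_indicator hA, setIntegral_const, smul_eq_mul]
  have vZ : ∀ k : ℝ, ∫ t, Z.indicator (fun _ => k) t ∂μ = μ.real Z * k := fun k => by
    rw [integral_indicator hZ, setIntegral_const, smul_eq_mul]
  have iAZ : ∀ k l : ℝ, Integrable
      (fun t => A.indicator (fun _ => k) t + Z.indicator (fun _ => l) t) μ := fun k l =>
    (iA k).add (iZ l)
  have hφb : ∀ᵐ t ∂μ, (0 : ℝ) ≤ φ t ∧ φ t ≤ 1 := Eventually.of_forall hb
  have i2 : Integrable (fun t => φ t ^ 2) μ :=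
    integrable_pow_of_ae_bounds hφ.aestronglyMeasurable hφb 2
  have e1 : ∀ t, φ t ^ 2 * η t = φ t ^ 2 +
      (A.indicator (fun _ => x - 1) t + Z.indicator (fun _ => α ^ 2 * (y - 1)) t) := fun t => by
    rcases cases t with ⟨h1, h2⟩ | ⟨h1, h2⟩ | ⟨h1, h2⟩
    · simp [hη, h1, h2, hφA t h1]
    · simp [hη, h1, h2, hφZ t h2]; ring
    · simp [hη, h1, h2]
  have e2 : ∀ t, η t ^ 2 = 1 +
      (A.indicator (fun _ => x ^ 2 - 1) t + Z.indicator (fun _ => y ^ 2 - 1) t) := fun t => by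
    rcases cases t with ⟨h1, h2⟩ | ⟨h1, h2⟩ | ⟨h1, h2⟩
    · simp [hη, h1, h2]
    · simp [hη, h1, h2]
    · simp [hη, h1, h2]
  have I1 : ∫ t, φ t ^ 2 * η t ∂μ = ∫ t, φ t ^ 2 ∂μ +
      (μ.real A * (x - 1) + μ.real Z * (α ^ 2 * (y - 1))) := by
    simp only [e1]
    rw [integral_add i2 (iAZ _ _), integral_add (iA _) (iZ _), vA, vZ]
  have I2 : ∫ t, η t ^ 2 ∂μ ≤ 1 := by
    simp only [e2]
    rw [integral_add (integrable_const _) (iAZ _ _), integral_add (iA _) (iZ _), vA, vZ]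
    simp only [integral_const, probReal_univ, smul_eq_mul]
    nlinarith
  have m1 : MemLp (fun t => φ t ^ 2) 2 μ :=
    memLp_of_ae_bounds (lo := 0) (hi := 1) (hφ.pow_const 2).aestronglyMeasurable
      (Eventually.of_forall fun t => ⟨sq_nonneg _, pow_le_one₀ (hb t).1 (hb t).2⟩)
  have m2 : MemLp η 2 μ := by
    refine MemLp.of_bound hηm.aestronglyMeasurable (max 1 (max |x| |y|))
      (Eventually.of_forall fun t => ?_)
    rcases cases t with ⟨h1, h2⟩ | ⟨h1, h2⟩ | ⟨h1, h2⟩ <;> simp [hη, h1, h2]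
  have hcs := sq_integral_mul_le m1 m2
  have e4 : ∀ t, (φ t ^ 2) ^ 2 = φ t ^ 4 := fun t => by ring
  simp only [e4] at hcs
  have h0 : 0 ≤ ∫ t, φ t ^ 4 ∂μ := integral_nonneg fun t => by positivity
  have := Real.le_sqrt_of_sq_le (hcs.trans (mul_le_of_le_one_right h0 I2))
  rw [I1] at this
  linarith

end Layers

/-! ### Test functions between two level sets -/

namespace DiffusionGenerator

variable {X : Type u} [MeasurableSpace X] {μ : Measure X}

/-- Test functions for the capacity of the level sets of `a`. -/
theorem exists_testFunction (S : DiffusionGenerator X μ) [IsProbabilityMeasure μ] (a : S.A) {c : ℝ}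
    (hc : 0 < c) {g : ℝ → ℝ} (hg : Measurable g) (hK : ∃ K, ∀ t, g t ≤ K) (hg0 : ∀ t, 0 ≤ g t)
    (hg1 : ∫ t in (0 : ℝ)..c, g t = 1) {α : ℝ} (hα : α ≤ 1) :
    ∃ φ : X → ℝ, Measurable φ ∧ (∀ x, α ≤ φ x ∧ φ x ≤ 1) ∧
      (∀ x, c ≤ (a : X → ℝ) x → φ x = 1) ∧ (∀ x, (a : X → ℝ) x ≤ 0 → φ x = α) ∧
      S.RelaxedLE φ ((1 - α) ^ 2 * ∫ x in (a : X → ℝ) ⁻¹' Set.Ioc 0 c,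
        g ((a : X → ℝ) x) ^ 2 * carreDuChamp S.L a a x ∂μ) := by
  obtain ⟨K, hK⟩ := hK
  have ham := S.measurable_of_mem a a.2
  -- The slope of the profile: the test function is α plus the primitive of G at a, flat outside 0 <
  -- a ≤ c.
  set G : ℝ → ℝ := (Set.Ioc 0 c).indicator fun t => (1 - α) * g t with hG
  have h1α : 0 ≤ 1 - α := by linarith
  have hGm : Measurable G := (hg.const_mul _).indicator measurableSet_Ioc
  have hK0 : 0 ≤ K := (hg0 0).trans (hK 0)
  have hGb : ∀ t, |G t| ≤ (1 - α) * K := fun t => by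
    rw [← Real.norm_eq_abs, hG]
    refine (norm_indicator_le_norm_self (fun t => (1 - α) * g t) t).trans ?_
    rw [Real.norm_eq_abs, abs_of_nonneg (mul_nonneg h1α (hg0 t))]
    exact mul_le_mul_of_nonneg_left (hK t) h1α
  have hii : ∀ y z, IntervalIntegrable G volume y z := fun y z => by
    rw [intervalIntegrable_iff]
    exact Measure.integrableOn_of_bounded (by simp) hGm.aestronglyMeasurable
      (Eventually.of_forall hGb)
  set P : ℝ → ℝ := fun y => ∫ t in (0 : ℝ)..y, G t with hP
  have hPc : Continuous P := intervalIntegral.continuous_primitive hii 0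
  have hneg : ∀ y ≤ 0, P y = 0 := fun y hy => by
    simp only [hP]
    rw [intervalIntegral.integral_congr (g := fun _ => 0)]
    · simp
    · intro t ht
      rw [Set.uIcc_of_ge hy] at ht
      exact Set.indicator_of_notMem (fun h => absurd h.1 (not_lt.2 ht.2)) _
  have hgi : IntegrableOn g (Set.Ioc 0 c) :=
    Measure.integrableOn_of_bounded (M := K) (by simp) hg.aestronglyMeasurable
      (Eventually.of_forall fun t => by rw [Real.norm_eq_abs, abs_of_nonneg (hg0 t)]; exact hK t)
  rw [intervalIntegral.integral_of_le hc.le] at hg1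
  have hpos : ∀ y, 0 ≤ y → P y = (1 - α) * ∫ t in Set.Ioc 0 y ∩ Set.Ioc 0 c, g t := fun y hy => by
    simp only [hP, hG]
    rw [intervalIntegral.integral_of_le hy, setIntegral_indicator measurableSet_Ioc,
      integral_const_mul]
  have hP01 : ∀ y, 0 ≤ P y ∧ P y ≤ 1 - α := fun y => by
    rcases le_total y 0 with hy | hy
    · rw [hneg y hy]; exact ⟨le_rfl, h1α⟩
    · rw [hpos y hy]
      have h1 : 0 ≤ ∫ t in Set.Ioc 0 y ∩ Set.Ioc 0 c, g t :=
        setIntegral_nonneg (measurableSet_Ioc.inter measurableSet_Ioc) fun t _ => hg0 t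
      have h2 : ∫ t in Set.Ioc 0 y ∩ Set.Ioc 0 c, g t ≤ 1 := by
        rw [← hg1]
        exact setIntegral_mono_set hgi (Eventually.of_forall hg0)
          (Eventually.of_forall fun t ht => ht.2)
      exact ⟨mul_nonneg h1α h1, mul_le_of_le_one_right h1α h2⟩
  refine ⟨fun x => α + P ((a : X → ℝ) x), measurable_const.add (hPc.measurable.comp ham),
    fun x => ⟨by linarith [(hP01 ((a : X → ℝ) x)).1], by linarith [(hP01 ((a : X → ℝ) x)).2]⟩,
    fun x hx => ?_, fun x hx => ?_, ?_⟩
  · simp only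
    rw [hpos _ (hc.le.trans hx), Set.inter_eq_right.2 (Set.Ioc_subset_Ioc_right hx), hg1]
    ring
  · simp only
    rw [hneg _ hx, add_zero]
  · have h := S.relaxedLE_chain a hGm hGb α
    convert h using 1
    rw [← integral_indicator (ham measurableSet_Ioc), ← integral_const_mul]
    refine integral_congr_ae (Eventually.of_forall fun x => ?_)
    by_cases hx : (a : X → ℝ) x ∈ Set.Ioc 0 c
    · have hx' : x ∈ (a : X → ℝ) ⁻¹' Set.Ioc 0 c := hx
      simp only [hG, Set.indicator_of_mem hx, Set.indicator_of_mem hx']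
      ring
    · have hx' : x ∉ (a : X → ℝ) ⁻¹' Set.Ioc 0 c := hx
      simp only [hG, Set.indicator_of_notMem hx, Set.indicator_of_notMem hx']
      ring

end DiffusionGenerator

/-! ### Capacity bounds and the Hardy inequality on a half space -/

/-- The rate function pairing used for the weighted Hardy inequality on a half space. -/
noncomputable def halfP (r : ℝ) : ℝ := if r < 68 then 1 / (r + 1 / 2) else 0.35 / (r - 44)

/-- A primitive of `-(halfP)²`, up to jumps. -/
noncomputable def halfQ (r : ℝ) : ℝ :=
  if r < 68 then 1 / (r + 1 / 2) - 1 / 68.5 + 0.1225 / 24 else 0.1225 / (r - 44)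

theorem halfP_nonneg {r : ℝ} (hr : 0 ≤ r) : 0 ≤ halfP r := by
  unfold halfP
  split_ifs with h
  · positivity
  · exact div_nonneg (by norm_num) (by linarith)

theorem halfP_le {r : ℝ} (hr : 0 ≤ r) : halfP r ≤ 2 := by
  unfold halfP
  split_ifs with h
  · rw [div_le_iff₀ (by positivity)]; linarith
  · rw [div_le_iff₀ (by linarith)]; linarith

theorem halfQ_nonneg {r : ℝ} (hr : 0 ≤ r) : 0 ≤ halfQ r := by
  unfold halfQ
  split_ifs with h
  · have : 1 / 68.5 ≤ 1 / (r + 1 / 2) := one_div_le_one_div_of_le (by positivity) (by linarith)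
    have : (0 : ℝ) ≤ 0.1225 / 24 := by norm_num
    linarith
  · exact div_nonneg (by norm_num) (by linarith)

/-- Integrated form of q' = -p² for p = q = 1/r, the model solution. Scaling p by λ and q by λ²
gives the other pairs in use. -/
theorem sq_inv_mul_le {a b : ℝ} (ha : 0 < a) (hab : a ≤ b) :
    (1 / b) ^ 2 * (b - a) ≤ 1 / a - 1 / b := by
  have hb : 0 < b := ha.trans_le hab
  have e : 1 / a - 1 / b = (1 / (a * b)) * (b - a) := by field_simp
  rw [e]
  refine mul_le_mul_of_nonneg_right ?_ (by linarith)
  rw [div_pow, one_pow]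
  exact one_div_le_one_div_of_le (by positivity) (by nlinarith)

/-- Each branch is a rescaled model solution. An interval crossing 68 is cut there: q is continuous
at the junction, and on the left part the slope of q dominates the largest value of p² on the right,
0.1225/576. -/
theorem halfP_sq_mul_le {r r' : ℝ} (hr : 0 ≤ r) (h : r ≤ r') :
    halfP r' ^ 2 * (r' - r) ≤ halfQ r - halfQ r' := by
  unfold halfP halfQ
  by_cases h' : r' < 68
  · have h1 : r < 68 := h.trans_lt h'
    simp only [h', h1, if_true]
    have := sq_inv_mul_le (a := r + 1 / 2) (b := r' + 1 / 2) (by positivity) (by linarith)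
    have e : r' + 1 / 2 - (r + 1 / 2) = r' - r := by ring
    rw [e] at this
    linarith
  · have h2 : (68 : ℝ) ≤ r' := not_lt.1 h'
    simp only [h', if_false]
    by_cases h1 : r < 68
    · simp only [h1, if_true]
      have A := sq_inv_mul_le (a := 24) (b := r' - 44) (by norm_num) (by linarith)
      have B : 1 / (r + 1 / 2) - 1 / 68.5 = (68 - r) / ((r + 1 / 2) * 68.5) := by
        field_simp; ring
      have C : 0.1225 / 576 * (68 - r) ≤ 1 / (r + 1 / 2) - 1 / 68.5 := by
        rw [B, le_div_iff₀ (by positivity)]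
        nlinarith
      have D : (1 / (r' - 44)) ^ 2 ≤ 1 / 576 := by
        rw [div_pow, one_pow]
        exact one_div_le_one_div_of_le (by norm_num) (by nlinarith)
      have e : (0.35 / (r' - 44)) ^ 2 * (r' - r) =
          0.1225 * ((1 / (r' - 44)) ^ 2 * (r' - 44 - 24)) +
            0.1225 * (1 / (r' - 44)) ^ 2 * (68 - r) := by ring
      have e2 : 0.1225 / (r' - 44) = 0.1225 * (1 / (r' - 44)) := by ring
      rw [e, e2]
      nlinarith [mul_le_mul_of_nonneg_right D (show (0:ℝ) ≤ 68 - r by linarith)]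
    · simp only [h1, if_false]
      have A := sq_inv_mul_le (a := r - 44) (b := r' - 44) (by linarith [not_lt.1 h1]) (by linarith)
      have e : (0.35 / (r' - 44)) ^ 2 * (r' - r) =
          0.1225 * ((1 / (r' - 44)) ^ 2 * (r' - 44 - (r - 44))) := by ring
      have e2 : 0.1225 / (r' - 44) = 0.1225 * (1 / (r' - 44)) := by ring
      have e3 : 0.1225 / (r - 44) = 0.1225 * (1 / (r - 44)) := by ring
      rw [e, e2, e3]
      linarith

/-- On this branch p - q is constant, so it reproduces the trivial bound 1/2 on the measure of a
level set when the resistance is too small for capacities to help. -/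
theorem half_le_halfP_sub {r : ℝ} (h : r < 68) :
    1 / 2 ≤ 54.6 * (halfP r - halfQ r) := by
  simp only [halfP, halfQ, h, if_true]
  rw [show 1 / (r + 1 / 2) - (1 / (r + 1 / 2) - 1 / 68.5 + 0.1225 / 24) =
    1 / 68.5 - 0.1225 / 24 by ring]
  norm_num

/-- Here p - q = (0.35 - 0.35²)/(r - 44), and 54.6 (0.35 - 0.1225) = 12.4215. -/
theorem le_halfP_sub {r m : ℝ} (h : 68 ≤ r) (hm : m * (r - 44) ≤ 12.4215) :
    m ≤ 54.6 * (halfP r - halfQ r) := by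
  simp only [halfP, halfQ, not_lt.2 h, if_false]
  have e : 54.6 * (0.35 / (r - 44) - 0.1225 / (r - 44)) = 12.4215 / (r - 44) := by ring
  rw [e, le_div_iff₀ (by linarith)]
  exact hm

namespace DiffusionGenerator

variable {X : Type u} [MeasurableSpace X] {μ : Measure X}

/-- The Hellinger inequality for `[lo, 1]`-valued functions with rate function `t ↦ θ / t` for `t`
in a set `I` of positive numbers. -/
def HellingerRate (S : DiffusionGenerator X μ) (θ : ℝ) (I : Set ℝ) : Prop :=
  ∀ t ∈ I, 0 < t → ∀ (φ : X → ℝ) (lo C : ℝ), Measurable φ → 0 ≤ lo → lo ≤ 1 →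
    (∀ x, lo ≤ φ x ∧ φ x ≤ 1) → S.RelaxedLE φ C →
    √(∫ x, φ x ^ 4 ∂μ) - ∫ x, φ x ^ 2 ∂μ ≤ θ * C / t + t * (1 - lo ^ 2)

/-- The dual lower bound on the Hellinger functional meets the energy of the test function, at most
(1 - α)²/R after multiplication by θ, and its squared oscillation term 1 - α². The numbers α, t, x,
y stay free for later optimisation. -/
theorem HellingerRate.capacity [IsProbabilityMeasure μ] {S : DiffusionGenerator X μ} {θ : ℝ}
    {I : Set ℝ} (h : S.HellingerRate θ I) (a : S.A) {c : ℝ} (hc : 0 < c) {g : ℝ → ℝ}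
    (hg : Measurable g) (hK : ∃ K, ∀ t, g t ≤ K) (hg0 : ∀ t, 0 ≤ g t)
    (hg1 : ∫ t in (0 : ℝ)..c, g t = 1) {R : ℝ}
    (hR : ∫ x in (a : X → ℝ) ⁻¹' Set.Ioc 0 c,
      g ((a : X → ℝ) x) ^ 2 * (θ * carreDuChamp S.L a a x) ∂μ ≤ 1 / R)
    {α : ℝ} (hα0 : 0 ≤ α) (hα : α ≤ 1) {t : ℝ} (ht : t ∈ I) (ht0 : 0 < t) {x y : ℝ}
    (hxy : μ.real ((a : X → ℝ) ⁻¹' Set.Ici c) * (x ^ 2 - 1) ≤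
      μ.real ((a : X → ℝ) ⁻¹' Set.Iic 0) * (1 - y ^ 2)) :
    μ.real ((a : X → ℝ) ⁻¹' Set.Ici c) * (x - 1) -
      α ^ 2 * (μ.real ((a : X → ℝ) ⁻¹' Set.Iic 0) * (1 - y)) ≤
      (1 - α) ^ 2 / (R * t) + t * (1 - α ^ 2) := by
  obtain ⟨φ, hφ, hb, h1, h0, hC⟩ := S.exists_testFunction a hc hg hK hg0 hg1 hα
  have ham := S.measurable_of_mem a a.2
  have A := le_sqrt_integral_pow_four_sub (μ := μ) hφ
    (fun x => ⟨hα0.trans (hb x).1, (hb x).2⟩) (ham measurableSet_Ici) (ham measurableSet_Iic)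
    (Set.disjoint_left.2 fun x h1 h2 => absurd (hc.trans_le h1) (not_lt.2 h2)) h1 h0 hxy
  refine A.trans ((h t ht ht0 φ α _ hφ hα0 hα hb hC).trans ?_)
  gcongr ?_ + _
  have e : ∀ x, g ((a : X → ℝ) x) ^ 2 * (θ * carreDuChamp S.L a a x) =
      θ * (g ((a : X → ℝ) x) ^ 2 * carreDuChamp S.L a a x) := fun x => by ring
  simp only [e] at hR
  rw [integral_const_mul] at hR
  set J := ∫ x in (a : X → ℝ) ⁻¹' Set.Ioc 0 c,
    g ((a : X → ℝ) x) ^ 2 * carreDuChamp S.L a a x ∂μ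
  calc θ * ((1 - α) ^ 2 * J) / t = (1 - α) ^ 2 * (θ * J) / t := by ring
    _ ≤ (1 - α) ^ 2 * (1 / R) / t := by gcongr
    _ = _ := by rw [mul_one_div, div_div]

end DiffusionGenerator

/-- Optimisation over `t` for test functions vanishing on a large set. -/
theorem mul_sub_le_of_capacity_zero {m R δ : ℝ} (hm : 0 < m) (hm1 : m ≤ 0.04) (hR : 68 ≤ R)
    (hδm : δ < m)
    (h : ∀ t, 0 < t → 0.1465 * √δ ≤ t → t ≤ 0.1 → ∀ x, m * (x ^ 2 - 1) ≤ 1 / 2 →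
      m * (x - 1) ≤ 1 / (R * t) + t) : m * (R - 44) ≤ 12.4215 := by
  -- The largest weight allowed by the constraint; the gain m(x - 1) then equals 1/(2(x + 1)).
  set x := √(1 + 1 / (2 * m)) with hx
  have hx2 : x ^ 2 = 1 + 1 / (2 * m) := Real.sq_sqrt (by positivity)
  have hx0 : 0 ≤ x := Real.sqrt_nonneg _
  have hmx : m * (x ^ 2 - 1) = 1 / 2 := by rw [hx2]; field_simp; ring
  have hx3 : 3.6 ≤ x := by
    apply Real.le_sqrt_of_sq_le
    have : 1 / (2 * 0.04) ≤ 1 / (2 * m) := one_div_le_one_div_of_le (by positivity) (by linarith)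
    norm_num at this ⊢
    linarith
  have hn : m * (x - 1) = 1 / (2 * (x + 1)) := by
    rw [eq_div_iff (by positivity)]; linarith
  have hR0 : 0 < R := by linarith
  -- Half of the gain goes to t, so the other half is at most 1/(Rt), which gives R ≤ 16(x + 1)².
  have key := h (1 / (4 * (x + 1))) (by positivity) ?_ ?_ x hmx.le
  · rw [hn] at key
    have e1 : 1 / (R * (1 / (4 * (x + 1)))) = 4 * (x + 1) / R := by field_simp
    have e2 : 1 / (2 * (x + 1)) = 1 / (4 * (x + 1)) + 1 / (4 * (x + 1)) := by field_simp; ring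
    rw [e1, e2] at key
    have k2 : 1 / (4 * (x + 1)) ≤ 4 * (x + 1) / R := by linarith
    rw [div_le_div_iff₀ (by positivity) hR0] at k2
    have k3 : R - 44 ≤ 12.4215 * (2 * (x ^ 2 - 1)) := by nlinarith
    have : m * (R - 44) ≤ m * (12.4215 * (2 * (x ^ 2 - 1))) := by gcongr
    nlinarith
  -- This t is admissible because √m ≤ 1.7/(x + 1) and 0.25/1.7 > 0.1465.
  · have : √δ ≤ √m := Real.sqrt_le_sqrt hδm.le
    have h2 : √m ≤ 1.7 / (x + 1) := by
      apply Real.sqrt_le_iff.2 ⟨by positivity, ?_⟩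
      rw [div_pow, le_div_iff₀ (by positivity)]
      nlinarith
    have e : 1 / (4 * (x + 1)) = 0.25 * (1 / (x + 1)) := by field_simp; norm_num
    have e' : 1.7 / (x + 1) = 1.7 * (1 / (x + 1)) := by ring
    have : 0 ≤ 1 / (x + 1) := by positivity
    rw [e]; rw [e'] at h2
    nlinarith
  · rw [div_le_iff₀ (by positivity)]; linarith

/-- Optimisation over `t` for test functions with minimum `1 / 4`. -/
theorem mul_sub_le_of_capacity_quarter {m R δ : ℝ} (hm : 0.04 < m) (hm1 : m ≤ 1 / 2) (hR : 68 ≤ R)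
    (hδm : δ < m) (hδ4 : δ < 1 / 4)
    (h : ∀ t, 0 < t → 0.1465 * √δ ≤ t → t ≤ 0.1 → ∀ x, m * (x ^ 2 - 1) ≤ 63 / 128 →
      m * (x - 1) - 7 / 256 ≤ 9 / 16 / (R * t) + t * (15 / 16)) : m * (R - 44) ≤ 12.4215 := by
  have hm0 : 0 < m := by linarith
  set x := √(1 + 63 / (128 * m)) with hx
  have hx2 : x ^ 2 = 1 + 63 / (128 * m) := Real.sq_sqrt (by positivity)
  have hx0 : 0 ≤ x := Real.sqrt_nonneg _
  have hmx : m * (x ^ 2 - 1) = 63 / 128 := by rw [hx2]; field_simp; ring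
  have hx3 : 1.4085 ≤ x := by
    apply Real.le_sqrt_of_sq_le
    have : 63 / (128 * (1 / 2)) ≤ 63 / (128 * m) :=
      div_le_div_of_nonneg_left (by norm_num) (by positivity) (by linarith)
    norm_num at this ⊢
    linarith
  have hx4 : x ≤ 3.648 := by
    apply Real.sqrt_le_iff.2 ⟨by norm_num, ?_⟩
    have : 63 / (128 * m) ≤ 63 / (128 * 0.04) :=
      div_le_div_of_nonneg_left (by norm_num) (by positivity) (by linarith)
    norm_num at this ⊢
    linarith
  have hR0 : 0 < R := by linarith
  -- The net gain m(x - 1) - 7/256, rewritten through m(x² - 1) = 63/128.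
  set n := 7 * (17 - x) / (256 * (x + 1)) with hn
  have hn0 : 0 < n := div_pos (by linarith) (by positivity)
  have hmn : m * (x - 1) - 7 / 256 = n := by
    have : m * (x - 1) = 63 / (128 * (x + 1)) := by
      rw [eq_div_iff (by positivity)]; linarith
    rw [this, hn]; field_simp; ring
  -- The oscillation term 15t/16 is then n/2, and the rest gives R n² ≤ 135/64.
  have key := h (8 * n / 15) (by positivity) ?_ ?_ x hmx.le
  · rw [hmn] at key
    have e1 : 9 / 16 / (R * (8 * n / 15)) = 135 / 128 / (R * n) := by field_simp; norm_num
    rw [e1] at key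
    have k2 : n / 2 ≤ 135 / 128 / (R * n) := by linarith
    rw [le_div_iff₀ (by positivity)] at k2
    have k3 : R * (7 * (17 - x)) ^ 2 ≤ 135 / 64 * (256 * (x + 1)) ^ 2 := by
      have : R * n ^ 2 ≤ 135 / 64 := by linarith
      rw [hn, div_pow, ← mul_div_assoc, div_le_iff₀ (by positivity)] at this
      exact this
    -- The target after R and m have been eliminated: a polynomial inequality in x on [1.4085,
    -- 3.648].
    have poly : 135 / 64 * 256 ^ 2 * (63 / 128) * (x + 1) ^ 2 ≤
        49 * (17 - x) ^ 2 * (12.4215 * (x ^ 2 - 1) + 44 * (63 / 128)) := by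
      nlinarith [mul_nonneg (sub_nonneg.2 hx3) (sub_nonneg.2 hx4),
        mul_nonneg (mul_nonneg (sub_nonneg.2 hx3) (sub_nonneg.2 hx4)) (sub_nonneg.2 hx3),
        mul_nonneg (mul_nonneg (sub_nonneg.2 hx3) (sub_nonneg.2 hx4)) (sub_nonneg.2 hx4),
        mul_nonneg (mul_nonneg (sub_nonneg.2 hx3) (sub_nonneg.2 hx4)) (sq_nonneg (x - 3)),
        mul_nonneg (mul_nonneg (sub_nonneg.2 hx3) (sub_nonneg.2 hx4)) (sq_nonneg x)]
    have k4 : (63 / 128) * (R - 44) ≤ 12.4215 * (x ^ 2 - 1) := by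
      have p : 0 < 49 * (17 - x) ^ 2 := by have : 0 < 17 - x := by linarith
                                           positivity
      refine le_of_mul_le_mul_left ?_ p
      nlinarith
    have hx1 : 0 < x ^ 2 - 1 := by nlinarith
    refine le_of_mul_le_mul_right ?_ hx1
    calc m * (R - 44) * (x ^ 2 - 1) = m * (x ^ 2 - 1) * (R - 44) := by ring
      _ ≤ _ := by rw [hmx]; exact k4
  -- Admissibility of t: for m near 1/2 it rests on δ < 1/4, for smaller m on δ < m.
  · rcases lt_or_ge x 1.72 with hx5 | hx5
    · have h1 : √δ ≤ 1 / 2 := Real.sqrt_le_iff.2 ⟨by norm_num, by norm_num; linarith⟩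
      have h2 : 0.1535 ≤ n := by
        rw [hn, le_div_iff₀ (by positivity)]
        linarith
      linarith
    · have h1 : 0.1465 * √m ≤ 8 * n / 15 := by
        have : √m ≤ 8 * n / 15 / 0.1465 := by
          apply Real.sqrt_le_iff.2 ⟨by positivity, ?_⟩
          have hx1 : 0 < x ^ 2 - 1 := by nlinarith
          have e : m = 63 / 128 / (x ^ 2 - 1) := by rw [eq_div_iff hx1.ne', hmx]
          have e2 : (8 * n / 15 / 0.1465) ^ 2 =
              (8 / 15 * 7 / 256 / 0.1465) ^ 2 * (17 - x) ^ 2 / (x + 1) ^ 2 := by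
            rw [hn]; field_simp
          have hp : 0.021463 * 0.4921875 * (x + 1) ≤
              (17 - x) ^ 2 * (x - 1) * (8 / 15 * 7 / 256) ^ 2 := by
            nlinarith [mul_nonneg (sub_nonneg.2 hx5) (sub_nonneg.2 hx4),
              mul_nonneg (mul_nonneg (sub_nonneg.2 hx5) (sub_nonneg.2 hx4)) (sub_nonneg.2 hx5),
              mul_nonneg (mul_nonneg (sub_nonneg.2 hx5) (sub_nonneg.2 hx4)) (sub_nonneg.2 hx4)]
          rw [e, e2, div_le_div_iff₀ hx1 (by positivity)]
          have hp2 := mul_le_mul_of_nonneg_right hp (show 0 ≤ x + 1 by linarith)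
          nlinarith
        rw [le_div_iff₀ (by norm_num)] at this
        linarith
      have := Real.sqrt_le_sqrt hδm.le
      linarith
  · rw [hn, div_le_iff₀ (by norm_num), mul_div_assoc', div_le_iff₀ (by positivity)]
    nlinarith

namespace DiffusionGenerator

variable {X : Type u} [MeasurableSpace X] {μ : Measure X}

/-- A weighted Hardy inequality on a half space `{a > 0}` of measure at most `1 / 2`. -/
theorem HellingerRate.integral_clamp_sq_le [IsProbabilityMeasure μ] {S : DiffusionGenerator X μ}
    {θ δ M : ℝ} (hθ : 0 ≤ θ) (hδ : 0 ≤ δ) (hδ4 : δ < 1 / 4)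
    (h : S.HellingerRate θ (Set.Icc (0.1465 * √δ) 0.1)) (a : S.A) (hM : 0 ≤ M)
    (ha : 0 < M → μ.real ((a : X → ℝ) ⁻¹' Set.Ioi 0) ≤ 1 / 2) :
    ∫ x, clamp 0 M ((a : X → ℝ) x) ^ 2 ∂μ ≤
      54.6 * (θ * ∫ x in (a : X → ℝ) ⁻¹' Set.Ioi 0, carreDuChamp S.L a a x ∂μ) + δ * M ^ 2 := by
  have ham := S.measurable_of_mem a a.2
  rw [integral_clamp_sq ham hM, ← integral_const_mul θ]
  refine hardy ham ((S.integrable_carre a a).const_mul θ)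
    ((S.carre_nonneg a).mono fun x hx => mul_nonneg hθ hx)
    (T := fun c => μ.real ((a : X → ℝ) ⁻¹' Set.Ici c))
    (fun c c' hc => measureReal_mono (Set.preimage_mono (Set.Ici_subset_Ici.2 hc)))
    (fun c => measureReal_le_one) (p := halfP) (q := halfQ)
    (fun r r' hr hr' => halfP_sq_mul_le hr hr') (B := 2) (fun r hr => halfP_nonneg hr)
    (fun r hr => halfP_le hr) (fun r hr => halfQ_nonneg hr) (by norm_num) hδ hM ?_
  intro c hc hcM R hR g hg hK hg0 hg1 hgR
  set m := μ.real ((a : X → ℝ) ⁻¹' Set.Ici c) with hm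
  set z := μ.real ((a : X → ℝ) ⁻¹' Set.Iic 0) with hz
  have hpos := ha (hc.trans_le hcM)
  have hm2 : m ≤ 1 / 2 := (measureReal_mono
    (Set.preimage_mono fun t ht => hc.trans_le ht)).trans hpos
  have hz2 : 1 / 2 ≤ z := by
    have := probReal_add_probReal_compl (μ := μ) (ham (measurableSet_Ioi (a := (0 : ℝ))))
    rw [← Set.preimage_compl, Set.compl_Ioi] at this
    linarith
  suffices H : m ≤ 54.6 * (halfP R - halfQ R) ∨ m ≤ δ by
    rcases H with H | H
    · linarith
    · have : 0 ≤ halfP R - halfQ R := by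
        rcases lt_or_ge R 68 with h1 | h1
        · linarith [half_le_halfP_sub h1]
        · have := le_halfP_sub (m := 0) h1 (by norm_num)
          linarith
      linarith
  -- Levels of measure at most δ are absorbed by the additive δ M² of the Hardy inequality; only m >
  -- δ needs a capacity bound.
  rcases le_or_gt m δ with hmδ | hmδ
  · exact Or.inr hmδ
  left
  rcases lt_or_ge R 68 with h1 | h1
  · exact hm2.trans (half_le_halfP_sub h1)
  refine le_halfP_sub h1 ?_
  have cap : ∀ α, 0 ≤ α → α ≤ 1 → ∀ t, 0 < t → 0.1465 * √δ ≤ t → t ≤ 0.1 → ∀ x y,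
      m * (x ^ 2 - 1) ≤ z * (1 - y ^ 2) →
      m * (x - 1) - α ^ 2 * (z * (1 - y)) ≤ (1 - α) ^ 2 / (R * t) + t * (1 - α ^ 2) :=
    fun α hα0 hα t ht0 ht1 ht2 x y hxy =>
      h.capacity a hc hg hK hg0 hg1 hgR hα0 hα ⟨ht1, ht2⟩ ht0 hxy
  have hm0 : 0 < m := hδ.trans_lt hmδ
  -- For small m the test function vanishes on {a ≤ 0}. For larger m it is kept at 1/4 there, which
  -- reduces the energy and oscillation factors to 9/16 and 15/16 at the price of the term 7/256.
  rcases le_or_gt m 0.04 with h2 | h2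
  · refine mul_sub_le_of_capacity_zero hm0 h2 h1 hmδ fun t ht0 ht1 ht2 x hx => ?_
    have := cap 0 le_rfl zero_le_one t ht0 ht1 ht2 x 0 (by norm_num; linarith)
    norm_num at this ⊢
    linarith
  · refine mul_sub_le_of_capacity_quarter h2 hm2 h1 hmδ hδ4 fun t ht0 ht1 ht2 x hx => ?_
    have hz0 : 0 < z := by linarith
    have hq : 63 / (128 * z) ≤ 63 / 64 := by
      rw [div_le_div_iff₀ (by positivity) (by norm_num)]; linarith
    -- Keeps z(1 - y²) at its value 63/128 for z = 1/2, y = 1/8; as y ≥ 1/8, the loss z(1 - y) is at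
    -- most 7/16.
    set y := √(1 - 63 / (128 * z)) with hy
    have hy2 : y ^ 2 = 1 - 63 / (128 * z) := Real.sq_sqrt (by linarith)
    have hy0 : 1 / 8 ≤ y := Real.le_sqrt_of_sq_le (by norm_num; linarith)
    have hzy : z * (1 - y ^ 2) = 63 / 128 := by rw [hy2]; field_simp; ring
    have := cap (1 / 4) (by norm_num) (by norm_num) t ht0 ht1 ht2 x y (by linarith)
    have hzy2 : z * (1 - y) ≤ 7 / 16 := by
      have h3 : z * (1 - y) * (1 + y) = 63 / 128 := by rw [← hzy]; ring
      have h4 : 0 ≤ z * (1 - y) := mul_nonneg hz0.le (by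
        have : y ≤ 1 := Real.sqrt_le_one.2 (by have : 0 < 63 / (128 * z) := by positivity
                                               linarith)
        linarith)
      nlinarith
    norm_num at this ⊢
    linarith

end DiffusionGenerator

/-! ### Quantiles and splitting at a level -/

section Quantile

variable {X : Type*} [MeasurableSpace X] {μ : Measure X}

/-- The infimum of the levels t with μ(b > t) ≤ u works: continuity of μ from below gives the first
inequality, continuity from above the second. -/
theorem exists_quantile [IsProbabilityMeasure μ] {b : X → ℝ} (hb : Measurable b) {K : ℝ}
    (hK : ∀ x, |b x| ≤ K) {u : ℝ} (hu0 : 0 ≤ u) (hu1 : u < 1) :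
    ∃ c, μ.real (b ⁻¹' Set.Ioi c) ≤ u ∧ u ≤ μ.real (b ⁻¹' Set.Ici c) := by
  set s : Set ℝ := {t | μ.real (b ⁻¹' Set.Ioi t) ≤ u} with hs
  have hsne : s.Nonempty := by
    refine ⟨K, ?_⟩
    have : b ⁻¹' Set.Ioi K = ∅ := by
      ext x
      simpa using (le_abs_self _).trans (hK x)
    simp [hs, this, hu0]
  have hsb : BddBelow s := by
    refine ⟨-K - 1, fun t ht => ?_⟩
    by_contra! hlt
    have : b ⁻¹' Set.Ioi t = Set.univ := by
      ext x
      have := (abs_le.1 (hK x)).1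
      simp only [Set.mem_preimage, Set.mem_Ioi, Set.mem_univ, iff_true]
      linarith
    simp only [hs, Set.mem_ofPred_eq, this, probReal_univ] at ht
    linarith
  set c := sInf s with hc
  obtain ⟨v, hv1, hv2, hv3⟩ := exists_seq_strictAnti_tendsto c
  obtain ⟨w, hw1, hw2, hw3⟩ := exists_seq_strictMono_tendsto c
  refine ⟨c, ?_, ?_⟩
  · have e : b ⁻¹' Set.Ioi c = ⋃ n, b ⁻¹' Set.Ioi (v n) := by
      ext x
      simp only [Set.mem_preimage, Set.mem_Ioi, Set.mem_iUnion]
      constructor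
      · exact fun h => (hv3.eventually (eventually_lt_nhds h)).exists
      · rintro ⟨n, hn⟩
        exact (hv2 n).trans hn
    have hmono : Monotone fun n => b ⁻¹' Set.Ioi (v n) := fun i j hij =>
      Set.preimage_mono (Set.Ioi_subset_Ioi (hv1.antitone hij))
    have ht := (ENNReal.tendsto_toReal (measure_ne_top μ _)).comp
      (tendsto_measure_iUnion_atTop (μ := μ) hmono)
    rw [e]
    refine le_of_tendsto ht (Eventually.of_forall fun n => ?_)
    obtain ⟨t, ht, htn⟩ := (csInf_lt_iff hsb hsne).1 (hv2 n)
    exact (measureReal_mono (Set.preimage_mono (Set.Ioi_subset_Ioi htn.le))).trans ht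
  · have e : b ⁻¹' Set.Ici c = ⋂ n, b ⁻¹' Set.Ioi (w n) := by
      ext x
      simp only [Set.mem_preimage, Set.mem_Ici, Set.mem_Ioi, Set.mem_iInter]
      exact ⟨fun h n => (hw2 n).trans_le h, fun h => le_of_tendsto' hw3 fun n => (h n).le⟩
    have hanti : Antitone fun n => b ⁻¹' Set.Ioi (w n) := fun i j hij =>
      Set.preimage_mono (Set.Ioi_subset_Ioi (hw1.monotone hij))
    have ht := (ENNReal.tendsto_toReal (measure_ne_top μ _)).comp
      (tendsto_measure_iInter_atTop (μ := μ)
        (fun n => (hb measurableSet_Ioi).nullMeasurableSet) hanti ⟨0, measure_ne_top μ _⟩)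
    rw [e]
    refine ge_of_tendsto ht (Eventually.of_forall fun n => ?_)
    exact (not_le.1 fun h => absurd (csInf_le hsb h) (not_le.2 (hw2 n))).le

/-- A negative quantile is replaced by 0. The lower bound may then fail, which is harmless since it
is only ever used multiplied by c. -/
theorem exists_nonneg_quantile [IsProbabilityMeasure μ] {b : X → ℝ} (hb : Measurable b) {K : ℝ}
    (hK : ∀ x, |b x| ≤ K) {u : ℝ} (hu0 : 0 ≤ u) (hu1 : u < 1) :
    ∃ c, 0 ≤ c ∧ μ.real (b ⁻¹' Set.Ioi c) ≤ u ∧ (0 < c → u ≤ μ.real (b ⁻¹' Set.Ici c)) := by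
  obtain ⟨c, h1, h2⟩ := exists_quantile (μ := μ) hb hK hu0 hu1
  rcases le_or_gt c 0 with h | h
  · exact ⟨0, le_rfl, (measureReal_mono (Set.preimage_mono (Set.Ioi_subset_Ioi h))).trans h1,
      fun h0 => absurd h0 (lt_irrefl _)⟩
  · exact ⟨c, h.le, h1, fun _ => h2⟩

/-- Splitting a function at the level `c`. -/
theorem exists_integral_split [IsProbabilityMeasure μ] {b : X → ℝ} (hb : Measurable b) {K : ℝ}
    (hK : ∀ x, |b x| ≤ K) {c ν : ℝ} (hc : 0 ≤ c)
    (hν : 0 < c → ν ≤ μ.real (b ⁻¹' Set.Ici c)) :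
    ∃ k, c * ν ≤ k ∧ ∫ x, max (b x) 0 ∂μ = ∫ x, max (b x - c) 0 ∂μ + k ∧
      ∫ x, max (b x) 0 ^ 2 ∂μ ≤
        ∫ x, max (b x - c) 0 ^ 2 ∂μ + 2 * c * ∫ x, max (b x - c) 0 ∂μ + c * k := by
  have hbd : ∀ x, -K ≤ b x ∧ b x ≤ K := fun x => abs_le.1 (hK x)
  have i1 : Integrable (fun x => max (b x - c) 0) μ :=
    integrable_of_ae_bounds (lo := 0) (hi := max (K - c) 0) (by fun_prop)
      (Eventually.of_forall fun x => ⟨le_max_right _ _, max_le_max (by linarith [(hbd x).2]) le_rfl⟩)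
  have i2 : Integrable (fun x => max (b x - c) 0 ^ 2) μ :=
    integrable_pow_of_ae_bounds (lo := 0) (hi := max (K - c) 0) (by fun_prop)
      (Eventually.of_forall fun x => ⟨le_max_right _ _, max_le_max (by linarith [(hbd x).2]) le_rfl⟩) 2
  have i3 : Integrable (fun x => clamp 0 c (b x)) μ :=
    integrable_of_ae_bounds (lo := 0) (hi := c)
      ((continuous_clamp 0 c).measurable.comp hb).aestronglyMeasurable
      (Eventually.of_forall fun x => clamp_mem hc _)
  have e : ∀ x, max (b x) 0 = max (b x - c) 0 + clamp 0 c (b x) := fun x => by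
    simp only [clamp]
    rcases le_total (b x) 0 with h | h
    · rw [max_eq_right h, max_eq_right (by linarith), min_eq_right (by linarith), max_eq_left h]
      ring
    · rcases le_total (b x) c with h' | h'
      · rw [max_eq_left h, max_eq_right (by linarith), min_eq_right h', max_eq_right h]; ring
      · rw [max_eq_left h, max_eq_left (by linarith), min_eq_left h', max_eq_right hc]; ring
  refine ⟨∫ x, clamp 0 c (b x) ∂μ, ?_, ?_, ?_⟩
  · rcases hc.eq_or_lt with rfl | hc'
    · rw [zero_mul]
      exact integral_nonneg fun x => (clamp_mem le_rfl _).1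
    · calc c * ν ≤ c * μ.real (b ⁻¹' Set.Ici c) := by gcongr; exact hν hc'
        _ = ∫ x, (b ⁻¹' Set.Ici c).indicator (fun _ => c) x ∂μ := by
          rw [integral_indicator (hb measurableSet_Ici), setIntegral_const, smul_eq_mul, mul_comm]
        _ ≤ _ := by
          refine integral_mono ((integrable_const c).indicator (hb measurableSet_Ici)) i3 fun x => ?_
          by_cases h : c ≤ b x
          · simp [Set.indicator, h, clamp, hc]
          · simp [Set.indicator, h, (clamp_mem hc _).1]
  · rw [← integral_add i1 i3]
    exact integral_congr_ae (Eventually.of_forall e)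
  · have i4 : Integrable (fun x => 2 * c * max (b x - c) 0) μ := i1.const_mul _
    have i5 : Integrable (fun x => c * clamp 0 c (b x)) μ := i3.const_mul _
    have i6 : Integrable (fun x => max (b x - c) 0 ^ 2 + 2 * c * max (b x - c) 0) μ := i2.add i4
    rw [← integral_const_mul, ← integral_const_mul, ← integral_add i2 i4, ← integral_add i6 i5]
    refine integral_mono_of_nonneg (Eventually.of_forall fun x => sq_nonneg _)
      (i6.add i5) (Eventually.of_forall fun x => ?_)
    simp only [e]
    obtain ⟨h1, h2⟩ := clamp_mem hc (b x)
    have h3 : 0 ≤ max (b x - c) 0 := le_max_right _ _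
    nlinarith

end Quantile

/-- The choice λ = 1/2 maximises λ - λ² among rescaled model solutions, giving p - q = 1/(4(r + K)),
the classical Hardy constant. -/
theorem sq_inv_two_mul_le {r r' : ℝ} {K : ℝ} (hr : 0 < r + K) (h : r ≤ r') :
    (1 / (2 * (r' + K))) ^ 2 * (r' - r) ≤ 1 / (4 * (r + K)) - 1 / (4 * (r' + K)) := by
  have := sq_inv_mul_le (a := r + K) (b := r' + K) hr (by linarith)
  have e : r' + K - (r + K) = r' - r := by ring
  rw [e] at this
  have e1 : (1 / (2 * (r' + K))) ^ 2 = 1 / 4 * (1 / (r' + K)) ^ 2 := by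
    rw [mul_comm, ← one_div_mul_one_div]; ring
  have e2 : ∀ y : ℝ, 1 / (4 * y) = 1 / 4 * (1 / y) := fun y => by rw [one_div_mul_one_div]
  rw [e1, e2, e2]
  linarith

/-! ### Super-Poincaré estimate for a positive part -/

namespace DiffusionGenerator

variable {X : Type u} [MeasurableSpace X] {μ : Measure X}

theorem setIntegral_carre_sub_const (S : DiffusionGenerator X μ) [IsProbabilityMeasure μ] (b : S.A)
    (k : ℝ) (s : Set X) :
    ∫ x in s, carreDuChamp S.L (b - algebraMap ℝ S.A k) (b - algebraMap ℝ S.A k) x ∂μ =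
      ∫ x in s, carreDuChamp S.L b b x ∂μ :=
  integral_congr_ae (ae_restrict_of_ae (S.carre_sub_const b k))

/-- The Hardy inequality for a function whose positive part has a small support. -/
theorem HellingerRate.integral_posPart_sq_le [IsProbabilityMeasure μ] {S : DiffusionGenerator X μ}
    {θ u : ℝ} (hθ : 0 ≤ θ) (hu : u < 1 / 2)
    (h : S.HellingerRate θ (Set.Iic (0.1464 * √u))) (a : S.A)
    (ha : μ.real ((a : X → ℝ) ⁻¹' Set.Ioi 0) ≤ 0.35 * u) :
    ∫ x, max ((a : X → ℝ) x) 0 ^ 2 ∂μ ≤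
      54.6 * (θ * ∫ x in (a : X → ℝ) ⁻¹' Set.Ioi 0, carreDuChamp S.L a a x ∂μ) := by
  have ham := S.measurable_of_mem a a.2
  obtain ⟨M, hM⟩ := S.bounded_of_mem a a.2
  have hM0 : 0 ≤ M := by
    obtain ⟨x⟩ : Nonempty X := nonempty_of_isProbabilityMeasure μ
    exact (abs_nonneg _).trans (hM x)
  -- M bounds a, so truncation at M changes nothing, and with δ = 0 no term in M survives.
  have e : ∀ x, max ((a : X → ℝ) x) 0 = clamp 0 M ((a : X → ℝ) x) := fun x => by
    rw [clamp, min_eq_right ((le_abs_self _).trans (hM x)), max_comm]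
  simp only [e]
  rw [integral_clamp_sq ham hM0, ← integral_const_mul θ]
  have := hardy ham ((S.integrable_carre a a).const_mul θ)
    ((S.carre_nonneg a).mono fun x hx => mul_nonneg hθ hx)
    (T := fun c => μ.real ((a : X → ℝ) ⁻¹' Set.Ici c))
    (fun c c' hc => measureReal_mono (Set.preimage_mono (Set.Ici_subset_Ici.2 hc)))
    (fun c => measureReal_le_one) (p := fun r => 1 / (2 * (r + 8))) (q := fun r => 1 / (4 * (r + 8)))
    (fun r r' hr hr' => sq_inv_two_mul_le (by positivity) hr') (B := 1 / 16)
    (fun r hr => by positivity)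
    (fun r hr => one_div_le_one_div_of_le (by norm_num) (by linarith)) (fun r hr => by positivity)
    (C := 54.6) (δ := 0) (M := M) (by norm_num) le_rfl hM0 ?_
  · simpa using this
  intro c hc hcM R hR g hg hK hg0 hg1 hgR
  set m := μ.real ((a : X → ℝ) ⁻¹' Set.Ici c) with hm
  set z := μ.real ((a : X → ℝ) ⁻¹' Set.Iic 0) with hz
  have hmu : m ≤ 0.35 * u := (measureReal_mono
    (Set.preimage_mono fun t ht => hc.trans_le ht)).trans ha
  have hz2 : 0.825 ≤ z := by
    have := probReal_add_probReal_compl (μ := μ) (ham (measurableSet_Ioi (a := (0 : ℝ))))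
    rw [← Set.preimage_compl, Set.compl_Ioi] at this
    linarith
  have e2 : 54.6 * (1 / (2 * (R + 8)) - 1 / (4 * (R + 8))) + 0 = 13.65 / (R + 8) := by
    field_simp; norm_num
  rw [e2, le_div_iff₀ (by positivity)]
  have hm0 : 0 ≤ m := measureReal_nonneg
  rcases hm0.eq_or_lt with h0 | hm0
  · rw [← h0]; norm_num
  -- The constraint is saturated with y = 0, the complement having measure at least 0.825. The
  -- resulting R m ≤ 1/(0.3366 · 0.245), with m ≤ 0.175, gives m(R + 8) ≤ 13.65 = 54.6/4.
  set x := √(1 + 0.825 / m) with hx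
  have hx2 : x ^ 2 = 1 + 0.825 / m := Real.sq_sqrt (by positivity)
  have hx0 : 0 ≤ x := Real.sqrt_nonneg _
  have hmx : m * (x ^ 2 - 1) = 0.825 := by rw [hx2]; field_simp; ring
  set s := √m with hs
  have hs0 : 0 < s := Real.sqrt_pos.2 hm0
  have hs2 : s ^ 2 = m := Real.sq_sqrt hm0.le
  have hsx : s * x ≤ 1 := by
    have : (s * x) ^ 2 ≤ 1 := by rw [mul_pow, hs2]; nlinarith
    exact (abs_le_one_iff_mul_self_le_one.2 (by nlinarith) : |s * x| ≤ 1) |> (le_abs_self _).trans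
  have hs4 : s ≤ 0.4184 := Real.sqrt_le_iff.2 ⟨by norm_num, by norm_num; linarith⟩
  have hn : 0.5816 * s ≤ m * (x - 1) := by
    have h1 : m * (x - 1) * (x + 1) = 0.825 := by rw [← hmx]; ring
    refine le_of_mul_le_mul_right ?_ (show 0 < x + 1 by positivity)
    rw [h1]
    nlinarith
  -- The level 0.35 u makes the chosen t = 0.245√m admissible: 0.245 √0.35 < 0.1464.
  have ht : 0.245 * s ≤ 0.1464 * √u := by
    have : s ≤ √u * 0.5917 := by
      apply Real.sqrt_le_iff.2 ⟨by positivity, ?_⟩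
      rw [mul_pow, Real.sq_sqrt (by linarith)]
      norm_num
      linarith
    have := Real.sqrt_nonneg u
    linarith
  have cap := h.capacity a hc hg hK hg0 hg1 hgR le_rfl zero_le_one ht (by positivity)
    (x := x) (y := 0) (by rw [hmx]; norm_num; linarith)
  norm_num at cap hn
  have k1 : 0.3366 * s ≤ 1 / (R * (0.245 * s)) := by
    norm_num
    linarith
  rw [le_div_iff₀ (by positivity)] at k1
  nlinarith

/-- The super-Poincaré type inequality for the positive part. -/
theorem HellingerRate.integral_posPart_sq_le_add [IsProbabilityMeasure μ]
    {S : DiffusionGenerator X μ} {θ u : ℝ} (hθ : 0 ≤ θ) (hu0 : 0 < u) (hu : u < 1 / 2)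
    (h : S.HellingerRate θ (Set.Iic (0.1464 * √u))) (b : S.A) :
    ∫ x, max ((b : X → ℝ) x) 0 ^ 2 ∂μ ≤
      54.6 * (θ * ∫ x in (b : X → ℝ) ⁻¹' Set.Ioi 0, carreDuChamp S.L b b x ∂μ) +
        (∫ x, max ((b : X → ℝ) x) 0 ∂μ) ^ 2 / u := by
  have key : ∀ b : S.A, ∃ K, ∀ x, |(b : X → ℝ) x| ≤ K := fun b => S.bounded_of_mem b b.2
  have hbm := S.measurable_of_mem b b.2
  obtain ⟨K, hK⟩ := key b
  obtain ⟨c0, hc0, hc01, hc02⟩ := exists_nonneg_quantile (μ := μ) hbm hK hu0.le (by linarith)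
  set a : S.A := b - algebraMap ℝ S.A c0 with ha
  have hax : ∀ x, (a : X → ℝ) x = (b : X → ℝ) x - c0 := fun x => by simp [ha]
  have ham := S.measurable_of_mem a a.2
  obtain ⟨K', hK'⟩ := key a
  obtain ⟨c1, hc1, hc11, hc12⟩ := exists_nonneg_quantile (μ := μ) ham hK' (u := 0.35 * u)
    (by positivity) (by linarith)
  set d : S.A := a - algebraMap ℝ S.A c1 with hd
  have hdx : ∀ x, (d : X → ℝ) x = (a : X → ℝ) x - c1 := fun x => by simp [hd]
  obtain ⟨k, hk1, hk2, hk3⟩ := exists_integral_split (μ := μ) hbm hK hc0 hc02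
  obtain ⟨l, hl1, hl2, hl3⟩ := exists_integral_split (μ := μ) ham hK' hc1 hc12
  simp only [← hax] at hk2 hk3
  simp only [← hdx] at hl2 hl3
  have hdpre : ∀ t, (d : X → ℝ) ⁻¹' Set.Ioi t = (a : X → ℝ) ⁻¹' Set.Ioi (c1 + t) := fun t => by
    ext x; simp [hdx, lt_sub_iff_add_lt, add_comm]
  have hapre : (a : X → ℝ) ⁻¹' Set.Ioi 0 = (b : X → ℝ) ⁻¹' Set.Ioi c0 := by
    ext x; simp [hax]
  have tail := h.integral_posPart_sq_le hθ hu d (by rw [hdpre, add_zero]; exact hc11)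
  have hgam : ∀ s, ∫ x in s, carreDuChamp S.L a a x ∂μ = ∫ x in s, carreDuChamp S.L b b x ∂μ :=
    fun s => S.setIntegral_carre_sub_const b c0 s
  have hgamd : ∀ s, ∫ x in s, carreDuChamp S.L d d x ∂μ = ∫ x in s, carreDuChamp S.L b b x ∂μ :=
    fun s => (S.setIntegral_carre_sub_const a c1 s).trans (hgam s)
  rw [hgamd, hdpre, add_zero] at tail
  set W1 := θ * ∫ x in (a : X → ℝ) ⁻¹' Set.Ioc 0 c1, carreDuChamp S.L b b x ∂μ with hW1
  -- Between the two quantiles the linear profile 1/c1 suffices: there 0.35 u ≤ m ≤ u, so a single t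
  -- = 0.119√u works, and 54.6 · 0.119 · 0.1195 > 0.65.
  have slice : 0.65 * u * c1 ^ 2 ≤ 54.6 * W1 := by
    rcases hc1.eq_or_lt with h0 | hc1'
    · rw [← h0]
      have : 0 ≤ W1 := mul_nonneg hθ (setIntegral_nonneg_of_ae (S.carre_nonneg b))
      norm_num
      exact this
    have hm := hc12 hc1'
    set m := μ.real ((a : X → ℝ) ⁻¹' Set.Ici c1) with hmdef
    have hmu : m ≤ u := (measureReal_mono
      (Set.preimage_mono fun t ht => hc1'.trans_le ht)).trans (hapre ▸ hc01)
    have hz : 1 / 2 ≤ μ.real ((a : X → ℝ) ⁻¹' Set.Iic 0) := by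
      have := probReal_add_probReal_compl (μ := μ) (ham (measurableSet_Ioi (a := (0 : ℝ))))
      rw [← Set.preimage_compl, Set.compl_Ioi] at this
      rw [← hapre] at hc01
      linarith
    have hm0 : 0 < m := lt_of_lt_of_le (by positivity) hm
    set x := √(1 + 1 / (2 * m)) with hx
    have hx2 : x ^ 2 = 1 + 1 / (2 * m) := Real.sq_sqrt (by positivity)
    have hx0 : 0 ≤ x := Real.sqrt_nonneg _
    have hmx : m * (x ^ 2 - 1) = 1 / 2 := by rw [hx2]; field_simp; ring
    set s := √u with hs
    have hs0 : 0 < s := Real.sqrt_pos.2 hu0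
    have hs2 : s ^ 2 = u := Real.sq_sqrt hu0.le
    have hs4 : s ≤ 0.7072 := Real.sqrt_le_iff.2 ⟨by norm_num, by norm_num; linarith⟩
    have hsx : s * x ≤ 1.3888 := by
      refine abs_le_of_sq_le_sq' ?_ (by norm_num) |>.2
      rw [mul_pow, hs2, hx2]
      have : 1 / (2 * m) ≤ 1 / (0.7 * u) := one_div_le_one_div_of_le (by positivity) (by linarith)
      have : u * (1 / (2 * m)) ≤ u * (1 / (0.7 * u)) := by gcongr
      have e : u * (1 / (0.7 * u)) = 1 / 0.7 := by field_simp
      rw [e] at this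
      norm_num at this ⊢
      linarith
    have hn : 0.2385 * s ≤ m * (x - 1) := by
      have h1 : m * (x - 1) * (x + 1) = 1 / 2 := by rw [← hmx]; ring
      refine le_of_mul_le_mul_right ?_ (show 0 < x + 1 by positivity)
      rw [h1]
      nlinarith
    have cap := h.capacity a hc1' (g := fun _ => 1 / c1) measurable_const ⟨1 / c1, fun _ => le_rfl⟩
      (fun _ => by positivity) (by simp [hc1'.ne']) (R := c1 ^ 2 / W1) (by
        rw [integral_const_mul, integral_const_mul, hgam, ← hW1]
        rw [one_div_div]
        exact le_of_eq (by ring))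
      le_rfl zero_le_one (t := 0.119 * s) (show 0.119 * s ≤ 0.1464 * s by linarith) (by positivity) (x := x) (y := 0)
      (by rw [hmx]; norm_num; linarith)
    have e : (1 - 0) ^ 2 / (c1 ^ 2 / W1 * (0.119 * s)) = W1 / (c1 ^ 2 * (0.119 * s)) := by
      rw [sub_zero, one_pow, div_mul_eq_mul_div, one_div_div]
    rw [e] at cap
    have k1 : 0.1195 * s ≤ W1 / (c1 ^ 2 * (0.119 * s)) := by
      norm_num at cap hn ⊢
      linarith
    rw [le_div_iff₀ (by positivity)] at k1
    have : 0.1195 * 0.119 * (u * c1 ^ 2) ≤ W1 := by rw [← hs2]; linarith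
    have : 0 ≤ u * c1 ^ 2 := by positivity
    linarith
  have hsum : ∫ x in (a : X → ℝ) ⁻¹' Set.Ioc 0 c1, carreDuChamp S.L b b x ∂μ +
      ∫ x in (a : X → ℝ) ⁻¹' Set.Ioi c1, carreDuChamp S.L b b x ∂μ ≤
      ∫ x in (b : X → ℝ) ⁻¹' Set.Ioi 0, carreDuChamp S.L b b x ∂μ := by
    have hi := S.integrable_carre b b
    have hdis : Disjoint (Set.Ioc 0 c1) (Set.Ioi c1) :=
      Set.disjoint_left.2 fun t h1 h2 => absurd h1.2 (not_le.2 h2)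
    rw [← setIntegral_union (hdis.preimage _)
      (ham measurableSet_Ioi) hi.integrableOn hi.integrableOn]
    refine setIntegral_mono_set hi.integrableOn (ae_restrict_of_ae (S.carre_nonneg b))
      (Eventually.of_forall fun x hx => ?_)
    have h0 : 0 < (a : X → ℝ) x := by
      rcases hx with hx | hx
      · exact hx.1
      · exact hc1.trans_lt hx
    rw [hax] at h0
    show 0 < (b : X → ℝ) x
    linarith
  have hG0 : 0 ≤ ∫ x, max ((a : X → ℝ) x) 0 ∂μ := integral_nonneg fun x => le_max_right _ _
  have hH0 : 0 ≤ ∫ x, max ((d : X → ℝ) x) 0 ∂μ := integral_nonneg fun x => le_max_right _ _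
  have hsum2 := mul_le_mul_of_nonneg_left hsum hθ
  rw [mul_add, ← hW1] at hsum2
  set F1 := ∫ x, max ((b : X → ℝ) x) 0 ∂μ
  set G1 := ∫ x, max ((a : X → ℝ) x) 0 ∂μ
  set H1 := ∫ x, max ((d : X → ℝ) x) 0 ∂μ
  -- Since F1 = G1 + k with k ≥ c0 u, the square F1² covers both cross terms of the first cut.
  have s1 : G1 ^ 2 / u + 2 * c0 * G1 + c0 * k ≤ F1 ^ 2 / u := by
    rw [le_div_iff₀ hu0, add_mul, add_mul, div_mul_cancel₀ _ hu0.ne', hk2]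
    nlinarith [mul_nonneg hG0 hc0, mul_le_mul_of_nonneg_left hk1 hG0,
      mul_le_mul_of_nonneg_left hk1 (show 0 ≤ k from le_trans (by positivity) hk1)]
  -- With G1 = H1 + l the left side is 2 c1 G1 - c1 l. Completing the square costs u c1², of which l
  -- ≥ 0.35 u c1 returns 0.35 u c1²; the remaining 0.65 is what `slice` pays for.
  have s2 : 2 * c1 * H1 + c1 * l ≤ G1 ^ 2 / u + 0.65 * u * c1 ^ 2 := by
    have : 2 * c1 * G1 - u * c1 ^ 2 ≤ G1 ^ 2 / u := by
      rw [le_div_iff₀ hu0]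
      nlinarith [sq_nonneg (G1 - u * c1)]
    have h2 := mul_le_mul_of_nonneg_left hl1 hc1
    rw [hl2] at this ⊢
    nlinarith
  linarith

end DiffusionGenerator

/-! ### Splitting at a median and the variance of truncations -/

namespace DiffusionGenerator

variable {X : Type u} [MeasurableSpace X] {μ : Measure X}

/-- Splitting at a median of a truncation. -/
theorem exists_median (S : DiffusionGenerator X μ) [IsProbabilityMeasure μ] (b : S.A) {p q : ℝ}
    (hpq : p ≤ q) :
    ∃ m, p ≤ m ∧ m ≤ q ∧ 1 / 2 ≤ μ.real {x | m ≤ clamp p q ((b : X → ℝ) x)} ∧ ∃ a₁ a₂ : S.A,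
      (0 < q - m → μ.real ((a₁ : X → ℝ) ⁻¹' Set.Ioi 0) ≤ 1 / 2) ∧
      (0 < m - p → μ.real ((a₂ : X → ℝ) ⁻¹' Set.Ioi 0) ≤ 1 / 2) ∧
      (∀ x, ∀ k : ℕ, Even k → k ≠ 0 → (clamp p q ((b : X → ℝ) x) - m) ^ k =
        clamp 0 (q - m) ((a₁ : X → ℝ) x) ^ k + clamp 0 (m - p) ((a₂ : X → ℝ) x) ^ k) ∧
      ∫ x in (a₁ : X → ℝ) ⁻¹' Set.Ioi 0, carreDuChamp S.L a₁ a₁ x ∂μ +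
        ∫ x in (a₂ : X → ℝ) ⁻¹' Set.Ioi 0, carreDuChamp S.L a₂ a₂ x ∂μ ≤ preForm μ S.L b b := by
  have hbm := S.measurable_of_mem b b.2
  obtain ⟨K, hK⟩ := S.bounded_of_mem b b.2
  obtain ⟨c, hc1, hc2⟩ := exists_quantile (μ := μ) hbm hK (u := 1 / 2) (by norm_num) (by norm_num)
  obtain ⟨hp, hq⟩ := clamp_mem hpq c
  -- The truncation of a median is a median of the truncation. If it sits at p or q, one half has
  -- zero height and no measure bound is needed on that side.
  set m := clamp p q c with hm
  have hmq : m < q → c ≤ m := fun h => by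
    rcases le_total q c with h' | h'
    · rw [hm, clamp, min_eq_left h', max_eq_right hpq] at h
      exact absurd h (lt_irrefl _)
    · rw [hm, clamp, min_eq_right h']; exact le_max_right _ _
  have hmp : p < m → m ≤ c := fun h => by
    rcases le_total c p with h' | h'
    · rw [hm, clamp, min_eq_right (h'.trans hpq), max_eq_left h'] at h
      exact absurd h (lt_irrefl _)
    · rw [hm, clamp]; exact max_le h' (min_le_right _ _)
  set a₁ : S.A := b - algebraMap ℝ S.A m with ha₁
  set a₂ : S.A := -a₁ with ha₂
  have h1 : ∀ x, (a₁ : X → ℝ) x = (b : X → ℝ) x - m := fun x => by simp [ha₁]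
  have h2 : ∀ x, (a₂ : X → ℝ) x = m - (b : X → ℝ) x := fun x => by simp [ha₂, ha₁]
  have hs2 : (a₂ : X → ℝ) ⁻¹' Set.Ioi 0 = (b : X → ℝ) ⁻¹' Set.Iio m := by
    ext x; simp [h2]
  have hs1 : (a₁ : X → ℝ) ⁻¹' Set.Ioi 0 = (b : X → ℝ) ⁻¹' Set.Ioi m := by
    ext x; simp [h1]
  have hlt : p < m → μ.real ((b : X → ℝ) ⁻¹' Set.Iio m) ≤ 1 / 2 := fun h => by
    have := probReal_add_probReal_compl (μ := μ) (hbm (measurableSet_Ici (a := c)))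
    rw [← Set.preimage_compl, Set.compl_Ici] at this
    have := measureReal_mono (μ := μ) (Set.preimage_mono (f := (b : X → ℝ))
      (Set.Iio_subset_Iio (hmp h)))
    linarith
  refine ⟨m, hp, hq, ?_, a₁, a₂, fun h => ?_, fun h => ?_, fun x k hk hk0 => ?_, ?_⟩
  · rcases hp.eq_or_lt with h | h
    · have : {x | m ≤ clamp p q ((b : X → ℝ) x)} = Set.univ := by
        ext x
        simp [← h, (clamp_mem hpq _).1]
      rw [this, probReal_univ]
      norm_num
    · have := probReal_add_probReal_compl (μ := μ) (hbm (measurableSet_Iio (a := m)))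
      rw [← Set.preimage_compl, Set.compl_Iio] at this
      have h3 := hlt h
      have h4 := measureReal_mono (μ := μ) (s₁ := (b : X → ℝ) ⁻¹' Set.Ici m)
        (s₂ := {x | m ≤ clamp p q ((b : X → ℝ) x)})
        (fun x hx => (le_min hq hx).trans (le_max_right _ _))
      linarith
  · rw [hs1]
    exact (measureReal_mono (Set.preimage_mono
      (Set.Ioi_subset_Ioi (hmq (by linarith))))).trans hc1
  · rw [hs2]
    exact hlt (by linarith)
  · rw [h1, h2]
    rcases le_total ((b : X → ℝ) x) m with h | h
    · have e1 : clamp 0 (q - m) ((b : X → ℝ) x - m) = 0 :=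
        max_eq_left ((min_le_right _ _).trans (by linarith))
      have e2 : clamp 0 (m - p) (m - (b : X → ℝ) x) = m - clamp p q ((b : X → ℝ) x) := by
        rw [clamp, clamp, min_eq_right (h.trans hq), max_eq_right
          (le_min (by linarith) (by linarith))]
        rcases le_total p ((b : X → ℝ) x) with h' | h'
        · rw [max_eq_right h', min_eq_right (by linarith)]
        · rw [max_eq_left h', min_eq_left (by linarith)]
      rw [e1, e2, zero_pow hk0, zero_add, ← hk.neg_pow, neg_sub]
    · have e1 : clamp 0 (m - p) (m - (b : X → ℝ) x) = 0 :=
        max_eq_left ((min_le_right _ _).trans (by linarith))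
      have e2 : clamp 0 (q - m) ((b : X → ℝ) x - m) = clamp p q ((b : X → ℝ) x) - m := by
        rw [clamp, clamp, max_eq_right (le_min (by linarith) (by linarith)), max_eq_right
          (le_min hpq (by linarith))]
        rcases le_total q ((b : X → ℝ) x) with h' | h'
        · rw [min_eq_left h', min_eq_left (by linarith)]
        · rw [min_eq_right h', min_eq_right (by linarith)]
      rw [e1, e2, zero_pow hk0, add_zero]
  · have hg1 : ∀ s, ∫ x in s, carreDuChamp S.L a₁ a₁ x ∂μ = ∫ x in s, carreDuChamp S.L b b x ∂μ :=
      fun s => S.setIntegral_carre_sub_const b m s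
    have hg2 : ∀ s, ∫ x in s, carreDuChamp S.L a₂ a₂ x ∂μ = ∫ x in s, carreDuChamp S.L b b x ∂μ :=
      fun s => (integral_congr_ae (ae_restrict_of_ae (S.carre_neg a₁))).trans (hg1 s)
    have hi := S.integrable_carre b b
    have hdis : Disjoint (Set.Ioi m) (Set.Iio m) :=
      Set.disjoint_left.2 fun t h1 h2 => lt_asymm (show m < t from h1) h2
    rw [hg1, hg2, hs1, hs2, ← setIntegral_union (hdis.preimage _) (hbm measurableSet_Iio)
      hi.integrableOn hi.integrableOn]
    exact setIntegral_le_integral hi (S.carre_nonneg b)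

theorem integrable_clamp_pow (S : DiffusionGenerator X μ) [IsFiniteMeasure μ] (b : S.A) {p q : ℝ}
    (hpq : p ≤ q) (k : ℕ) : Integrable (fun x => clamp p q ((b : X → ℝ) x) ^ k) μ :=
  integrable_pow_of_ae_bounds
    ((continuous_clamp p q).comp_aestronglyMeasurable (S.aestronglyMeasurable_coe b))
    (Eventually.of_forall fun _ => clamp_mem hpq _) k

theorem memLp_clamp (S : DiffusionGenerator X μ) [IsFiniteMeasure μ] (b : S.A) {p q : ℝ}
    (hpq : p ≤ q) : MemLp (fun x => clamp p q ((b : X → ℝ) x)) 2 μ :=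
  memLp_of_ae_bounds
    ((continuous_clamp p q).comp_aestronglyMeasurable (S.aestronglyMeasurable_coe b))
    (Eventually.of_forall fun _ => clamp_mem hpq _)

/-- The variance of a truncation, under a Hellinger inequality. -/
theorem HellingerRate.variance_clamp_le [IsProbabilityMeasure μ] {S : DiffusionGenerator X μ}
    {θ δ : ℝ} (hθ : 0 ≤ θ) (hδ : 0 ≤ δ) (hδ4 : δ < 1 / 4)
    (h : S.HellingerRate θ (Set.Icc (0.1465 * √δ) 0.1)) (b : S.A) {p q : ℝ} (hpq : p ≤ q) :
    ∫ x, clamp p q ((b : X → ℝ) x) ^ 2 ∂μ - (∫ x, clamp p q ((b : X → ℝ) x) ∂μ) ^ 2 ≤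
      54.6 * θ * preForm μ S.L b b + δ * (q - p) ^ 2 := by
  obtain ⟨m, hpm, hmq, -, a₁, a₂, h₁, h₂, hsplit, hE⟩ := S.exists_median b hpq
  have A₁ := h.integral_clamp_sq_le hθ hδ hδ4 a₁ (sub_nonneg.2 hmq) h₁
  have A₂ := h.integral_clamp_sq_le hθ hδ hδ4 a₂ (sub_nonneg.2 hpm) h₂
  have i0 := S.integrable_clamp_pow b hpq 1
  simp only [pow_one] at i0
  have i2 := S.integrable_clamp_pow b hpq 2
  have e1 : ∫ x, (clamp p q ((b : X → ℝ) x) - m) ^ 2 ∂μ =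
      ∫ x, clamp p q ((b : X → ℝ) x) ^ 2 ∂μ - 2 * m * ∫ x, clamp p q ((b : X → ℝ) x) ∂μ + m ^ 2 := by
    have e : ∀ x, (clamp p q ((b : X → ℝ) x) - m) ^ 2 =
        clamp p q ((b : X → ℝ) x) ^ 2 - 2 * m * clamp p q ((b : X → ℝ) x) + m ^ 2 :=
      fun x => by ring
    simp only [e]
    have i3 : Integrable (fun x => 2 * m * clamp p q ((b : X → ℝ) x)) μ := i0.const_mul _
    have i4 : Integrable (fun x => clamp p q ((b : X → ℝ) x) ^ 2 -
      2 * m * clamp p q ((b : X → ℝ) x)) μ := i2.sub i3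
    rw [integral_add i4 (integrable_const _), integral_sub i2 i3, integral_const_mul]
    simp
  have e2 : ∫ x, (clamp p q ((b : X → ℝ) x) - m) ^ 2 ∂μ =
      ∫ x, clamp 0 (q - m) ((a₁ : X → ℝ) x) ^ 2 ∂μ +
        ∫ x, clamp 0 (m - p) ((a₂ : X → ℝ) x) ^ 2 ∂μ := by
    rw [← integral_add (S.integrable_clamp_pow a₁ (sub_nonneg.2 hmq) 2)
      (S.integrable_clamp_pow a₂ (sub_nonneg.2 hpm) 2)]
    exact integral_congr_ae (Eventually.of_forall fun x => hsplit x 2 even_two two_ne_zero)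
  -- The heights of the two halves add up to q - p, so the two oscillation terms fit into one.
  have h3 : δ * ((q - m) ^ 2 + (m - p) ^ 2) ≤ δ * (q - p) ^ 2 := by
    gcongr
    nlinarith [mul_nonneg (sub_nonneg.2 hmq) (sub_nonneg.2 hpm)]
  have h4 := mul_le_mul_of_nonneg_left hE (show 0 ≤ 54.6 * θ by positivity)
  nlinarith [sq_nonneg (∫ x, clamp p q ((b : X → ℝ) x) ∂μ - m)]

/-! ### From weak Poincaré to fourth moments -/

/-- The `L⁴` Hardy inequality on a half space, under a weak Poincaré inequality. -/
theorem WeakPoincare.sqrt_integral_clamp_pow_four_le [IsProbabilityMeasure μ]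
    {S : DiffusionGenerator X μ} {B : ℝ → ℝ} (h : S.WeakPoincare B) {K s M : ℝ} (hK : 0 < K)
    (hs : 0 ≤ s) (hB0 : ∀ t, 0 < t → 0 ≤ B t)
    (hB : ∀ m, 0 < m → m ≤ 1 / 2 → s < √m → 4 * B (m / 4) ≤ K * √m)
    (a : S.A) (hM : 0 ≤ M) (ha : 0 < M → μ.real ((a : X → ℝ) ⁻¹' Set.Ioi 0) ≤ 1 / 2) :
    √(∫ x, clamp 0 M ((a : X → ℝ) x) ^ 4 ∂μ) ≤
      8 * K * ∫ x in (a : X → ℝ) ⁻¹' Set.Ioi 0, carreDuChamp S.L a a x ∂μ + s * M ^ 2 := by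
  have ham := S.measurable_of_mem a a.2
  set J := 8 * K * ∫ x in (a : X → ℝ) ⁻¹' Set.Ioi 0, carreDuChamp S.L a a x ∂μ + s * M ^ 2
  set T : ℝ → ℝ := fun c => μ.real ((a : X → ℝ) ⁻¹' Set.Ici c) with hT
  have hTa : Antitone T :=
    fun c c' hc => measureReal_mono (Set.preimage_mono (Set.Ici_subset_Ici.2 hc))
  have hsTa : Antitone fun c => √(T c) := fun c c' hc => Real.sqrt_le_sqrt (hTa hc)
  -- The Hardy inequality is applied to √T rather than T. This bounds the L^{2,1} Lorentz norm of
  -- the squared truncation, which dominates its L² norm.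
  have hJ : ∫ c in (0 : ℝ)..M, 2 * c * √(T c) ≤ J := by
    refine hardy ham (S.integrable_carre a a) (S.carre_nonneg a) hsTa
      (fun c => Real.sqrt_le_one.2 measureReal_le_one) (p := fun r => 1 / (2 * (r + K)))
      (q := fun r => 1 / (4 * (r + K))) (fun r r' hr hr' => sq_inv_two_mul_le (by positivity) hr')
      (B := 1 / (2 * K)) (fun r hr => by positivity)
      (fun r hr => one_div_le_one_div_of_le (by positivity) (by linarith))
      (fun r hr => by positivity) (by positivity) hs hM ?_
    intro c hc hcM R hR g hg hK' hg0 hg1 hgR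
    have e2 : 8 * K * (1 / (2 * (R + K)) - 1 / (4 * (R + K))) = 2 * K / (R + K) := by
      field_simp; norm_num
    rw [e2]
    have hpos := ha (hc.trans_le hcM)
    have hm2 : T c ≤ 1 / 2 := (measureReal_mono
      (Set.preimage_mono fun t ht => hc.trans_le ht)).trans hpos
    have hz2 : 1 / 2 ≤ μ.real ((a : X → ℝ) ⁻¹' Set.Iic 0) := by
      have := probReal_add_probReal_compl (μ := μ) (ham (measurableSet_Ioi (a := (0 : ℝ))))
      rw [← Set.preimage_compl, Set.compl_Ioi] at this
      linarith
    have hf0 : 0 ≤ 2 * K / (R + K) := by positivity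
    rcases le_or_gt (√(T c)) s with hts | hts
    · linarith
    have hm0 : 0 < T c := Real.sqrt_pos.1 (hs.trans_lt hts)
    suffices H : √(T c) ≤ 2 * K / (R + K) by linarith
    have hl := Real.sqrt_pos.2 hm0
    have hl2 : √(T c) ^ 2 = T c := Real.sq_sqrt hm0.le
    have hl1 : √(T c) ≤ 1 := Real.sqrt_le_one.2 measureReal_le_one
    -- As √(T c) ≤ 1, adding K √(T c) ≤ K absorbs the shift in R + K.
    suffices H : √(T c) * R ≤ K by
      rw [le_div_iff₀ (by positivity)]
      nlinarith
    obtain ⟨φ, hφ, hb, h1, h0, hC⟩ := S.exists_testFunction a hc hg hK' hg0 hg1 zero_le_one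
    -- The variance will be at least T c / 2; the parameter T c / 4 spends half of it on the
    -- oscillation term.
    have hwp := h.relaxed (s := T c / 4) (by positivity) (hB0 _ (by positivity))
      hφ.aestronglyMeasurable hC zero_le_one (Eventually.of_forall hb)
    have hφb : ∀ᵐ t ∂μ, (0 : ℝ) ≤ φ t ∧ φ t ≤ 1 := Eventually.of_forall hb
    have i1 := integrable_of_ae_bounds hφ.aestronglyMeasurable hφb
    have i2 := integrable_pow_of_ae_bounds hφ.aestronglyMeasurable hφb 2
    set e := ∫ x, φ x ∂μ with he
    have hvar : T c / 2 ≤ ∫ x, φ x ^ 2 ∂μ - e ^ 2 := by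
      have v1 : ∫ x, (φ x - e) ^ 2 ∂μ = ∫ x, φ x ^ 2 ∂μ - e ^ 2 := by
        have e' : ∀ x, (φ x - e) ^ 2 = φ x ^ 2 - 2 * e * φ x + e ^ 2 := fun x => by ring
        simp only [e']
        have i3 : Integrable (fun x => 2 * e * φ x) μ := i1.const_mul _
        have i4 : Integrable (fun x => φ x ^ 2 - 2 * e * φ x) μ := i2.sub i3
        rw [integral_add i4 (integrable_const _), integral_sub i2 i3, integral_const_mul]
        simp only [integral_const, probReal_univ, smul_eq_mul, ← he]
        ring
      have i5 : Integrable (fun x => (φ x - e) ^ 2) μ :=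
        integrable_pow_of_ae_bounds (lo := 0 - e) (hi := 1 - e)
          (hφ.sub_const e).aestronglyMeasurable
          (Eventually.of_forall fun x => ⟨by linarith [(hb x).1], by linarith [(hb x).2]⟩) 2
      have mA : MeasurableSet ((a : X → ℝ) ⁻¹' Set.Ici c) := ham measurableSet_Ici
      have mZ : MeasurableSet ((a : X → ℝ) ⁻¹' Set.Iic 0) := ham measurableSet_Iic
      have hdis : Disjoint (Set.Ici c) (Set.Iic 0) :=
        Set.disjoint_left.2 fun t (h1 : c ≤ t) (h2 : t ≤ 0) => absurd (hc.trans_le h1) (not_lt.2 h2)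
      have v2 := setIntegral_le_integral (μ := μ)
        (s := (a : X → ℝ) ⁻¹' Set.Ici c ∪ (a : X → ℝ) ⁻¹' Set.Iic 0) i5
        (Eventually.of_forall fun x => sq_nonneg _)
      rw [setIntegral_union (hdis.preimage _) mZ i5.integrableOn i5.integrableOn,
        setIntegral_congr_fun mA (g := fun _ => (1 - e) ^ 2) (fun x hx => by simp only [h1 x hx]),
        setIntegral_congr_fun mZ (g := fun _ => (0 - e) ^ 2) (fun x hx => by simp only [h0 x hx]),
        setIntegral_const, setIntegral_const, smul_eq_mul, smul_eq_mul, v1] at v2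
      -- The zero set has measure at least 1/2 ≥ T c, so the variance is at least T c (e² + (1 -
      -- e)²) ≥ T c / 2.
      have v3 : T c * (0 - e) ^ 2 ≤ μ.real ((a : X → ℝ) ⁻¹' Set.Iic 0) * (0 - e) ^ 2 := by
        gcongr; linarith
      have v4 : T c * (1 - e) ^ 2 + T c * (0 - e) ^ 2 ≤ ∫ x, φ x ^ 2 ∂μ - e ^ 2 :=
        le_trans (by simp only [hT] at v3 ⊢; linarith) v2
      nlinarith [mul_nonneg hm0.le (sq_nonneg (2 * e - 1))]
    set W := ∫ x in (a : X → ℝ) ⁻¹' Set.Ioc 0 c,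
      g ((a : X → ℝ) x) ^ 2 * carreDuChamp S.L a a x ∂μ with hW
    have hBT := hB (T c) hm0 hm2 hts
    have hB0' := hB0 (T c / 4) (by positivity)
    have k1 : T c / 4 ≤ B (T c / 4) * (1 / R) := by
      have : B (T c / 4) * W ≤ B (T c / 4) * (1 / R) := by gcongr
      norm_num at hwp
      linarith
    rw [mul_one_div, le_div_iff₀ hR] at k1
    have k2 : √(T c) * (√(T c) * R) ≤ √(T c) * K := by rw [← mul_assoc, ← sq, hl2]; linarith
    exact le_of_mul_le_mul_left k2 hl
  set Y := √(∫ x, clamp 0 M ((a : X → ℝ) x) ^ 4 ∂μ) with hY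
  have i4 := S.integrable_clamp_pow a hM 4
  have i2 := S.integrable_clamp_pow a hM 2
  have hY2 : Y ^ 2 = ∫ x, clamp 0 M ((a : X → ℝ) x) ^ 4 ∂μ :=
    Real.sq_sqrt (integral_nonneg fun x => by positivity)
  have hY0 : 0 ≤ Y := Real.sqrt_nonneg _
  set D : ℝ → ℝ := fun c => ∫ x in (a : X → ℝ) ⁻¹' Set.Ici c, clamp 0 M ((a : X → ℝ) x) ^ 2 ∂μ
  have hDa : Antitone D := fun c c' hc => setIntegral_mono_set i2.integrableOn
    (Eventually.of_forall fun x => sq_nonneg _)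
    (LE.le.eventuallyLE (Set.preimage_mono (Set.Ici_subset_Ici.2 hc)))
  have hlayer : Y ^ 2 = ∫ c in (0 : ℝ)..M, 2 * c * D c := by
    rw [hY2, ← integral_clamp_sq_mul (μ := μ) ham
      (H := fun x => clamp 0 M ((a : X → ℝ) x) ^ 2)
      (((continuous_clamp 0 M).measurable.comp ham).pow_const 2) (K := M ^ 2) (fun x => ?_) hM]
    · exact integral_congr_ae (Eventually.of_forall fun x => by simp only; ring)
    · obtain ⟨h1, h2⟩ := clamp_mem hM ((a : X → ℝ) x)
      rw [abs_of_nonneg (sq_nonneg _)]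
      gcongr
  -- Cauchy–Schwarz on a level set. Inserted in the layer formula it gives Y² ≤ Y J, and a factor Y
  -- is cancelled.
  have hDle : ∀ c, D c ≤ √(T c) * Y := fun c => by
    have mA : MeasurableSet ((a : X → ℝ) ⁻¹' Set.Ici c) := ham measurableSet_Ici
    have m1 : MemLp (((a : X → ℝ) ⁻¹' Set.Ici c).indicator fun _ => (1 : ℝ)) 2 μ :=
      (memLp_const 1).indicator mA
    have m2 : MemLp (fun x => clamp 0 M ((a : X → ℝ) x) ^ 2) 2 μ :=
      memLp_of_ae_bounds (lo := 0) (hi := M ^ 2)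
        (((continuous_clamp 0 M).measurable.comp ham).pow_const 2).aestronglyMeasurable
        (Eventually.of_forall fun x => ⟨sq_nonneg _,
          pow_le_pow_left₀ (clamp_mem hM _).1 (clamp_mem hM _).2 2⟩)
    have hcs := sq_integral_mul_le m1 m2
    have e1 : ∫ x, ((a : X → ℝ) ⁻¹' Set.Ici c).indicator (fun _ => (1 : ℝ)) x *
        clamp 0 M ((a : X → ℝ) x) ^ 2 ∂μ = D c := by
      change _ = ∫ x in (a : X → ℝ) ⁻¹' Set.Ici c, clamp 0 M ((a : X → ℝ) x) ^ 2 ∂μ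
      rw [← integral_indicator mA]
      refine integral_congr_ae (Eventually.of_forall fun x => ?_)
      by_cases hx : x ∈ (a : X → ℝ) ⁻¹' Set.Ici c <;> simp [hx]
    have e2 : ∫ x, ((a : X → ℝ) ⁻¹' Set.Ici c).indicator (fun _ => (1 : ℝ)) x ^ 2 ∂μ = T c := by
      rw [hT]
      simp only
      rw [← integral_indicator_one mA]
      refine integral_congr_ae (Eventually.of_forall fun x => ?_)
      by_cases hx : x ∈ (a : X → ℝ) ⁻¹' Set.Ici c <;> simp [hx]
    have e3 : ∫ x, (clamp 0 M ((a : X → ℝ) x) ^ 2) ^ 2 ∂μ = Y ^ 2 := by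
      rw [hY2]
      exact integral_congr_ae (Eventually.of_forall fun x => by simp only; ring)
    rw [e1, e2, e3] at hcs
    refine abs_le_of_sq_le_sq' ?_ (by positivity) |>.2
    rw [mul_pow, Real.sq_sqrt measureReal_nonneg]
    exact hcs
  have hYJ : Y * Y ≤ Y * J := by
    rw [← sq, hlayer]
    calc ∫ c in (0 : ℝ)..M, 2 * c * D c ≤ ∫ c in (0 : ℝ)..M, Y * (2 * c * √(T c)) := by
          refine intervalIntegral.integral_mono_on hM
            (hDa.intervalIntegrable.continuousOn_mul (by fun_prop))
            ((hsTa.intervalIntegrable.continuousOn_mul (by fun_prop)).const_mul _) fun c hc => ?_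
          have := mul_le_mul_of_nonneg_left (hDle c) (show 0 ≤ 2 * c by linarith [hc.1])
          linarith
      _ = Y * ∫ c in (0 : ℝ)..M, 2 * c * √(T c) := intervalIntegral.integral_const_mul _ _
      _ ≤ Y * J := by gcongr
  rcases hY0.eq_or_lt with h0 | h0
  · rw [← h0]
    have : 0 ≤ ∫ x in (a : X → ℝ) ⁻¹' Set.Ioi 0, carreDuChamp S.L a a x ∂μ :=
      setIntegral_nonneg_of_ae (S.carre_nonneg a)
    positivity
  · exact le_of_mul_le_mul_left hYJ h0

end DiffusionGenerator

theorem add_pow_four_le (x y : ℝ) : (x + y) ^ 4 ≤ 8 * x ^ 4 + 8 * y ^ 4 := by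
  have h1 : (x + y) ^ 2 ≤ 2 * (x ^ 2 + y ^ 2) := by nlinarith [sq_nonneg (x - y)]
  have h2 := pow_le_pow_left₀ (sq_nonneg _) h1 2
  nlinarith [sq_nonneg (x ^ 2 - y ^ 2)]

/-- The Hellinger functional is controlled by the fourth moment around a median. -/
theorem sqrt_sub_le_of_median {X : Type*} [MeasurableSpace X] {μ : Measure X}
    [IsProbabilityMeasure μ] {v : X → ℝ} (hvm : AEStronglyMeasurable v μ) {m q : ℝ} (hm0 : 0 ≤ m)
    (hmq : m ≤ q) (hvb : ∀ x, 0 ≤ v x ∧ v x ≤ q) (hmed : 1 / 2 ≤ μ.real {x | m ≤ v x}) :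
    √(∫ x, v x ^ 4 ∂μ) - ∫ x, v x ^ 2 ∂μ ≤ 5 * √(∫ x, (v x - m) ^ 4 ∂μ) := by
  have j2 : Integrable (fun x => v x ^ 2) μ :=
    integrable_pow_of_ae_bounds hvm (Eventually.of_forall hvb) 2
  have j4 : Integrable (fun x => v x ^ 4) μ :=
    integrable_pow_of_ae_bounds hvm (Eventually.of_forall hvb) 4
  set Y := √(∫ x, (v x - m) ^ 4 ∂μ) with hY
  have hV0 : 0 ≤ ∫ x, v x ^ 4 ∂μ := integral_nonneg fun x => by positivity
  set A := √(∫ x, v x ^ 4 ∂μ) with hA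
  have hA0 : 0 ≤ A := Real.sqrt_nonneg _
  have hA2 : A ^ 2 = ∫ x, v x ^ 4 ∂μ := Real.sq_sqrt hV0
  set e := ∫ x, v x ^ 2 ∂μ with he
  have he0 : 0 ≤ e := integral_nonneg fun x => sq_nonneg _
  have hY0 : 0 ≤ Y := Real.sqrt_nonneg _
  -- Markov's inequality at the median level, whose upper set has measure at least 1/2.
  have hm4 : m ^ 4 ≤ 2 * A ^ 2 := by
    rw [hA2]
    have := mul_meas_ge_le_integral_of_nonneg
      (Eventually.of_forall fun x => (by positivity : 0 ≤ v x ^ 4)) j4 (m ^ 4)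
    have h5 : (1 : ℝ) / 2 ≤ μ.real {x | m ^ 4 ≤ v x ^ 4} :=
      hmed.trans (measureReal_mono fun x hx => pow_le_pow_left₀ hm0 hx 4)
    have : m ^ 4 * (1 / 2) ≤ m ^ 4 * μ.real {x | m ^ 4 ≤ v x ^ 4} := by gcongr
    linarith
  have hZ : ∫ x, (v x + m) ^ 4 ∂μ ≤ 24 * A ^ 2 := by
    calc ∫ x, (v x + m) ^ 4 ∂μ ≤ ∫ x, (8 * v x ^ 4 + 8 * m ^ 4) ∂μ := by
          refine integral_mono_of_nonneg (Eventually.of_forall fun x => by positivity)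
            ((j4.const_mul 8).add (integrable_const _)) (Eventually.of_forall fun x => ?_)
          simp only
          exact add_pow_four_le _ _
      _ = 8 * A ^ 2 + 8 * m ^ 4 := by
          rw [integral_add (j4.const_mul 8) (integrable_const _), integral_const_mul, hA2]
          simp
      _ ≤ _ := by linarith
  have hcs : (∫ x, (v x ^ 2 - m ^ 2) ^ 2 ∂μ) ^ 2 ≤ Y ^ 2 * (24 * A ^ 2) := by
    have n1 : MemLp (fun x => (v x - m) ^ 2) 2 μ :=
      memLp_of_ae_bounds (lo := 0) (hi := q ^ 2) ((hvm.sub aestronglyMeasurable_const).pow 2)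
        (Eventually.of_forall fun x => ⟨sq_nonneg _,
          sq_le_sq' (by linarith [(hvb x).1]) (by linarith [(hvb x).2])⟩)
    have n2 : MemLp (fun x => (v x + m) ^ 2) 2 μ :=
      memLp_of_ae_bounds (lo := 0) (hi := (q + q) ^ 2) ((hvm.add aestronglyMeasurable_const).pow 2)
        (Eventually.of_forall fun x => ⟨sq_nonneg _,
          sq_le_sq' (by linarith [(hvb x).1]) (by linarith [(hvb x).2])⟩)
    have := sq_integral_mul_le n1 n2
    have f1 : ∀ x, (v x - m) ^ 2 * (v x + m) ^ 2 = (v x ^ 2 - m ^ 2) ^ 2 := fun x => by ring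
    have f2 : ∀ x, ((v x - m) ^ 2) ^ 2 = (v x - m) ^ 4 := fun x => by ring
    have f3 : ∀ x, ((v x + m) ^ 2) ^ 2 = (v x + m) ^ 4 := fun x => by ring
    simp only [f1, f2, f3] at this
    rw [hY, Real.sq_sqrt (integral_nonneg fun x => by positivity)]
    exact this.trans (mul_le_mul_of_nonneg_left hZ (integral_nonneg fun x => by positivity))
  have hVar : A ^ 2 - e ^ 2 ≤ ∫ x, (v x ^ 2 - m ^ 2) ^ 2 ∂μ := by
    have f1 : ∀ x, (v x ^ 2 - m ^ 2) ^ 2 = v x ^ 4 - 2 * m ^ 2 * v x ^ 2 + m ^ 4 :=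
      fun x => by ring
    simp only [f1]
    have i3 : Integrable (fun x => 2 * m ^ 2 * v x ^ 2) μ := j2.const_mul _
    have i4 : Integrable (fun x => v x ^ 4 - 2 * m ^ 2 * v x ^ 2) μ := j4.sub i3
    rw [integral_add i4 (integrable_const _), integral_sub j4 i3, integral_const_mul, ← hA2]
    simp only [integral_const, probReal_univ, smul_eq_mul]
    nlinarith [sq_nonneg (e - m ^ 2)]
  have hW : ∫ x, (v x ^ 2 - m ^ 2) ^ 2 ∂μ ≤ 5 * (Y * A) := by
    refine abs_le_of_sq_le_sq' ?_ (by positivity) |>.2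
    have : 0 ≤ Y ^ 2 * A ^ 2 := by positivity
    linarith
  -- By now A² - e² ≤ 5YA, while A - e > 0 would give A² - e² ≥ (A - e)A; hence A - e ≤ 5Y. Negating
  -- first secures A > 0.
  by_contra! hcon
  have hA1 : 0 < A := by
    have : 0 ≤ 5 * Y := by positivity
    linarith
  nlinarith [mul_pos (sub_pos.2 hcon) hA1, mul_nonneg hY0 he0, mul_nonneg he0 (sub_pos.2 hcon).le]

/-! ### From the algebra and its truncations to the form domain -/

namespace DiffusionGenerator

variable {X : Type u} [MeasurableSpace X] {μ : Measure X}

theorem RelaxedLE.nonneg {S : DiffusionGenerator X μ} {f : X → ℝ} {C : ℝ}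
    (h : S.RelaxedLE f C) : 0 ≤ C := by
  refine le_of_forall_pos_le_add fun ε hε => ?_
  obtain ⟨a, -, ha⟩ := h ε hε
  exact (S.preForm_nonneg a).trans ha

theorem memLp_sub_coe {S : DiffusionGenerator X μ} [IsProbabilityMeasure μ] {f : X → ℝ}
    (hf : MemLp f 2 μ) (b : S.A) : MemLp (fun x => f x - (b : X → ℝ) x) 2 μ :=
  hf.sub (S.memLp_coe b)

/-- Truncations of elements of the algebra approximate bounded functions. -/
theorem RelaxedLE.exists_clamp_seq {S : DiffusionGenerator X μ} [IsProbabilityMeasure μ]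
    {f : X → ℝ} (hf : AEStronglyMeasurable f μ) {C : ℝ} (h : S.RelaxedLE f C) {p q : ℝ}
    (hpq : p ≤ q) (hb : ∀ᵐ x ∂μ, p ≤ f x ∧ f x ≤ q) :
    ∃ b : ℕ → S.A, (∀ n : ℕ, preForm μ S.L (b n) (b n) ≤ C + 1 / ((n : ℝ) + 1)) ∧
      ∀ k : ℕ, Tendsto (fun n => ∫ x, _root_.clamp p q ((b n : X → ℝ) x) ^ k ∂μ) atTop
        (𝓝 (∫ x, f x ^ k ∂μ)) := by
  have hp : ∀ n : ℕ, 0 < 1 / ((n : ℝ) + 1) := fun n => by positivity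
  choose b hb1 hb2 using fun n : ℕ => h _ (hp n)
  have hf2 : MemLp f 2 μ := memLp_of_ae_bounds hf hb
  refine ⟨b, hb2, fun k => tendsto_integral_pow hf (fun n => (S.memLp_clamp (b n) hpq).1) hb
    (fun n => Eventually.of_forall fun x => clamp_mem hpq _) ?_ k⟩
  refine squeeze_zero (fun n => integral_nonneg fun x => abs_nonneg _) (fun n => ?_)
    tendsto_one_div_add_atTop_nhds_zero_nat
  have hm := memLp_sub_coe hf2 (b n)
  refine le_trans ?_ (integral_abs_le_of_integral_sq_le hm (hp n)
    ((eLpNorm_two_le_ofReal hm (hp n).le).1 (hb1 n)))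
  refine integral_mono_ae (((S.memLp_clamp (b n) hpq).sub hf2).integrable one_le_two).abs
    (hm.integrable one_le_two).abs (hb.mono fun x hx => ?_)
  have := abs_clamp_sub_clamp_le p q ((b n : X → ℝ) x) (f x)
  rw [clamp_of_mem hx.1 hx.2, abs_sub_comm ((b n : X → ℝ) x)] at this
  exact this

/-- An inequality of super-Poincaré type extends from the algebra to the form domain. -/
theorem integral_sq_le_of_forall_coe (S : DiffusionGenerator X μ) [IsProbabilityMeasure μ]
    {C s : ℝ} (hC : 0 ≤ C) (hs : 0 ≤ s)
    (h : ∀ b : S.A, ∫ x, (b : X → ℝ) x ^ 2 ∂μ ≤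
      C * preForm μ S.L b b + s * (∫ x, |(b : X → ℝ) x| ∂μ) ^ 2)
    {f : X → ℝ} (hf : MemLp f 2 μ) {E : ℝ} (hE : S.RelaxedLE f E) :
    ∫ x, f x ^ 2 ∂μ ≤ C * E + s * (∫ x, |f x| ∂μ) ^ 2 := by
  set I := ∫ x, |f x| ∂μ
  -- The L² error is taken of order η², so that the large factor 1 + 1/η of Young's inequality
  -- leaves only (1 + η)η³.
  have key : ∀ η : ℝ, 0 < η →
      ∫ x, f x ^ 2 ∂μ ≤ (1 + η) * (C * (E + η ^ 2) + s * (I + η ^ 2) ^ 2 + η ^ 3) := by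
    intro η hη
    obtain ⟨b, hb1, hb2⟩ := hE (η ^ 2) (by positivity)
    have hm := memLp_sub_coe hf b
    have hbm := S.memLp_coe b
    have hsq := (eLpNorm_two_le_ofReal hm (by positivity)).1 hb1
    have habs := integral_abs_le_of_integral_sq_le hm (by positivity) hsq
    have i1 : Integrable (fun x => (1 + η) * (b : X → ℝ) x ^ 2) μ := hbm.integrable_sq.const_mul _
    have i2 : Integrable (fun x => (1 + 1 / η) * (f x - (b : X → ℝ) x) ^ 2) μ :=
      hm.integrable_sq.const_mul _
    have h1 : ∫ x, f x ^ 2 ∂μ ≤ (1 + η) * ∫ x, (b : X → ℝ) x ^ 2 ∂μ +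
        (1 + 1 / η) * ∫ x, (f x - (b : X → ℝ) x) ^ 2 ∂μ := by
      rw [← integral_const_mul, ← integral_const_mul, ← integral_add i1 i2]
      refine integral_mono hf.integrable_sq (i1.add i2) fun x => ?_
      simp only
      have e : (1 + η) * (b : X → ℝ) x ^ 2 + (1 + 1 / η) * (f x - (b : X → ℝ) x) ^ 2 - f x ^ 2 =
          (η * (b : X → ℝ) x - (f x - (b : X → ℝ) x)) ^ 2 / η := by
        field_simp; ring
      have : 0 ≤ (η * (b : X → ℝ) x - (f x - (b : X → ℝ) x)) ^ 2 / η := by positivity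
      linarith
    have h2 : ∫ x, |(b : X → ℝ) x| ∂μ ≤ I + η ^ 2 := by
      have i3 := (hf.integrable one_le_two).abs
      have i4 := (hm.integrable one_le_two).abs
      have : ∫ x, |(b : X → ℝ) x| ∂μ ≤ I + ∫ x, |f x - (b : X → ℝ) x| ∂μ := by
        rw [← integral_add i3 i4]
        refine integral_mono (hbm.integrable one_le_two).abs (i3.add i4) fun x => ?_
        have := abs_sub (f x) (f x - (b : X → ℝ) x)
        rw [sub_sub_cancel] at this
        exact this
      linarith
    have h3 : (∫ x, |(b : X → ℝ) x| ∂μ) ^ 2 ≤ (I + η ^ 2) ^ 2 :=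
      pow_le_pow_left₀ (integral_nonneg fun x => abs_nonneg _) h2 2
    have h4 : (1 + 1 / η) * ∫ x, (f x - (b : X → ℝ) x) ^ 2 ∂μ ≤ (1 + η) * η ^ 3 := by
      calc _ ≤ (1 + 1 / η) * (η ^ 2) ^ 2 := by gcongr
        _ = _ := by field_simp; ring
    have h5 : ∫ x, (b : X → ℝ) x ^ 2 ∂μ ≤ C * (E + η ^ 2) + s * (I + η ^ 2) ^ 2 :=
      (h b).trans (add_le_add (mul_le_mul_of_nonneg_left hb2 hC) (mul_le_mul_of_nonneg_left h3 hs))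
    have h6 := mul_le_mul_of_nonneg_left h5 (show 0 ≤ 1 + η by positivity)
    linarith
  have hlim : Tendsto (fun η : ℝ => (1 + η) * (C * (E + η ^ 2) + s * (I + η ^ 2) ^ 2 + η ^ 3))
      (𝓝[>] 0) (𝓝 (C * E + s * I ^ 2)) := by
    have : Continuous fun η : ℝ => (1 + η) * (C * (E + η ^ 2) + s * (I + η ^ 2) ^ 2 + η ^ 3) := by
      fun_prop
    have := (this.tendsto 0).mono_left (nhdsWithin_le_nhds (s := Set.Ioi 0))
    simpa using this
  exact ge_of_tendsto hlim (eventually_mem_nhdsWithin.mono fun η hη => key η hη)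

/-- The Hellinger functional of a truncation, under a weak Poincaré inequality. -/
theorem WeakPoincare.sqrt_sub_clamp_le [IsProbabilityMeasure μ]
    {S : DiffusionGenerator X μ} {B : ℝ → ℝ} (h : S.WeakPoincare B) {K s : ℝ} (hK : 0 < K)
    (hs : 0 ≤ s) (hB0 : ∀ t, 0 < t → 0 ≤ B t)
    (hB : ∀ m, 0 < m → m ≤ 1 / 2 → s < √m → 4 * B (m / 4) ≤ K * √m)
    (b : S.A) {p q : ℝ} (hp : 0 ≤ p) (hpq : p ≤ q) :
    √(∫ x, clamp p q ((b : X → ℝ) x) ^ 4 ∂μ) - ∫ x, clamp p q ((b : X → ℝ) x) ^ 2 ∂μ ≤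
      5 * (8 * K * preForm μ S.L b b + s * (q - p) ^ 2) := by
  obtain ⟨m, hpm, hmq, hmed, a₁, a₂, h₁, h₂, hsplit, hE⟩ := S.exists_median b hpq
  have A₁ := h.sqrt_integral_clamp_pow_four_le hK hs hB0 hB a₁ (sub_nonneg.2 hmq) h₁
  have A₂ := h.sqrt_integral_clamp_pow_four_le hK hs hB0 hB a₂ (sub_nonneg.2 hpm) h₂
  set v : X → ℝ := fun x => clamp p q ((b : X → ℝ) x) with hv
  have hvm : AEStronglyMeasurable v μ := (S.memLp_clamp b hpq).1
  have hvb : ∀ x, p ≤ v x ∧ v x ≤ q := fun x => clamp_mem hpq _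
  have hm0 : 0 ≤ m := hp.trans hpm
  have e2 : ∫ x, (v x - m) ^ 4 ∂μ =
      ∫ x, clamp 0 (q - m) ((a₁ : X → ℝ) x) ^ 4 ∂μ +
        ∫ x, clamp 0 (m - p) ((a₂ : X → ℝ) x) ^ 4 ∂μ := by
    rw [← integral_add (S.integrable_clamp_pow a₁ (sub_nonneg.2 hmq) 4)
      (S.integrable_clamp_pow a₂ (sub_nonneg.2 hpm) 4)]
    exact integral_congr_ae (Eventually.of_forall fun x =>
      hsplit x 4 (by decide) (by norm_num))
  set Y := √(∫ x, (v x - m) ^ 4 ∂μ) with hY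
  have hYle : Y ≤ 8 * K * preForm μ S.L b b + s * (q - p) ^ 2 := by
    have h0 : Y ≤ √(∫ x, clamp 0 (q - m) ((a₁ : X → ℝ) x) ^ 4 ∂μ) +
        √(∫ x, clamp 0 (m - p) ((a₂ : X → ℝ) x) ^ 4 ∂μ) := by
      rw [hY, e2]
      refine Real.sqrt_le_iff.2 ⟨by positivity, ?_⟩
      rw [add_sq, Real.sq_sqrt (integral_nonneg fun x => by positivity),
        Real.sq_sqrt (integral_nonneg fun x => by positivity)]
      have : 0 ≤ 2 * √(∫ x, clamp 0 (q - m) ((a₁ : X → ℝ) x) ^ 4 ∂μ) *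
        √(∫ x, clamp 0 (m - p) ((a₂ : X → ℝ) x) ^ 4 ∂μ) := by positivity
      linarith
    have h3 : s * ((q - m) ^ 2 + (m - p) ^ 2) ≤ s * (q - p) ^ 2 := by
      gcongr
      nlinarith [mul_nonneg (sub_nonneg.2 hmq) (sub_nonneg.2 hpm)]
    have h4 := mul_le_mul_of_nonneg_left hE (show 0 ≤ 8 * K by positivity)
    linarith
  refine (sqrt_sub_le_of_median hvm hm0 hmq (fun x => ⟨hp.trans (hvb x).1, (hvb x).2⟩) hmed).trans ?_
  exact mul_le_mul_of_nonneg_left hYle (by norm_num)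

end DiffusionGenerator

/-! ### The numerical constant and the three implications -/

/-- The constant in the definition of `gammaH`. -/
noncomputable def gammaConst : ℝ := (√2 - 1) / (2 * √2)

/-- Tight enough for 54.6 times the constant to stay below 8, and to separate it from the thresholds
0.1464 and 0.1465 in the ranges of t. -/
theorem gammaConst_bounds : 0.14644 ≤ gammaConst ∧ gammaConst ≤ 0.14645 := by
  have h2 : √2 ^ 2 = 2 := Real.sq_sqrt (by norm_num)
  have h1 : 1.41421 ≤ √2 := Real.le_sqrt_of_sq_le (by norm_num)
  have h3 : √2 ≤ 1.41422 := Real.sqrt_le_iff.2 ⟨by norm_num, by norm_num⟩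
  unfold gammaConst
  constructor
  · rw [le_div_iff₀ (by positivity)]; linarith
  · rw [div_le_iff₀ (by positivity)]; linarith

theorem gammaConst_pos : 0 < gammaConst := lt_of_lt_of_le (by norm_num) gammaConst_bounds.1

theorem gammaH_nonneg {β : ℝ → ℝ} (hβ : ∀ s, 0 < s → 0 ≤ β s) {s : ℝ} (hs : 0 < s) :
    0 ≤ gammaH β s :=
  mul_nonneg (Real.sqrt_nonneg _) (hβ _ (mul_pos gammaConst_pos (Real.sqrt_pos.2 hs)))

theorem gammaH_sq_div (β : ℝ → ℝ) {t : ℝ} (ht : 0 < t) :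
    β t = gammaConst * gammaH β ((t / gammaConst) ^ 2) / t := by
  have hk := gammaConst_pos
  have e : √((t / gammaConst) ^ 2) = t / gammaConst := Real.sqrt_sq (by positivity)
  have e2 : gammaConst * (t / gammaConst) = t := by field_simp
  unfold gammaH
  rw [e, ← gammaConst, e2]
  field_simp

namespace DiffusionGenerator

variable {X : Type u} [MeasurableSpace X] {μ : Measure X}

/-- A uniform bound on γ_H over the rescaled range of t is a bound on β(t) of the form θ/t. Part 1
and part 2 differ in the direction of monotonicity of γ_H, hence in the range I. -/
theorem Hellinger.rate [IsProbabilityMeasure μ] {S : DiffusionGenerator X μ} {β : ℝ → ℝ}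
    (h : S.Hellinger β) (hβ : ∀ s, 0 < s → 0 ≤ β s) {I : Set ℝ} {G : ℝ}
    (hG : ∀ t ∈ I, 0 < t → gammaH β ((t / gammaConst) ^ 2) ≤ G) :
    S.HellingerRate (gammaConst * G) I := by
  intro t ht ht0 φ lo C hφ hlo hlo1 hb hC
  have h1 := h.relaxed ht0 (hβ t ht0) hφ.aestronglyMeasurable hC hlo hlo1 (Eventually.of_forall hb)
  have h2 : β t * C ≤ gammaConst * G * C / t := by
    rw [gammaH_sq_div β ht0, div_mul_eq_mul_div]
    have := hG t ht ht0
    have := hC.nonneg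
    have := gammaConst_pos
    gcongr
  rw [one_pow] at h1
  linarith

theorem energy_nonneg (S : DiffusionGenerator X μ) [IsFiniteMeasure μ] {f : X → ℝ}
    (hf : f ∈ S.friedrichsDomain) : 0 ≤ S.energy f := by
  obtain ⟨hf2, a, ha, -⟩ := hf
  exact ge_of_tendsto' (S.tendsto_energy hf2 ha) fun n => S.preForm_nonneg _

theorem Hellinger.weakPoincare [IsProbabilityMeasure μ] {S : DiffusionGenerator X μ} {β : ℝ → ℝ}
    (h : S.Hellinger β) (hβ : ∀ s, 0 < s → 0 ≤ β s)
    (hγ : AntitoneOn (gammaH β) (Set.Ioo 0 (1 / 2))) :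
    S.WeakPoincare fun s => 12 * gammaH β s := by
  intro s hs f hf hfb
  have hE := S.energy_nonneg hf
  have hγ0 := gammaH_nonneg hβ hs
  have hb := hfb.ae_mem
  obtain ⟨hf2, a, ha, -⟩ := hf
  have hpq : essInf f μ ≤ essSup f μ := by
    obtain ⟨x, hx⟩ := hb.exists
    exact hx.1.trans hx.2
  unfold osc
  -- For s ≥ 1/4 Popoviciu's bound on the variance already suffices.
  rcases le_or_gt (1 / 4) s with hs4 | hs4
  · have := ProbabilityTheory.variance_le_sq_of_bounded (X := f) (μ := μ) hb hf2.1.aemeasurable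
    have h2 : 1 / 4 * (essSup f μ - essInf f μ) ^ 2 ≤ s * (essSup f μ - essInf f μ) ^ 2 := by gcongr
    have h3 : 0 ≤ 12 * gammaH β s * S.energy f := by positivity
    linarith
  · have hk := gammaConst_bounds
    have hk0 := gammaConst_pos
    -- The range of t keeps (t / gammaConst)² in [s, 1/2), where γ_H is at most γ_H(s).
    have hrate : S.HellingerRate (gammaConst * gammaH β s) (Set.Icc (0.1465 * √s) 0.1) := by
      refine h.rate hβ fun t ht ht0 => hγ ⟨hs, by linarith⟩ ⟨by positivity, ?_⟩ ?_
      · rw [div_pow, div_lt_iff₀ (by positivity)]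
        nlinarith [ht.2]
      · rw [div_pow, le_div_iff₀ (by positivity)]
        have h1 : gammaConst * √s ≤ t := by
          have := Real.sqrt_nonneg s
          have := ht.1
          nlinarith
        have h2 := pow_le_pow_left₀ (by positivity) h1 2
        rw [mul_pow, Real.sq_sqrt hs.le] at h2
        linarith
    obtain ⟨b, hbE, hlim⟩ := (S.relaxedLE_of_isApprox hf2 ha).exists_clamp_seq hf2.1 hpq hb
    have hl := (hlim 2).sub ((hlim 1).pow 2)
    rw [variance_eq_of_ae_bounds hf2]
    have hr : Tendsto (fun n : ℕ => 12 * gammaH β s * (S.energy f + 1 / ((n : ℝ) + 1)) +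
        s * (essSup f μ - essInf f μ) ^ 2) atTop
        (𝓝 (12 * gammaH β s * (S.energy f + 0) + s * (essSup f μ - essInf f μ) ^ 2)) :=
      ((tendsto_one_div_add_atTop_nhds_zero_nat.const_add _).const_mul _).add_const _
    rw [add_zero] at hr
    refine le_of_tendsto_of_tendsto' hl hr fun n => ?_
    have := hrate.variance_clamp_le (by positivity) hs.le hs4 (b n) hpq
    simp only [pow_one]
    refine this.trans ?_
    gcongr ?_ + _
    have h0 : 0 ≤ S.energy f + 1 / ((n : ℝ) + 1) := (S.preForm_nonneg _).trans (hbE n)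
    calc 54.6 * (gammaConst * gammaH β s) * preForm μ S.L (b n) (b n) ≤
          54.6 * (gammaConst * gammaH β s) * (S.energy f + 1 / ((n : ℝ) + 1)) := by
          gcongr
          exact hbE n
      _ ≤ _ := by
          refine mul_le_mul_of_nonneg_right ?_ h0
          nlinarith

theorem WeakPoincare.hellinger [IsProbabilityMeasure μ] {S : DiffusionGenerator X μ} {β : ℝ → ℝ}
    (h : S.WeakPoincare fun s => 12 * gammaH β s) (hβ : ∀ s, 0 < s → 0 ≤ β s)
    (hanti : AntitoneOn β (Set.Ioi 0)) :
    S.Hellinger fun s => 960 * β (gammaConst / 10 * s) := by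
  intro s hs f hf hfb
  have hk0 := gammaConst_pos
  obtain ⟨hf2, a, ha, -⟩ := hf
  obtain ⟨D, hD⟩ := hfb
  have hsqb : EssBounded μ fun x => f x ^ 2 := ⟨D ^ 2, hD.mono fun x hx => by
    rw [abs_pow]
    exact pow_le_pow_left₀ (abs_nonneg _) hx 2⟩
  have hb2 := hsqb.ae_mem
  unfold osc
  set P := essInf (fun x => f x ^ 2) μ
  set Q := essSup (fun x => f x ^ 2) μ
  have hP : 0 ≤ P := by
    have h1 : IsBoundedUnder (· ≤ ·) (ae μ) fun x => f x ^ 2 :=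
      ⟨Q, by simpa using hb2.mono fun x hx => hx.2⟩
    exact le_essInf_of_ae_le 0 (Eventually.of_forall fun x => sq_nonneg _)
      h1.isCoboundedUnder_ge
  have hPQ : P ≤ Q := by
    obtain ⟨x, hx⟩ := hb2.exists
    exact hx.1.trans hx.2
  have hpq : √P ≤ √Q := Real.sqrt_le_sqrt hPQ
  have hb : ∀ᵐ x ∂μ, √P ≤ |f x| ∧ |f x| ≤ √Q := hb2.mono fun x hx => by
    rw [← Real.sqrt_sq_eq_abs]
    exact ⟨Real.sqrt_le_sqrt hx.1, Real.sqrt_le_sqrt hx.2⟩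
  have hβ0 : 0 ≤ β (gammaConst / 10 * s) := hβ _ (by positivity)
  have habs : AEStronglyMeasurable (fun x => |f x|) μ := hf2.1.norm
  obtain ⟨b, hbE, hlim⟩ := ((S.relaxedLE_of_isApprox hf2 ha).abs hf2.1).exists_clamp_seq habs hpq hb
  have hl := (hlim 4).sqrt.sub (hlim 2)
  have e4 : ∀ x, |f x| ^ 4 = f x ^ 4 := fun x => (by decide : Even 4).pow_abs _
  simp only [e4, sq_abs] at hl
  set E := S.energy f
  -- The Hardy shift K must be positive even where β vanishes; η is removed at the end.
  have key : ∀ η : ℝ, 0 < η → √(∫ x, f x ^ 4 ∂μ) - ∫ x, f x ^ 2 ∂μ ≤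
      40 * (24 * β (gammaConst / 10 * s) + η) * E + s * (Q - P) := by
    intro η hη
    have hr : Tendsto (fun n : ℕ => 40 * (24 * β (gammaConst / 10 * s) + η) *
        (E + 1 / ((n : ℝ) + 1)) + s * (Q - P)) atTop
        (𝓝 (40 * (24 * β (gammaConst / 10 * s) + η) * (E + 0) + s * (Q - P))) :=
      ((tendsto_one_div_add_atTop_nhds_zero_nat.const_add _).const_mul _).add_const _
    rw [add_zero] at hr
    refine le_of_tendsto_of_tendsto' hl hr fun n => ?_
    -- The median estimate costs 5, hence s/5. For √m > s/5, antitonicity gives β(gammaConst √m / 2)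
    -- ≤ β(gammaConst s / 10), and 4 · 12 / 2 = 24 is the factor in K; in the end 5 · 8 · 24 = 960.
    have := h.sqrt_sub_clamp_le (K := 24 * β (gammaConst / 10 * s) + η) (s := s / 5)
      (by positivity) (by positivity)
      (fun t ht => mul_nonneg (by norm_num) (gammaH_nonneg hβ ht)) (fun m hm0 _ hm => ?_)
      (b n) (Real.sqrt_nonneg P) hpq
    · refine this.trans ?_
      have h1 : (√Q - √P) ^ 2 ≤ Q - P := by
        have h2 := Real.sq_sqrt hP
        have h3 := Real.sq_sqrt (hP.trans hPQ)
        nlinarith [mul_nonneg (Real.sqrt_nonneg P) (sub_nonneg.2 hpq)]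
      have h4 := mul_le_mul_of_nonneg_left h1 hs.le
      have h5 := mul_le_mul_of_nonneg_left (hbE n)
        (show 0 ≤ 40 * (24 * β (gammaConst / 10 * s) + η) by positivity)
      linarith
    · have e : √(m / 4) = √m / 2 := by
        rw [show m / 4 = m / 2 ^ 2 by norm_num, Real.sqrt_div' _ (by positivity),
          Real.sqrt_sq (by norm_num)]
      have hsm : 0 < √m := Real.sqrt_pos.2 hm0
      simp only [gammaH, e]
      rw [← gammaConst]
      have h1 : β (gammaConst * (√m / 2)) ≤ β (gammaConst / 10 * s) :=
        hanti (show (0 : ℝ) < _ by positivity) (show (0 : ℝ) < _ by positivity) (by nlinarith)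
      nlinarith [mul_nonneg hsm.le (sub_nonneg.2 h1), mul_pos hsm hη]
  have hlim0 : Tendsto (fun η : ℝ => 40 * (24 * β (gammaConst / 10 * s) + η) * E + s * (Q - P))
      (𝓝[>] 0) (𝓝 (40 * (24 * β (gammaConst / 10 * s) + 0) * E + s * (Q - P))) :=
    ((by fun_prop : Continuous fun η : ℝ => 40 * (24 * β (gammaConst / 10 * s) + η) * E +
      s * (Q - P)).tendsto 0).mono_left nhdsWithin_le_nhds
  have := ge_of_tendsto hlim0 (eventually_mem_nhdsWithin.mono fun η hη => key η hη)
  linarith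

theorem Hellinger.superPoincare [IsProbabilityMeasure μ] {S : DiffusionGenerator X μ} {β : ℝ → ℝ}
    (h : S.Hellinger β) (hβ : ∀ s, 0 < s → 0 ≤ β s)
    (hγ : AntitoneOn (fun s => gammaH β (1 / s)) (Set.Ici 2)) :
    S.SuperPoincare fun s => if 2 ≤ s then 8 * gammaH β (1 / s) else 8 * gammaH β (1 / 2) := by
  have hk := gammaConst_bounds
  have hk0 := gammaConst_pos
  have mono : ∀ u v, 0 < u → u ≤ v → v ≤ 1 / 2 → gammaH β u ≤ gammaH β v := fun u v hu huv hv => by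
    have := hγ (a := 1 / v) (b := 1 / u)
      (by rw [Set.mem_Ici, le_div_iff₀ (hu.trans_le huv)]; linarith)
      (by rw [Set.mem_Ici, le_div_iff₀ hu]; linarith) (one_div_le_one_div_of_le hu huv)
    simpa using this
  -- The monotonicity makes γ_H at most γ_H(1/2) on (0, 1/2], so the variance bound holds with δ =
  -- 0. This is a Poincaré inequality, and (∫ b)² ≤ s(∫ |b|)² because s ≥ 1.
  have low : ∀ s, 1 ≤ s → ∀ b : S.A, ∫ x, (b : X → ℝ) x ^ 2 ∂μ ≤
      8 * gammaH β (1 / 2) * preForm μ S.L b b + s * (∫ x, |(b : X → ℝ) x| ∂μ) ^ 2 := by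
    intro s hs b
    have hγ0 := gammaH_nonneg hβ (s := 1 / 2) (by norm_num)
    have hE := S.preForm_nonneg b
    have hrate : S.HellingerRate (gammaConst * gammaH β (1 / 2)) (Set.Icc (0.1465 * √0) 0.1) := by
      refine h.rate hβ fun t ht ht0 => mono _ _ (by positivity) ?_ le_rfl
      rw [div_pow, div_le_iff₀ (by positivity)]
      nlinarith [ht.2]
    obtain ⟨K, hK⟩ := S.bounded_of_mem b b.2
    obtain ⟨x₀⟩ : Nonempty X := nonempty_of_isProbabilityMeasure μ
    have hK0 : 0 ≤ K := (abs_nonneg _).trans (hK x₀)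
    have := hrate.variance_clamp_le (by positivity) le_rfl (by norm_num) b (p := -K) (q := K)
      (by linarith)
    simp only [clamp_of_mem (abs_le.1 (hK _)).1 (abs_le.1 (hK _)).2] at this
    have h1 : (∫ x, (b : X → ℝ) x ∂μ) ^ 2 ≤ (∫ x, |(b : X → ℝ) x| ∂μ) ^ 2 :=
      sq_le_sq.2 ((abs_integral_le_integral_abs).trans (le_abs_self _))
    have h2 : 54.6 * (gammaConst * gammaH β (1 / 2)) * preForm μ S.L b b ≤
        8 * gammaH β (1 / 2) * preForm μ S.L b b := by
      refine mul_le_mul_of_nonneg_right ?_ (S.preForm_nonneg b)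
      nlinarith
    nlinarith [sq_nonneg (∫ x, |(b : X → ℝ) x| ∂μ)]
  intro s hs f hf
  obtain ⟨hf2, a, ha, -⟩ := hf
  have hrel := S.relaxedLE_of_isApprox hf2 ha
  have hs0 : 0 ≤ s := by linarith
  rcases le_or_gt s 2 with hs2 | hs2
  · have e : (if 2 ≤ s then 8 * gammaH β (1 / s) else 8 * gammaH β (1 / 2)) =
        8 * gammaH β (1 / 2) := by
      split_ifs with h2
      · rw [le_antisymm hs2 h2]
      · rfl
    simp only [e]
    exact S.integral_sq_le_of_forall_coe
      (mul_nonneg (by norm_num) (gammaH_nonneg hβ (by norm_num))) hs0 (low s hs) hf2 hrel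
  · simp only [if_pos hs2.le]
    have hu0 : 0 < 1 / s := by positivity
    have hu : 1 / s < 1 / 2 := one_div_lt_one_div_of_lt (by norm_num) hs2
    have hγ0 := gammaH_nonneg hβ hu0
    refine S.integral_sq_le_of_forall_coe (by positivity) hs0 (fun b => ?_) hf2 hrel
    have hrate : S.HellingerRate (gammaConst * gammaH β (1 / s)) (Set.Iic (0.1464 * √(1 / s))) := by
      refine h.rate hβ fun t ht ht0 => mono _ _ (by positivity) ?_ hu.le
      rw [div_pow, div_le_iff₀ (by positivity)]
      have h1 : t ≤ gammaConst * √(1 / s) := (show t ≤ 0.1464 * √(1 / s) from ht).trans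
        (mul_le_mul_of_nonneg_right (by linarith) (Real.sqrt_nonneg _))
      have h2 := pow_le_pow_left₀ ht0.le h1 2
      rw [mul_pow, Real.sq_sqrt hu0.le] at h2
      linarith
    have A₁ := hrate.integral_posPart_sq_le_add (by positivity) hu0 hu b
    have A₂ := hrate.integral_posPart_sq_le_add (by positivity) hu0 hu (-b)
    have hbm := S.measurable_of_mem b b.2
    have hneg : ∀ x, ((-b : S.A) : X → ℝ) x = -(b : X → ℝ) x := fun x => by simp
    have hs2' : ((-b : S.A) : X → ℝ) ⁻¹' Set.Ioi 0 = (b : X → ℝ) ⁻¹' Set.Iio 0 := by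
      ext x; simp
    have hg : ∫ x in ((-b : S.A) : X → ℝ) ⁻¹' Set.Ioi 0, carreDuChamp S.L (-b) (-b) x ∂μ =
        ∫ x in (b : X → ℝ) ⁻¹' Set.Iio 0, carreDuChamp S.L b b x ∂μ := by
      rw [hs2']
      exact integral_congr_ae (ae_restrict_of_ae (S.carre_neg b))
    rw [hg] at A₂
    simp only [hneg] at A₂
    have hi := S.integrable_carre b b
    have hdis : Disjoint (Set.Ioi (0 : ℝ)) (Set.Iio 0) :=
      Set.disjoint_left.2 fun t h1 h2 => lt_asymm (show 0 < t from h1) h2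
    have hsum : ∫ x in (b : X → ℝ) ⁻¹' Set.Ioi 0, carreDuChamp S.L b b x ∂μ +
        ∫ x in (b : X → ℝ) ⁻¹' Set.Iio 0, carreDuChamp S.L b b x ∂μ ≤ preForm μ S.L b b := by
      rw [← setIntegral_union (hdis.preimage _) (hbm measurableSet_Iio)
        hi.integrableOn hi.integrableOn]
      exact setIntegral_le_integral hi (S.carre_nonneg b)
    have mb := S.memLp_coe b
    have mp : MemLp (fun x => max ((b : X → ℝ) x) 0) 2 μ := mb.pos_part
    have mn : MemLp (fun x => max (-(b : X → ℝ) x) 0) 2 μ := mb.neg_part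
    have e1 : ∫ x, (b : X → ℝ) x ^ 2 ∂μ =
        ∫ x, max ((b : X → ℝ) x) 0 ^ 2 ∂μ + ∫ x, max (-(b : X → ℝ) x) 0 ^ 2 ∂μ := by
      rw [← integral_add mp.integrable_sq mn.integrable_sq]
      refine integral_congr_ae (Eventually.of_forall fun x => ?_)
      rcases le_total ((b : X → ℝ) x) 0 with hx | hx <;> simp [hx]
    have e2 : ∫ x, |(b : X → ℝ) x| ∂μ =
        ∫ x, max ((b : X → ℝ) x) 0 ∂μ + ∫ x, max (-(b : X → ℝ) x) 0 ∂μ := by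
      rw [← integral_add (mp.integrable one_le_two) (mn.integrable one_le_two)]
      refine integral_congr_ae (Eventually.of_forall fun x => ?_)
      rcases le_total ((b : X → ℝ) x) 0 with hx | hx
      · simp [hx, abs_of_nonpos hx]
      · simp [hx, abs_of_nonneg hx]
    have n1 : 0 ≤ ∫ x, max ((b : X → ℝ) x) 0 ∂μ := integral_nonneg fun x => le_max_right _ _
    have n2 : 0 ≤ ∫ x, max (-(b : X → ℝ) x) 0 ∂μ := integral_nonneg fun x => le_max_right _ _
    rw [div_div_eq_mul_div, div_one] at A₁ A₂
    rw [e1, e2]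
    set c₁ := ∫ x, max ((b : X → ℝ) x) 0 ∂μ
    set c₂ := ∫ x, max (-(b : X → ℝ) x) 0 ∂μ
    -- Positive and negative parts are treated separately; superadditivity of the square recombines
    -- their L¹ terms without loss of constant.
    have h3 : s * (c₁ ^ 2 + c₂ ^ 2) ≤ s * (c₁ + c₂) ^ 2 := by
      gcongr
      nlinarith [mul_nonneg n1 n2]
    have h4 := mul_le_mul_of_nonneg_left hsum
      (show 0 ≤ 54.6 * (gammaConst * gammaH β (1 / s)) by positivity)
    have h5 : 54.6 * (gammaConst * gammaH β (1 / s)) * preForm μ S.L b b ≤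
        8 * gammaH β (1 / s) * preForm μ S.L b b := by
      refine mul_le_mul_of_nonneg_right ?_ (S.preForm_nonneg b)
      nlinarith
    linarith

end DiffusionGenerator

theorem corollary4p3 :
    (∀ (X : Type u) [MeasurableSpace X] (μ : Measure X) [IsProbabilityMeasure μ]
      (S : DiffusionGenerator X μ) (β : ℝ → ℝ),
      (∀ s : ℝ, 0 < s → 0 ≤ β s) → AntitoneOn β (Set.Ioi 0) →
      AntitoneOn (gammaH β) (Set.Ioo 0 (1 / 2)) →
      S.Hellinger β → S.WeakPoincare (fun s => 12 * gammaH β s)) ∧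
    (∃ c c' : ℝ, 0 < c ∧ 0 < c' ∧
      ∀ (X : Type u) [MeasurableSpace X] (μ : Measure X) [IsProbabilityMeasure μ]
        (S : DiffusionGenerator X μ) (β : ℝ → ℝ),
        (∀ s : ℝ, 0 < s → 0 ≤ β s) → AntitoneOn β (Set.Ioi 0) →
        AntitoneOn (gammaH β) (Set.Ioo 0 (1 / 2)) →
        S.WeakPoincare (fun s => 12 * gammaH β s) → S.Hellinger (fun s => c * β (c' * s))) ∧
    (∀ (X : Type u) [MeasurableSpace X] (μ : Measure X) [IsProbabilityMeasure μ]
      (S : DiffusionGenerator X μ) (β : ℝ → ℝ),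
      (∀ s : ℝ, 0 < s → 0 ≤ β s) → AntitoneOn β (Set.Ioi 0) →
      AntitoneOn (fun s => gammaH β (1 / s)) (Set.Ici 2) →
      MonotoneOn (fun s => s * gammaH β (1 / s)) (Set.Ioi 2) →
      S.Hellinger β →
      S.SuperPoincare (fun s => if 2 ≤ s then 8 * gammaH β (1 / s) else 8 * gammaH β (1 / 2))) := by
  refine ⟨fun X _ μ _ S β hβ _ hγ h => h.weakPoincare hβ hγ, ?_,
    fun X _ μ _ S β hβ _ hγ _ h => h.superPoincare hβ hγ⟩
  exact ⟨960, gammaConst / 10, by norm_num, div_pos gammaConst_pos (by norm_num),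
    fun X _ μ _ S β hβ hanti _ h => h.hellinger hβ hanti⟩
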